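/- Let $\mathbb{M}_n$ denote the (finite) set of all matroids with ground set $\{1,\ldots,n\}$. For a matroid $M$ of rank $r\ge 1$ on a finite ground set $E$, the truncation $T(M)$ is the matroid on $E$ whose independent sets are the sets $X\subseteq E$ that are independent in $M$ and satisfy $|X|\le r-1$; for a matroid $M$ of rank $0$ put $T(M)=M$. **Theorem 5.4.** Asymptotically almost no matroids arise as the truncation of another matroid, that is, $$\frac{\left|\{N\in\mathbb{M}_n : N=T(M)\text{ for some matroid } M\neq N\}\right|}{|\mathbb{M}_n|}\longrightarrow 0\qquad\text{as } n\to\infty .$$ -/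

import Mathlib

namespace MatroidTruncation

open Set Filter Topology

/-- The truncation `T(M)` of a matroid `M` of finite rank `r`: the matroid on the same ground set
whose independent sets are the independent sets of `M` with at most `r - 1` elements.
The subtraction is truncated, so that a matroid of rank `0` (for which the family of sets with at
most `-1` elements would not be a matroid) is its own truncation. -/
noncomputable def truncation {α : Type*} (M : Matroid α) [M.RankFinite] : Matroid α :=
  (IndepMatroid.ofBddAugment
    (E := M.E)
    (Indep := fun I ↦ M.Indep I ∧ I.encard ≤ M.eRank - 1)
    (indep_empty := ⟨M.empty_indep, by simp⟩)
    (indep_subset := fun _ _ hJ hIJ ↦ ⟨hJ.1.subset hIJ, (Set.encard_le_encard hIJ).trans hJ.2⟩)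
    (indep_aug := by
      rintro I J ⟨hI, -⟩ ⟨hJ, hJr⟩ hlt
      obtain ⟨e, he, heI⟩ := hI.augment hJ hlt
      refine ⟨e, he.1, he.2, heI, ?_⟩
      rw [Set.encard_insert_of_notMem he.2]
      exact (Order.add_one_le_of_lt hlt).trans hJr)
    (indep_bdd := by
      obtain ⟨B, hB⟩ := M.exists_isBase
      refine ⟨B.ncard, fun I hI ↦ ?_⟩
      rw [hB.finite.cast_ncard_eq, hB.encard_eq_eRank]
      exact hI.1.encard_le_eRank)
    (subset_ground := fun _ hI ↦ hI.1.subset_ground)).matroid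

theorem truncation_ground {α : Type*} (M : Matroid α) [M.RankFinite] :
    (truncation M).E = M.E := rfl

theorem truncation_indep_iff {α : Type*} (M : Matroid α) [M.RankFinite] (I : Set α) :
    (truncation M).Indep I ↔ M.Indep I ∧ I.encard ≤ M.eRank - 1 := Iff.rfl

/-- The set `𝕄ₙ` of all (labelled) matroids whose ground set is the standard `n`-element set
`Fin n`. -/
def matroidsOn (n : ℕ) : Set (Matroid (Fin n)) := {M | M.E = univ}

/-- There are finitely many matroids on `Fin n`, so that the cardinalities `Set.ncard` of sets of
such matroids are the true ones. -/
theorem finite_matroid (n : ℕ) : Finite (Matroid (Fin n)) :=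
  Finite.of_injective (fun M : Matroid (Fin n) ↦ (M.E, M.Indep)) fun M N h ↦ by
    simp only [Prod.mk.injEq] at h
    exact Matroid.ext_indep h.1 fun I _ ↦ by rw [h.2]

/-- A class of matroids, given by its members on each of the ground sets `Fin n`, is thin
(asymptotically almost no matroid belongs to it) if the fraction of the matroids with ground set
`Fin n` which belong to the class tends to `0`. -/
def IsThin (C : ∀ n : ℕ, Set (Matroid (Fin n))) : Prop :=
  Tendsto (fun n : ℕ ↦ ((C n ∩ matroidsOn n).ncard : ℝ) / ((matroidsOn n).ncard : ℝ))
    atTop (𝓝 0)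

/-- `N` arises as the truncation of another matroid. (The truncation has the same ground set as the
matroid that is truncated, so only matroids on the ground set of `N` have to be considered.) -/
def IsTruncationOfAnother {n : ℕ} (N : Matroid (Fin n)) : Prop :=
  ∃ M : Matroid (Fin n), M ≠ N ∧ truncation M = N

end MatroidTruncation

namespace MatroidTruncation

set_option linter.unusedSectionVars false

open Finset

/-! Lower bound: every stable family of `r`-sets, `0 < r < n`, is the family of non-basic `r`-sets
of a matroid (`sparsePaving`). So there are at least as many matroids as stable families of any such
size, and, taking subfamilies of one large stable family, at least about `2 ^ (n.choose (n / 2) /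
n)` of them.

Encoding: conversely, a matroid of rank `r` is determined by its certificate (the heavy circuits and
heavy cocircuits) together with its core, a stable family of `r`-sets (`stable_core`, `core_ext`).
Certificates are few, so counting matroids amounts to counting stable families. If the cores in some
class can be modified independently in `k` places, remaining stable, and the modification can be
undone with little extra information, then the class is smaller than the set of all stable families
by a factor of about `2 ^ k` (`card_mul_two_pow_le`). It remains to make `k` exceed the number of
bits that had to be fixed.

Let `N`, of rank `r`, be a truncation of `M`, of rank `r + 1`. If `r` or `n - r` is tiny, there are
too few `r`-sets to matter. Otherwise look at the circuits lying properly inside members of the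
core. If there are many, one element outside such a circuit can be exchanged in many core members
(`exists_moves_of_coreCircuits`). If there are few, they can be written down, and then the core is
known up to its members that are themselves circuits. If those are few as well, everything can be
written down.

The last case is the only one that uses truncation. A core member `X` that is a circuit of `N` is a
circuit of `M` too, so no cocircuit of `M` meets it in exactly one element. For all but few `X` some
small cocircuit `D` of `M` avoids `X`, since otherwise `X` would lie in too many spanning sets of
`M` of nullity one (`card_not_avoiding_mul_le`); moreover `D` is unique
(`uniquelyAvoided_smallCocircuits`). Once the small cocircuits of `M` are known, replacing an
element `f` of `X` by a fixed element of `D` can be undone, and these exchanges conflict only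
through two-element intersections of `X` with cocircuits. Few sets have many of those
(`card_mul_choose_le`), so again there are many independent modifications.

Each case is bounded by `2 ^ (-n)` times the number of matroids; three cases and `n + 1` ranks give
the proportion `3 * (n + 1) / 2 ^ n`. -/

/-- A family of sets is stable if distinct members differ in at least two elements; for families
of sets of the same size, this is stability in the Johnson graph. -/
def Stable {α : Type*} [DecidableEq α] (I : Finset (Finset α)) : Prop :=
  ∀ X ∈ I, ∀ Y ∈ I, X ≠ Y → 2 ≤ (X \ Y).card

theorem Stable.mono {α : Type*} [DecidableEq α] {I J : Finset (Finset α)} (hJ : Stable J)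
    (h : I ⊆ J) : Stable I :=
  fun X hX Y hY hne ↦ hJ X (h hX) Y (h hY) hne

/-- The stable families of `r`-subsets of `Fin n`. -/
noncomputable def stableFamilies (n r : ℕ) : Finset (Finset (Finset (Fin n))) := by
  classical
  exact univ.filter fun I ↦ (∀ X ∈ I, X.card = r) ∧ Stable I

theorem mem_stableFamilies {n r : ℕ} {I : Finset (Finset (Fin n))} :
    I ∈ stableFamilies n r ↔ (∀ X ∈ I, X.card = r) ∧ Stable I := by
  simp [stableFamilies]

/-! ### Counting by independent reversible modifications -/

section Gain

/-- If every member `I` of `𝓘` can be modified independently in `k` places, in such a way that `I`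
can be recovered from the result and one of few pieces of information, then `𝓘` is small. -/
theorem card_mul_two_pow_le {V ι : Type*} [DecidableEq V] [DecidableEq ι]
    (𝓘 S : Finset (Finset V)) (Γ : Finset ι) (τ : ι → V → V) (k : ℕ)
    (h : ∀ I ∈ 𝓘, ∃ g ∈ Γ, ∃ J ⊆ I, k ≤ J.card ∧ ∃ μ : V → V, (∀ X ∈ I, τ g X = X) ∧
      (∀ X ∈ J, τ g (μ X) = X ∧ μ X ≠ X) ∧ ∀ σ ⊆ J, (I \ σ) ∪ σ.image μ ∈ S) :
    𝓘.card * 2 ^ k ≤ Γ.card * S.card := by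
  obtain rfl | ⟨I₀, hI₀⟩ := 𝓘.eq_empty_or_nonempty
  · simp
  have : Nonempty ι := ⟨(h I₀ hI₀).choose⟩
  have : Nonempty (V → V) := ⟨id⟩
  choose! g hg J hJI hk μ hτ hμ hS using h
  set T : Finset V → Finset (ι × Finset V) := fun I ↦
    (J I).powerset.image fun σ ↦ (g I, (I \ σ) ∪ σ.image (μ I)) with hT
  -- The decoder `τ g` fixes the untouched members and undoes the moves, so `g` and the modified
  -- family determine `I`.
  have hdec : ∀ I ∈ 𝓘, ∀ σ ⊆ J I, ((I \ σ) ∪ σ.image (μ I)).image (τ (g I)) = I := by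
    intro I hI σ hσ
    ext X
    simp only [mem_image, mem_union, mem_sdiff]
    constructor
    · rintro ⟨Y, ⟨hY, -⟩ | ⟨Z, hZ, rfl⟩, rfl⟩
      · rwa [hτ I hI Y hY]
      · rw [(hμ I hI Z (hσ hZ)).1]
        exact hJI I hI (hσ hZ)
    · intro hX
      by_cases hXσ : X ∈ σ
      · exact ⟨μ I X, Or.inr ⟨X, hXσ, rfl⟩, (hμ I hI X (hσ hXσ)).1⟩
      · exact ⟨X, Or.inl ⟨hX, hXσ⟩, hτ I hI X hX⟩
  -- `σ` consists of the members of `J` missing from the modified family: a moved set `μ Y` is never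
  -- in `J`, because `τ g` fixes members of `I` but does not fix `μ Y`.
  have hinj : ∀ I ∈ 𝓘, Set.InjOn (fun σ ↦ (g I, (I \ σ) ∪ σ.image (μ I))) (J I).powerset := by
    intro I hI σ hσ σ' hσ' heq
    simp only [coe_powerset, Set.mem_preimage, Set.mem_powerset_iff, coe_subset] at hσ hσ'
    have key : ∀ σ ⊆ J I, ∀ X ∈ J I, X ∈ σ ↔ X ∉ (I \ σ) ∪ σ.image (μ I) := by
      intro σ hσ X hX
      constructor
      · intro hXσ hmem
        simp only [mem_union, mem_sdiff, mem_image] at hmem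
        obtain ⟨-, h⟩ | ⟨Y, hY, rfl⟩ := hmem
        · exact h hXσ
        · have h1 := (hμ I hI Y (hσ hY))
          have h2 := hτ I hI _ (hJI I hI hX)
          rw [h1.1] at h2
          exact h1.2 h2.symm
      · intro hX'
        by_contra hXσ
        exact hX' (mem_union_left _ (mem_sdiff.2 ⟨hJI I hI hX, hXσ⟩))
    simp only [Prod.mk.injEq, true_and] at heq
    ext X
    constructor
    · intro hX
      rw [key σ' hσ' X (hσ hX), ← heq, ← key σ hσ X (hσ hX)]
      exact hX
    · intro hX
      rw [key σ hσ X (hσ' hX), heq, ← key σ' hσ' X (hσ' hX)]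
      exact hX
  have hdisj : (𝓘 : Set (Finset V)).PairwiseDisjoint T := by
    intro I hI I' hI' hne
    rw [Function.onFun, Finset.disjoint_left]
    rintro x hx hx'
    simp only [hT, mem_image, mem_powerset] at hx hx'
    obtain ⟨σ, hσ, rfl⟩ := hx
    obtain ⟨σ', hσ', heq⟩ := hx'
    simp only [Prod.mk.injEq] at heq
    refine hne ?_
    rw [← hdec I hI σ hσ, ← hdec I' hI' σ' hσ', heq.1, heq.2]
  calc 𝓘.card * 2 ^ k = ∑ _I ∈ 𝓘, 2 ^ k := by simp
    _ ≤ ∑ I ∈ 𝓘, (T I).card := by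
        refine sum_le_sum fun I hI ↦ ?_
        rw [hT, card_image_of_injOn (hinj I hI), card_powerset]
        exact Nat.pow_le_pow_right two_pos (hk I hI)
    _ = (𝓘.biUnion T).card := (card_biUnion hdisj).symm
    _ ≤ (Γ ×ˢ S).card := by
        refine card_le_card fun x hx ↦ ?_
        simp only [mem_biUnion, hT, mem_image, mem_powerset] at hx
        obtain ⟨I, hI, σ, hσ, rfl⟩ := hx
        exact mem_product.2 ⟨hg I hI, hS I hI σ hσ⟩
    _ = Γ.card * S.card := card_product _ _

theorem card_pigeonhole {α V : Type*} [Fintype α] [DecidableEq α] (T : Finset V)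
    (G : V → Finset α) {s k : ℕ}
    (hG : ∀ x ∈ T, s ≤ (G x).card) (hk : Fintype.card α * k ≤ T.card * s)
    (hα : 0 < Fintype.card α) : ∃ g : α, k ≤ (T.filter fun x ↦ g ∈ G x).card := by
  by_contra! hcon
  have h1 : ∑ g : α, (T.filter fun x ↦ g ∈ G x).card = ∑ x ∈ T, (G x).card := by
    simp_rw [card_eq_sum_ones, sum_filter]
    rw [sum_comm]
    refine sum_congr rfl fun C _ ↦ ?_
    rw [← sum_filter]
    congr 1
    ext x
    simp
  have : Nonempty α := Fintype.card_pos_iff.1 hα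
  have h2 : ∑ g : α, (T.filter fun x ↦ g ∈ G x).card < ∑ _g : α, k :=
    sum_lt_sum_of_nonempty univ_nonempty fun g _ ↦ hcon g
  have h3 : ∑ _x ∈ T, s ≤ ∑ x ∈ T, (G x).card := sum_le_sum hG
  rw [h1] at h2
  simp only [sum_const, smul_eq_mul, card_univ] at h2 h3
  omega

theorem card_sdiff_eq_of_card_eq {α : Type*} [DecidableEq α] {X Y : Finset α}
    (h : X.card = Y.card) : (X \ Y).card = (Y \ X).card := by
  have h1 := card_sdiff_add_card_inter X Y
  have h2 := card_sdiff_add_card_inter Y X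
  rw [inter_comm] at h2
  omega

theorem sdiff_union_image_mem_stableFamilies {n r : ℕ} {I J σ : Finset (Finset (Fin n))}
    {μ : Finset (Fin n) → Finset (Fin n)} (hI : I ∈ stableFamilies n r)
    (hcard : ∀ X ∈ J, (μ X).card = r)
    (h1 : ∀ X ∈ J, ∀ X' ∈ I, X ≠ X' → 2 ≤ (μ X \ X').card)
    (h2 : ∀ X ∈ J, ∀ X' ∈ J, X ≠ X' → 2 ≤ (μ X \ μ X').card) (hσ : σ ⊆ J) :
    (I \ σ) ∪ σ.image μ ∈ stableFamilies n r := by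
  rw [mem_stableFamilies] at hI ⊢
  refine ⟨?_, ?_⟩
  · intro X hX
    simp only [mem_union, mem_sdiff, mem_image] at hX
    obtain ⟨h, -⟩ | ⟨Y, hY, rfl⟩ := hX
    · exact hI.1 X h
    · exact hcard Y (hσ hY)
  · intro X hX Y hY hne
    simp only [mem_union, mem_sdiff, mem_image] at hX hY
    obtain ⟨hX, hXσ⟩ | ⟨X, hX, rfl⟩ := hX <;> obtain ⟨hY, hYσ⟩ | ⟨Y, hY, rfl⟩ := hY
    · exact hI.2 X hX Y hY hne
    · rw [card_sdiff_eq_of_card_eq ((hI.1 X hX).trans (hcard Y (hσ hY)).symm)]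
      exact h1 Y (hσ hY) X hX (by rintro rfl; exact hXσ hY)
    · exact h1 X (hσ hX) Y hY (by rintro rfl; exact hYσ hX)
    · exact h2 X (hσ hX) Y (hσ hY) (by rintro rfl; exact hne rfl)

end Gain

/-! ### Sparse paving matroids and the lower bound on the number of matroids -/

section SparsePaving

variable {n r : ℕ}

/-- Two candidates `f`, `g` give sets differing in one element, which cannot both lie in a stable
family; with only one candidate the exchange produces `B` itself. -/
theorem sparsePaving_exchange {I : Finset (Finset (Fin n))} (hI : I ∈ stableFamilies n r)
    {A B : Finset (Fin n)} (hA : A.card = r) (hB : B.card = r) (hBI : B ∉ I) {e : Fin n}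
    (he : e ∈ A \ B) : ∃ f ∈ B \ A, insert f (A.erase e) ∉ I := by
  obtain ⟨heA, heB⟩ := mem_sdiff.1 he
  have hc : ∀ f ∈ B \ A, f ∉ A.erase e := fun f hf h ↦ (mem_sdiff.1 hf).2 (mem_of_mem_erase h)
  have hcard : (A \ B).card = (B \ A).card := card_sdiff_eq_of_card_eq (hA.trans hB.symm)
  have hpos : 0 < (B \ A).card := hcard ▸ card_pos.2 ⟨e, he⟩
  obtain hlt | hle := Nat.lt_or_ge 1 (B \ A).card
  · obtain ⟨f, hf, g, hg, hfg⟩ := one_lt_card.1 hlt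
    by_contra! hcon
    have h2 := (mem_stableFamilies.1 hI).2 _ (hcon f hf) _ (hcon g hg) (by
      intro h
      have : f ∈ insert g (A.erase e) := h ▸ mem_insert_self _ _
      rw [mem_insert] at this
      exact this.elim hfg (hc f hf))
    have h3 : insert f (A.erase e) \ insert g (A.erase e) ⊆ {f} := by
      intro x hx
      simp only [mem_sdiff, mem_insert, not_or] at hx
      rw [mem_singleton]
      tauto
    have := card_le_card h3
    simp at this
    omega
  · obtain ⟨f, hf⟩ := card_pos.1 hpos
    refine ⟨f, hf, ?_⟩
    suffices insert f (A.erase e) = B by rwa [this]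
    have h1 : A \ B = {e} := by
      refine (eq_of_subset_of_card_le (singleton_subset_iff.2 he) ?_).symm
      rw [card_singleton]
      omega
    refine eq_of_subset_of_card_le ?_ ?_
    · intro x hx
      rw [mem_insert, mem_erase] at hx
      obtain rfl | ⟨hxe, hxA⟩ := hx
      · exact (mem_sdiff.1 hf).1
      · by_contra hxB
        have : x ∈ A \ B := mem_sdiff.2 ⟨hxA, hxB⟩
        rw [h1, mem_singleton] at this
        exact hxe this
    · rw [card_insert_of_notMem (hc f hf), card_erase_of_mem heA]
      omega

theorem exists_notMem_stable {I : Finset (Finset (Fin n))} (hI : I ∈ stableFamilies n r)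
    (hr : 0 < r) (hrn : r < n) : ∃ B : Finset (Fin n), B.card = r ∧ B ∉ I := by
  obtain ⟨A, -, hA⟩ := exists_subset_card_eq (s := (univ : Finset (Fin n))) (n := r)
    (by simpa using hrn.le)
  by_cases hAI : A ∈ I
  swap
  · exact ⟨A, hA, hAI⟩
  obtain ⟨e, he⟩ : A.Nonempty := card_pos.1 (by omega)
  obtain ⟨f, hf⟩ : ∃ f, f ∉ A := by
    by_contra! h
    have : A = univ := eq_univ_of_forall h
    rw [this, card_univ, Fintype.card_fin] at hA
    omega
  have hf' : f ∉ A.erase e := fun h ↦ hf (mem_of_mem_erase h)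
  refine ⟨insert f (A.erase e), ?_, fun hmem ↦ ?_⟩
  · rw [card_insert_of_notMem hf', card_erase_of_mem he]
    omega
  · have h2 := (mem_stableFamilies.1 hI).2 _ hmem _ hAI (by
      rintro h
      exact hf (h ▸ mem_insert_self _ _))
    have h3 : insert f (A.erase e) \ A ⊆ {f} := by
      intro x hx
      simp only [mem_sdiff, mem_insert, mem_erase] at hx
      rw [mem_singleton]
      tauto
    have := card_le_card h3
    simp at this
    omega

/-- The matroid whose bases are the `r`-sets outside a stable family. -/
noncomputable def sparsePaving {I : Finset (Finset (Fin n))} (hI : I ∈ stableFamilies n r)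
    (hr : 0 < r) (hrn : r < n) : Matroid (Fin n) :=
  Matroid.ofIsBaseOfFinite (E := Set.univ) Set.finite_univ
    (fun B ↦ ∃ F : Finset (Fin n), (F : Set (Fin n)) = B ∧ F.card = r ∧ F ∉ I)
    (by
      obtain ⟨B, hB, hBI⟩ := exists_notMem_stable hI hr hrn
      exact ⟨B, B, rfl, hB, hBI⟩)
    (by
      rintro _ _ ⟨A, rfl, hA, hAI⟩ ⟨B, rfl, hB, hBI⟩ e he
      have he' : e ∈ A \ B := by simpa using he
      obtain ⟨f, hf, hfI⟩ := sparsePaving_exchange hI hA hB hBI he'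
      refine ⟨f, by simpa using hf, insert f (A.erase e), by simp, ?_, hfI⟩
      have hf' : f ∉ A.erase e := fun h ↦ (mem_sdiff.1 hf).2 (mem_of_mem_erase h)
      rw [card_insert_of_notMem hf', card_erase_of_mem (mem_sdiff.1 he').1]
      have : 0 < A.card := card_pos.2 ⟨e, (mem_sdiff.1 he').1⟩
      omega)
    (fun _ _ ↦ Set.subset_univ _)

theorem card_stableFamilies_le (hr : 0 < r) (hrn : r < n) :
    (stableFamilies n r).card ≤ (matroidsOn n).ncard := by
  classical
  have := finite_matroid n
  have hfin : (matroidsOn n).Finite := Set.toFinite _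
  rw [← Set.ncard_coe_finset]
  refine Set.ncard_le_ncard_of_injOn
    (fun I ↦ if hI : I ∈ stableFamilies n r then sparsePaving hI hr hrn else Matroid.emptyOn _)
    ?_ ?_ hfin
  · intro I hI
    have hI : I ∈ stableFamilies n r := hI
    simp only [hI, dite_true]
    rfl
  · intro I hI J hJ h
    have hI : I ∈ stableFamilies n r := hI
    have hJ : J ∈ stableFamilies n r := hJ
    simp only [hI, hJ, dite_true] at h
    have key : ∀ F : Finset (Fin n), F.card = r → (F ∉ I ↔ F ∉ J) := by
      intro F hF
      have h1 : (sparsePaving hI hr hrn).IsBase F ↔ (sparsePaving hJ hr hrn).IsBase F := by rw [h]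
      change (∃ F' : Finset (Fin n), (F' : Set (Fin n)) = F ∧ F'.card = r ∧ F' ∉ I) ↔
        (∃ F' : Finset (Fin n), (F' : Set (Fin n)) = F ∧ F'.card = r ∧ F' ∉ J) at h1
      simpa [hF] using h1
    ext F
    by_cases hF : F.card = r
    · exact not_iff_not.1 (key F hF)
    · exact ⟨fun h ↦ absurd ((mem_stableFamilies.1 hI).1 F h) hF,
        fun h ↦ absurd ((mem_stableFamilies.1 hJ).1 F h) hF⟩

/-- The colouring of Graham and Sloane: some colour class of the `r`-sets is a large stable
family. -/
theorem exists_stable_large (hn : 0 < n) :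
    ∃ I ∈ stableFamilies n r, n.choose r ≤ n * I.card := by
  classical
  have : NeZero n := ⟨hn.ne'⟩
  -- The colour is the sum of the elements modulo `n`; exchanging a single element for a different
  -- one changes it.
  set c : Finset (Fin n) → Fin n := fun X ↦ ∑ x ∈ X, x
  set P := powersetCard r (univ : Finset (Fin n))
  obtain ⟨a, ha⟩ : ∃ a, n.choose r ≤ n * (P.filter fun X ↦ c X = a).card := by
    by_contra! h
    have h1 : ∑ a : Fin n, (P.filter fun X ↦ c X = a).card = n.choose r := by
      rw [← card_eq_sum_card_fiberwise (fun _ _ ↦ mem_coe.2 (mem_univ _)), card_powersetCard,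
        card_univ, Fintype.card_fin]
    have h2 : ∑ a : Fin n, n * (P.filter fun X ↦ c X = a).card < ∑ _a : Fin n, n.choose r :=
      sum_lt_sum_of_nonempty univ_nonempty fun a _ ↦ h a
    rw [← mul_sum, h1, sum_const, card_univ, Fintype.card_fin, smul_eq_mul] at h2
    exact lt_irrefl _ h2
  refine ⟨P.filter fun X ↦ c X = a, mem_stableFamilies.2 ⟨fun X hX ↦ ?_, ?_⟩, ha⟩
  · exact (mem_powersetCard.1 (mem_filter.1 hX).1).2
  · intro X hX Y hY hne
    rw [mem_filter, mem_powersetCard] at hX hY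
    by_contra! hlt
    have hcard := card_sdiff_eq_of_card_eq (hX.1.2.trans hY.1.2.symm)
    have hX0 : (X \ Y).card ≠ 0 := by
      intro h0
      rw [card_eq_zero, sdiff_eq_empty_iff_subset] at h0
      exact hne (eq_of_subset_of_card_le h0 (by rw [hX.1.2, hY.1.2]))
    obtain ⟨x, hx⟩ := card_eq_one.1 (show (X \ Y).card = 1 by omega)
    obtain ⟨y, hy⟩ := card_eq_one.1 (show (Y \ X).card = 1 by omega)
    have e1 : c X = x + ∑ z ∈ X ∩ Y, z := by
      rw [← sum_singleton (fun z : Fin n ↦ z) x, ← hx]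
      rw [add_comm]
      exact (sum_inter_add_sum_sdiff X Y _).symm
    have e2 : c Y = y + ∑ z ∈ X ∩ Y, z := by
      rw [← sum_singleton (fun z : Fin n ↦ z) y, ← hy, inter_comm]
      rw [add_comm]
      exact (sum_inter_add_sum_sdiff Y X _).symm
    have hxy : x = y := by
      have := e1.symm.trans (hX.2.trans (hY.2.symm.trans e2))
      exact add_right_cancel this
    have h1 : x ∈ X \ Y := hx ▸ mem_singleton_self x
    have h2 : y ∈ Y \ X := hy ▸ mem_singleton_self y
    rw [mem_sdiff] at h1 h2
    exact h2.2 (hxy ▸ h1.1)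

theorem two_pow_le_ncard_matroidsOn {k : ℕ} (hn : 2 ≤ n) (hk : n * k ≤ n.choose (n / 2)) :
    2 ^ k ≤ (matroidsOn n).ncard := by
  classical
  obtain ⟨I, hI, hc⟩ := exists_stable_large (r := n / 2) (show 0 < n by omega)
  refine le_trans ?_ (card_stableFamilies_le (r := n / 2) (by omega) (by omega))
  calc 2 ^ k ≤ 2 ^ I.card :=
        Nat.pow_le_pow_right two_pos (Nat.le_of_mul_le_mul_left (hk.trans hc) (by omega))
    _ = I.powerset.card := (card_powerset _).symm
    _ ≤ _ := card_le_card fun J hJ ↦ by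
        rw [mem_powerset] at hJ
        rw [mem_stableFamilies] at hI ⊢
        exact ⟨fun X hX ↦ hI.1 X (hJ hX), hI.2.mono hJ⟩

end SparsePaving

/-! ### Hyperplanes with many bases -/

section Count

variable {α : Type*} [Fintype α] [DecidableEq α] {N : Matroid α} {r s : ℕ}

/-- By minimality of `K`, some base meets `K` in a single element `k`; without `k` it lies in the
complementary hyperplane. -/
theorem card_eq_of_isBasis_compl_isCocircuit (hr : N.eRank = r) {K J : Finset α}
    (hK : N.IsCocircuit K) (hJ : N.IsBasis J (N.E \ K)) : J.card + 1 = r := by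
  rw [Matroid.isCocircuit_iff_minimal] at hK
  have hJK : Disjoint (J : Set α) K := Set.disjoint_left.2 fun x hx ↦ (hJ.subset hx).2
  have hJr : (J.card : ℕ∞) ≤ r := by
    rw [← hr, ← Set.encard_coe_eq_coe_finsetCard]
    exact hJ.indep.encard_le_eRank
  have hlt : J.card ≠ r := by
    rintro rfl
    have hB : N.IsBase J := by
      refine hJ.indep.isBase_of_eRk_ge J.finite_toSet ?_
      rw [hr, hJ.indep.eRk_eq_encard, Set.encard_coe_eq_coe_finsetCard]
    obtain ⟨x, hxK, hxJ⟩ := hK.prop _ hB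
    exact Set.disjoint_left.1 hJK hxJ hxK
  obtain ⟨B₀, hB₀⟩ := N.exists_isBase
  obtain ⟨k, hk, -⟩ := hK.prop _ hB₀
  obtain ⟨B, hB, hBK⟩ : ∃ B, N.IsBase B ∧ ¬ ((↑K \ {k}) ∩ B).Nonempty := by
    by_contra! hcon
    have h : (K : Set α) ⊆ ↑K \ {k} := hK.le_of_le hcon Set.sdiff_subset
    exact (h hk).2 rfl
  rw [Set.not_nonempty_iff_eq_empty] at hBK
  have hBk : B \ {k} ⊆ N.E \ K := fun x hx ↦ ⟨hB.subset_ground hx.1, fun hxK ↦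
    (Set.eq_empty_iff_forall_notMem.1 hBK x) ⟨⟨hxK, hx.2⟩, hx.1⟩⟩
  have h1 : (B \ {k}).encard ≤ J.card := by
    rw [← Set.encard_coe_eq_coe_finsetCard, hJ.encard_eq_eRk]
    exact (hB.indep.subset Set.sdiff_subset).encard_le_eRk_of_subset hBk
  have h2 : (r : ℕ∞) ≤ J.card + 1 := by
    rw [← hr, ← hB.encard_eq_eRank]
    refine le_trans ?_ (add_le_add_left h1 1)
    have := Set.encard_le_encard (show B ⊆ insert k (B \ {k}) by
      intro x hx
      by_cases h : x = k
      · exact Or.inl h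
      · exact Or.inr ⟨hx, h⟩)
    exact this.trans (Set.encard_insert_le _ _)
  have h3 : r ≤ J.card + 1 := by exact_mod_cast h2
  have h4 : J.card ≤ r := by exact_mod_cast hJr
  omega

/-- The fundamental circuit of `a` over `J₀` is also its fundamental circuit over `J`. It has more
than `s` elements, and each of them except `a` can be exchanged for `a`. Keeping a basis of `S`
inside the new set allows a second exchange. -/
theorem exists_exchange_set {J₀ J S : Finset α} (hJ : N.Indep J) (hJ₀ : N.IsBasis J₀ S)
    (hJ₀J : J₀ ⊆ J) (hc : ∀ C : Finset α, N.IsCircuit C → C ⊆ S → s < C.card) {a : α} (ha : a ∈ S)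
    (haJ : a ∉ J) : ∃ U ⊆ J₀, s ≤ U.card ∧ ∀ u ∈ U, N.Indep (insert a (J.erase u) : Finset α) ∧
      N.IsBasis (insert a (J₀.erase u) : Finset α) S := by
  have haJ₀ : a ∉ (J₀ : Set α) := fun h ↦ haJ (hJ₀J (by exact_mod_cast h))
  have hacl : a ∈ N.closure J₀ := hJ₀.subset_closure (by exact_mod_cast ha)
  have hC := hJ₀.indep.fundCircuit_isCircuit hacl haJ₀
  obtain ⟨C, hCeq⟩ : ∃ C : Finset α, (C : Set α) = N.fundCircuit a J₀ :=
    ⟨(Set.toFinite (N.fundCircuit a J₀)).toFinset, Set.Finite.coe_toFinset _⟩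
  have hCsub : C ⊆ insert a J₀ := by
    have := N.fundCircuit_subset_insert a J₀
    rw [← hCeq] at this
    exact_mod_cast this
  have hJ₀S : J₀ ⊆ S := by exact_mod_cast hJ₀.subset
  have hCS : C ⊆ S := hCsub.trans (insert_subset ha hJ₀S)
  have hcard := hc C (hCeq ▸ hC) hCS
  have hmem : ∀ u ∈ C.erase a, u ∈ J₀ := fun u hu ↦ by
    rw [mem_erase] at hu
    exact (mem_insert.1 (hCsub hu.2)).resolve_left hu.1
  have hrew : ∀ (I : Finset α) (u : α), u ≠ a →
      ((insert a (I.erase u) : Finset α) : Set α) = insert a (I : Set α) \ {u} := by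
    intro I u hu
    ext x
    simp only [coe_insert, coe_erase, Set.mem_insert_iff, Set.mem_sdiff, mem_coe,
      Set.mem_singleton_iff]
    constructor
    · rintro (rfl | h)
      · exact ⟨Or.inl rfl, fun h ↦ hu h.symm⟩
      · exact ⟨Or.inr h.1, h.2⟩
    · tauto
  have haclJ : a ∈ N.closure J := N.closure_subset_closure (by exact_mod_cast hJ₀J) hacl
  have hCJ : N.fundCircuit a J₀ = N.fundCircuit a J :=
    hC.eq_fundCircuit_of_subset hJ ((N.fundCircuit_subset_insert a J₀).trans
      (Set.insert_subset_insert (by exact_mod_cast hJ₀J)))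
  refine ⟨C.erase a, hmem, ?_, fun u hu ↦ ⟨?_, ?_⟩⟩
  · have := pred_card_le_card_erase (s := C) (a := a)
    omega
  · rw [hrew J u (mem_erase.1 hu).1, ← hJ.mem_fundCircuit_iff haclJ (by exact_mod_cast haJ), ← hCJ,
      ← hCeq]
    exact_mod_cast (mem_erase.1 hu).2
  · have hi : N.Indep (insert a (J₀.erase u) : Finset α) := by
      rw [hrew J₀ u (mem_erase.1 hu).1, ← hJ₀.indep.mem_fundCircuit_iff hacl haJ₀, ← hCeq]
      exact_mod_cast (mem_erase.1 hu).2
    refine hi.isBasis_of_eRk_ge (finite_toSet _) ?_ ?_ hJ₀.subset_ground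
    · rw [coe_subset]
      exact insert_subset ha ((erase_subset _ _).trans hJ₀S)
    · rw [hi.eRk_eq_encard, ← hJ₀.encard_eq_eRk, Set.encard_coe_eq_coe_finsetCard,
        Set.encard_coe_eq_coe_finsetCard, card_insert_of_notMem
          (fun h ↦ haJ (hJ₀J (mem_of_mem_erase h))), card_erase_of_mem (hmem u hu)]
      have : 0 < J₀.card := card_pos.2 ⟨u, hmem u hu⟩
      exact_mod_cast (by omega : J₀.card ≤ J₀.card - 1 + 1)

/-- If `S` has nullity at least `2`, avoids the cocircuit `K`, and has no small circuits, then the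
hyperplane complementary to `K` has many bases. -/
theorem mul_pred_le_card_indep_avoiding (hE : N.E = Set.univ)
    (hr : N.eRank = r) {K S : Finset α} (hK : N.IsCocircuit K) (hSK : Disjoint S K)
    (hS : N.eRk S + 2 ≤ (S.card : ℕ∞))
    (hc : ∀ C : Finset α, N.IsCircuit C → C ⊆ S → s < C.card) [DecidablePred fun A : Finset α ↦
      N.Indep A ∧ Disjoint A K ∧ A.card + 1 = r] :
    s * (s - 1) ≤
      2 * (univ.filter fun A : Finset α ↦ N.Indep A ∧ Disjoint A K ∧ A.card + 1 = r).card := by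
  have hgr : ∀ X : Set α, X ⊆ N.E := fun X ↦ hE ▸ Set.subset_univ X
  obtain ⟨J₀, hJ₀⟩ := N.exists_isBasis (S : Set α) (hgr _)
  have hSH : (S : Set α) ⊆ N.E \ K := fun x hx ↦
    ⟨hgr _ hx, fun h ↦ disjoint_left.1 hSK (by exact_mod_cast hx) (by exact_mod_cast h)⟩
  obtain ⟨J, hJ, hJ₀J⟩ := hJ₀.indep.subset_isBasis_of_subset (hJ₀.subset.trans hSH) (hgr _)
  lift J₀ to Finset α using Set.toFinite _
  lift J to Finset α using Set.toFinite _
  have hJ₀J : J₀ ⊆ J := by exact_mod_cast hJ₀J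
  have hJcard := card_eq_of_isBasis_compl_isCocircuit hr hK hJ
  have hJK : Disjoint J K := disjoint_left.2 fun x hx hxK ↦ (hJ.subset (mem_coe.2 hx)).2 hxK
  have hSJ : 1 < (S \ J).card := by
    have h1 : ((S ∩ J).card : ℕ∞) ≤ N.eRk S := by
      rw [← Set.encard_coe_eq_coe_finsetCard]
      exact (hJ.indep.subset (by simp)).encard_le_eRk_of_subset (by simp)
    have h2 : ((S ∩ J).card : ℕ∞) + 2 ≤ S.card := (add_le_add_left h1 2).trans hS
    have h3 : (S ∩ J).card + 2 ≤ S.card := by exact_mod_cast h2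
    have := card_sdiff_add_card_inter S J
    omega
  -- Nullity two leaves two elements of `S` outside `J`; they are exchanged successively for `u` and
  -- `v`.
  obtain ⟨a, ha, b, hb, hab⟩ := one_lt_card.1 hSJ
  rw [mem_sdiff] at ha hb
  obtain ⟨U, hUJ, hUs, hU⟩ := exists_exchange_set hJ.indep hJ₀ hJ₀J hc ha.1 ha.2
  have hV : ∀ u ∈ U, ∃ V ⊆ insert a (J₀.erase u), s ≤ V.card ∧
      ∀ v ∈ V, N.Indep (insert b ((insert a (J.erase u)).erase v) : Finset α) := by
    intro u hu
    obtain ⟨V, hVJ, hVs, hV⟩ := exists_exchange_set (hU u hu).1 (hU u hu).2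
      (insert_subset_insert _ (erase_subset_erase _ hJ₀J)) hc hb.1 (by
        rw [mem_insert, mem_erase]
        rintro (h | h)
        · exact hab h.symm
        · exact hb.2 h.2)
    exact ⟨V, hVJ, hVs, fun v hv ↦ (hV v hv).1⟩
  choose! V hVJ hVs hVI using hV
  set T : Finset (α × α) := U.biUnion fun u ↦ ((V u).erase a).image fun v ↦ (u, v) with hT
  have hTmem : ∀ p, p ∈ T ↔ p.1 ∈ U ∧ p.2 ∈ V p.1 ∧ p.2 ≠ a := by
    rintro ⟨u, v⟩
    simp only [hT, mem_biUnion, mem_image, mem_erase, Prod.mk.injEq]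
    constructor
    · rintro ⟨u', hu', v', hv', rfl, rfl⟩
      exact ⟨hu', hv'.2, hv'.1⟩
    · rintro ⟨h1, h2, h3⟩
      exact ⟨u, h1, v, ⟨h3, h2⟩, rfl, rfl⟩
  have hTcard : s * (s - 1) ≤ T.card := by
    rw [hT, card_biUnion]
    · calc s * (s - 1) ≤ U.card * (s - 1) := Nat.mul_le_mul_right _ hUs
        _ = ∑ _u ∈ U, (s - 1) := by simp
        _ ≤ _ := by
          refine sum_le_sum fun u hu ↦ ?_
          rw [card_image_of_injective _ (fun v v' h ↦ (Prod.mk.inj h).2)]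
          have := pred_card_le_card_erase (s := V u) (a := a)
          have := hVs u hu
          omega
    · intro u _ u' _ hne
      rw [Function.onFun, disjoint_left]
      intro p hp hp'
      simp only [mem_image] at hp hp'
      obtain ⟨v, -, rfl⟩ := hp
      obtain ⟨v', -, h⟩ := hp'
      exact hne (Prod.mk.inj h).1.symm
  set f : α × α → Finset α := fun p ↦ insert b ((insert a (J.erase p.1)).erase p.2) with hf
  have hprop : ∀ p ∈ T, p.1 ∈ J ∧ p.2 ∈ J ∧ p.1 ≠ p.2 := by
    intro p hp
    rw [hTmem] at hp
    have h1 := hVJ p.1 hp.1 hp.2.1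
    rw [mem_insert, mem_erase] at h1
    have h2 := h1.resolve_left hp.2.2
    exact ⟨hJ₀J (hUJ hp.1), hJ₀J h2.2, fun h ↦ h2.1 h.symm⟩
  have hfsd : ∀ p ∈ T, J \ f p = {p.1, p.2} := by
    intro p hp
    obtain ⟨h1, h2, h3⟩ := hprop p hp
    have hap : ∀ x ∈ J, x ≠ a := fun x hx h ↦ ha.2 (h ▸ hx)
    have hbp : ∀ x ∈ J, x ≠ b := fun x hx h ↦ hb.2 (h ▸ hx)
    ext x
    simp only [hf, mem_sdiff, mem_insert, mem_erase, mem_singleton]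
    constructor
    · rintro ⟨hx, h⟩
      have := hap x hx
      tauto
    · rintro (rfl | rfl)
      · exact ⟨h1, by have := hap _ h1; have := hbp _ h1; tauto⟩
      · exact ⟨h2, by have := hap _ h2; have := hbp _ h2; tauto⟩
  refine hTcard.trans ((card_le_mul_card_image (f := f) T 2 ?_).trans
    (Nat.mul_le_mul_left _ (card_le_card ?_)))
  · intro A hA
    obtain ⟨p, hp, rfl⟩ := mem_image.1 hA
    -- The new basis determines the unordered pair of removed elements, hence the factor two.
    have hsub : (T.filter fun q ↦ f q = f p) ⊆ {(p.1, p.2), (p.2, p.1)} := by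
      intro q hq
      rw [mem_filter] at hq
      have h1 := hfsd q hq.1
      rw [hq.2, hfsd p hp] at h1
      have h2 := hprop q hq.1
      have h3 : q.1 ∈ ({p.1, p.2} : Finset α) := h1 ▸ mem_insert_self _ _
      have h4 : q.2 ∈ ({p.1, p.2} : Finset α) := h1 ▸ mem_insert_of_mem (mem_singleton_self _)
      rw [mem_insert, mem_singleton] at h3 h4
      simp only [mem_insert, mem_singleton, Prod.ext_iff]
      have := h2.2.2
      rcases h3 with h3 | h3 <;> rcases h4 with h4 | h4
      · exact absurd (h3.trans h4.symm) this
      · exact Or.inl ⟨h3, h4⟩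
      · exact Or.inr ⟨h3, h4⟩
      · exact absurd (h3.trans h4.symm) this
    exact (card_le_card hsub).trans card_le_two
  · intro A hA
    obtain ⟨p, hp, rfl⟩ := mem_image.1 hA
    obtain ⟨h1, h2, h3⟩ := hprop p hp
    rw [hTmem] at hp
    rw [mem_filter]
    refine ⟨mem_univ _, hVI p.1 hp.1 p.2 hp.2.1, ?_, ?_⟩
    · rw [disjoint_left] at hSK hJK ⊢
      intro x hx
      simp only [hf, mem_insert, mem_erase] at hx
      rcases hx with rfl | ⟨-, rfl | ⟨-, hx⟩⟩
      · exact hSK hb.1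
      · exact hSK ha.1
      · exact hJK hx
    · have e1 : a ∉ J.erase p.1 := fun h ↦ ha.2 (mem_of_mem_erase h)
      have e2 : p.2 ∈ insert a (J.erase p.1) :=
        mem_insert_of_mem (mem_erase.2 ⟨fun h ↦ h3 h.symm, h2⟩)
      have e3 : b ∉ (insert a (J.erase p.1)).erase p.2 := by
        simp only [mem_erase, mem_insert, not_and, not_or]
        exact fun _ ↦ ⟨fun h ↦ hab h.symm, fun _ ↦ hb.2⟩
      rw [hf, card_insert_of_notMem e3, card_erase_of_mem e2, card_insert_of_notMem e1,
        card_erase_of_mem h1]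
      have : 0 < J.card := card_pos.2 ⟨_, h1⟩
      omega

end Count

/-! ### Encoding a matroid by heavy circuits, heavy cocircuits and a stable core -/

section Encoding

variable {α : Type*} [Fintype α] [DecidableEq α]

/-- The spanning sets of nullity `1` that contain `C`. -/
noncomputable def coverSets (N : Matroid α) (C : Finset α) : Finset (Finset α) := by
  classical
  exact univ.filter fun Q ↦ C ⊆ Q ∧ N.Spanning Q ∧ (Q.card : ℕ∞) = N.eRank + 1

/-- The circuits of `N` that are small, or that are contained in many spanning sets of
nullity `1`. -/
noncomputable def heavyCircuits (s β : ℕ) (N : Matroid α) : Finset (Finset α) := by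
  classical
  exact univ.filter fun C ↦ N.IsCircuit C ∧ (C.card ≤ s ∨ β ≤ (coverSets N C).card)

/-- The heavy circuits and the heavy cocircuits of `N`. -/
noncomputable def certificate (s β : ℕ) (N : Matroid α) : Finset (Finset α) × Finset (Finset α) :=
  (heavyCircuits s β N, heavyCircuits s β N✶)

/-- A set is covered if it contains one of the given circuits or avoids one of the given
cocircuits. -/
def Covered (Z : Finset (Finset α) × Finset (Finset α)) (X : Finset α) : Prop :=
  (∃ C ∈ Z.1, C ⊆ X) ∨ ∃ K ∈ Z.2, Disjoint X K

/-- Uncovered sets that differ in at most one element are linked if one of the given circuits or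
cocircuits shows that they are both bases, or both not. -/
def Linked (Z : Finset (Finset α) × Finset (Finset α)) (X Y : Finset α) : Prop :=
  ¬ Covered Z X ∧ ¬ Covered Z Y ∧ X.card = Y.card ∧ (X \ Y).card ≤ 1 ∧
    ((∃ C ∈ Z.1, C ⊆ X ∪ Y) ∨ ∃ K ∈ Z.2, Disjoint (X ∩ Y) K)

/-- A representative of the class of `X` for the equivalence relation generated by linkage. -/
noncomputable def rep (Z : Finset (Finset α) × Finset (Finset α)) (X : Finset α) : Finset α :=
  (Quot.mk (Linked Z) X).out

/-- The uncovered non-bases of a matroid. -/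
noncomputable def residue (s β : ℕ) (N : Matroid α) : Finset (Finset α) := by
  classical
  exact univ.filter fun X ↦ (X.card : ℕ∞) = N.eRank ∧ ¬ N.Indep X ∧ ¬ Covered (certificate s β N) X

/-- The representatives of the classes of uncovered non-bases. -/
noncomputable def core (s β : ℕ) (N : Matroid α) : Finset (Finset α) :=
  (residue s β N).filter fun X ↦ rep (certificate s β N) X = X

variable {N : Matroid α} {r s β : ℕ} {X Y C K : Finset α}
  {Z : Finset (Finset α) × Finset (Finset α)}

theorem mem_coverSets {Q : Finset α} :
    Q ∈ coverSets N C ↔ C ⊆ Q ∧ N.Spanning Q ∧ (Q.card : ℕ∞) = N.eRank + 1 := by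
  simp [coverSets]

theorem mem_heavyCircuits : C ∈ heavyCircuits s β N ↔
    N.IsCircuit C ∧ (C.card ≤ s ∨ β ≤ (coverSets N C).card) := by
  simp [heavyCircuits]

theorem isCircuit_of_mem_heavyCircuits (h : C ∈ heavyCircuits s β N) : N.IsCircuit C :=
  (mem_heavyCircuits.1 h).1

theorem mem_residue : X ∈ residue s β N ↔
    (X.card : ℕ∞) = N.eRank ∧ ¬ N.Indep X ∧ ¬ Covered (certificate s β N) X := by
  simp [residue]

theorem mem_core : X ∈ core s β N ↔ X ∈ residue s β N ∧ rep (certificate s β N) X = X := by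
  simp [core]

theorem rep_rep : rep Z (rep Z X) = rep Z X := by
  rw [rep, rep, Quot.out_eq]

theorem rep_eq_of_linked (h : Linked Z X Y) : rep Z X = rep Z Y := by
  rw [rep, rep, Quot.sound h]

theorem rep_induction {P : Finset α → Prop} (hP : ∀ X Y, Linked Z X Y → (P X ↔ P Y)) :
    P (rep Z X) ↔ P X := by
  have h := Quot.eqvGen_exact (Quot.out_eq (Quot.mk (Linked Z) X))
  change Relation.EqvGen (Linked Z) (rep Z X) X at h
  generalize rep Z X = Y at h
  induction h with
  | rel x y h => exact hP x y h
  | refl => rfl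
  | symm x y _ ih => exact ih.symm
  | trans x y z _ _ ih1 ih2 => exact ih1.trans ih2

theorem eRk_compl_dual (hE : N.E = Set.univ) (hr : N.eRank = r) :
    N✶.eRank = (Fintype.card α - r : ℕ) ∧ r ≤ Fintype.card α := by
  have h := N.eRank_add_eRank_dual
  rw [hE, hr, Set.encard_univ, ENat.card_eq_coe_fintype_card] at h
  have hne : N✶.eRank ≠ ⊤ := by
    intro h'
    rw [h'] at h
    simp at h
  obtain ⟨k, hk⟩ := ENat.ne_top_iff_exists.1 hne
  rw [← hk] at h ⊢
  have h' : r + k = Fintype.card α := by exact_mod_cast h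
  exact ⟨by exact_mod_cast (by omega : k = Fintype.card α - r), by omega⟩

theorem dual_spanning_compl_iff (hE : N.E = Set.univ) :
    N✶.Spanning (Xᶜ : Finset α) ↔ N.Indep X := by
  rw [Matroid.spanning_iff_compl_coindep (by simp [hE]), Matroid.coindep_def, N.dual_dual,
    Matroid.dual_ground, hE, coe_compl, ← Set.compl_eq_univ_sdiff, compl_compl]

theorem dual_indep_compl_iff (hE : N.E = Set.univ) :
    N✶.Indep (Xᶜ : Finset α) ↔ N.Spanning X := by
  rw [Matroid.spanning_iff_compl_coindep (by simp [hE]), Matroid.coindep_def, hE, coe_compl,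
    ← Set.compl_eq_univ_sdiff]

theorem isCircuit_unique_of_indep {Q B : Finset α} {e : α} (hB : N.Indep B) (hQ : Q ⊆ insert e B)
    {C C' : Finset α} (hC : N.IsCircuit C) (hC' : N.IsCircuit C') (hCQ : C ⊆ Q) (hCQ' : C' ⊆ Q) :
    C = C' := by
  have h1 := hC.eq_fundCircuit_of_subset (e := e) hB (by exact_mod_cast hCQ.trans hQ)
  have h2 := hC'.eq_fundCircuit_of_subset (e := e) hB (by exact_mod_cast hCQ'.trans hQ)
  exact_mod_cast h1.trans h2.symm

theorem indep_card_le (hr : N.eRank = r) (hX : N.Indep X) : X.card ≤ r := by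
  have := hX.encard_le_eRank
  rw [hr, Set.encard_coe_eq_coe_finsetCard] at this
  exact_mod_cast this

theorem exists_base_subset_of_spanning (hr : N.eRank = r) (hX : N.Spanning X) :
    ∃ B ⊆ X, N.Indep B ∧ B.card = r := by
  obtain ⟨B, hB, hBX⟩ := hX.exists_isBase_subset
  lift B to Finset α using Set.toFinite _
  refine ⟨B, by exact_mod_cast hBX, hB.indep, ?_⟩
  have := hB.encard_eq_eRank
  rw [hr, Set.encard_coe_eq_coe_finsetCard] at this
  exact_mod_cast this

theorem spanning_iff_indep_of_card (hr : N.eRank = r) (hX : X.card = r) :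
    N.Spanning X ↔ N.Indep X := by
  constructor
  · intro h
    obtain ⟨B, hBX, hB, hBr⟩ := exists_base_subset_of_spanning hr h
    rwa [← eq_of_subset_of_card_le hBX (by omega)]
  · intro h
    refine (h.isBase_of_eRk_ge (finite_toSet _) ?_).spanning
    rw [hr, h.eRk_eq_encard, Set.encard_coe_eq_coe_finsetCard, hX]

theorem isCircuit_unique_of_spanning (hr : N.eRank = r) {Q : Finset α} (hQ : N.Spanning Q)
    (hQr : Q.card = r + 1) {C C' : Finset α} (hC : N.IsCircuit C) (hC' : N.IsCircuit C')
    (hCQ : C ⊆ Q) (hCQ' : C' ⊆ Q) : C = C' := by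
  obtain ⟨B, hBQ, hB, hBr⟩ := exists_base_subset_of_spanning hr hQ
  obtain ⟨e, he⟩ := card_eq_one.1 (show (Q \ B).card = 1 by
    rw [card_sdiff_of_subset hBQ]; omega)
  refine isCircuit_unique_of_indep hB (e := e) (Q := Q) ?_ hC hC' hCQ hCQ'
  intro x hx
  by_cases hxB : x ∈ B
  · exact mem_insert_of_mem hxB
  · have : x ∈ Q \ B := mem_sdiff.2 ⟨hx, hxB⟩
    rw [he, mem_singleton] at this
    exact this ▸ mem_insert_self _ _

theorem exists_circuit_subset (hE : N.E = Set.univ) (hX : ¬ N.Indep X) :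
    ∃ C ⊆ X, N.IsCircuit C := by
  obtain ⟨C, hCX, hC⟩ := Matroid.Dep.exists_isCircuit_subset (M := N) (X := X)
    ⟨hX, hE ▸ Set.subset_univ _⟩
  lift C to Finset α using Set.toFinite _
  exact ⟨C, by exact_mod_cast hCX, hC⟩

theorem exists_cocircuit_disjoint (hE : N.E = Set.univ) (hX : ¬ N.Spanning X) :
    ∃ K, Disjoint X K ∧ N.IsCocircuit K := by
  rw [← dual_indep_compl_iff hE] at hX
  obtain ⟨K, hKX, hK⟩ := exists_circuit_subset (N := N✶) hE hX
  exact ⟨K, disjoint_right.2 fun x hx ↦ mem_compl.1 (hKX hx), hK⟩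

theorem not_spanning_of_disjoint (hE : N.E = Set.univ) (hK : N.IsCocircuit K)
    (hX : Disjoint X K) : ¬ N.Spanning X := by
  rw [← dual_indep_compl_iff hE]
  intro h
  exact hK.not_indep (h.subset (by
    exact_mod_cast fun x hx ↦ mem_compl.2 (disjoint_right.1 hX hx)))

theorem notMem_closure_of_cocircuit (hK : N.IsCocircuit K)
    (hX : Disjoint X K) {v : α} (hv : v ∈ K) : v ∉ N.closure X := by
  intro hcl
  have hvX : v ∉ (X : Set α) := fun h ↦ disjoint_left.1 hX (by exact_mod_cast h) hv
  obtain ⟨C, hCX, hC, hvC⟩ := Matroid.exists_isCircuit_of_mem_closure hcl hvX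
  refine hC.inter_isCocircuit_ne_singleton hK (e := v) ?_
  ext x
  simp only [Set.mem_inter_iff, mem_coe, Set.mem_singleton_iff]
  constructor
  · rintro ⟨hxC, hxK⟩
    obtain rfl | hx := hCX hxC
    · rfl
    · exact absurd hxK (disjoint_left.1 hX (by exact_mod_cast hx))
  · rintro rfl
    exact ⟨hvC, hv⟩

theorem covered_compl_swap : Covered (Z.2, Z.1) Xᶜ ↔ Covered Z X := by
  unfold Covered
  have h1 : ∀ A : Finset α, A ⊆ Xᶜ ↔ Disjoint X A := fun A ↦ by
    rw [subset_compl_comm, subset_compl_iff_disjoint_right]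
  have h2 : ∀ A : Finset α, Disjoint Xᶜ A ↔ A ⊆ X := fun A ↦ by
    rw [disjoint_comm, disjoint_compl_right_iff]
  simp only [h1, h2]
  exact or_comm

theorem not_indep_of_covered (hE : N.E = Set.univ) (hX : (X.card : ℕ∞) = N.eRank)
    (h : Covered (certificate s β N) X) : ¬ N.Indep X := by
  obtain ⟨C, hC, hCX⟩ | ⟨K, hK, hKX⟩ := h
  · exact fun h ↦ (isCircuit_of_mem_heavyCircuits hC).not_indep
      (h.subset (by exact_mod_cast hCX))
  · intro hi
    refine not_spanning_of_disjoint hE (isCircuit_of_mem_heavyCircuits hK) hKX ?_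
    rwa [spanning_iff_indep_of_card hX.symm rfl]

/-- Covered `r`-sets are never bases; for uncovered ones the residue tells. -/
theorem residue_ext {N' : Matroid α} (hE : N.E = Set.univ) (hE' : N'.E = Set.univ)
    (hr : N.eRank = r) (hr' : N'.eRank = r) (hZ : certificate s β N = certificate s β N')
    (h : residue s β N = residue s β N') : N = N' := by
  have key : ∀ X : Finset α, X.card = r → (N.Indep X ↔ N'.Indep X) := by
    intro X hX
    by_cases hc : Covered (certificate s β N) X
    · have h1 := not_indep_of_covered hE (by rw [hr, hX]) hc
      have h2 := not_indep_of_covered hE' (by rw [hr', hX]) (hZ ▸ hc)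
      tauto
    · have h1 : X ∈ residue s β N ↔ X ∈ residue s β N' := by rw [h]
      rw [mem_residue, mem_residue, ← hZ, hr, hr', hX] at h1
      simp only [hc, not_false_eq_true, and_true, true_and] at h1
      exact not_iff_not.1 h1
  refine Matroid.ext_isBase (hE.trans hE'.symm) fun B _ ↦ ?_
  lift B to Finset α using Set.toFinite _
  have hb : ∀ {M : Matroid α}, M.eRank = r → (M.IsBase B ↔ M.Indep B ∧ B.card = r) := by
    intro M hM
    constructor
    · intro h
      refine ⟨h.indep, ?_⟩
      have := h.encard_eq_eRank
      rw [hM, Set.encard_coe_eq_coe_finsetCard] at this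
      exact_mod_cast this
    · rintro ⟨h1, h2⟩
      refine h1.isBase_of_eRk_ge (finite_toSet _) ?_
      rw [hM, h1.eRk_eq_encard, Set.encard_coe_eq_coe_finsetCard, h2]
  rw [hb hr, hb hr']
  exact and_congr_left fun h ↦ key B h

/-- A spanning set of nullity one contains only one circuit, so the sets counted for different
circuits are distinct `(r + 1)`-sets. -/
theorem card_large_heavyCircuits_mul_le (hr : N.eRank = r) :
    ((heavyCircuits s β N).filter fun C ↦ s < C.card).card * β ≤
      (Fintype.card α).choose (r + 1) := by
  classical
  set T : Finset α → Finset (Finset α) := coverSets N with hT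
  set H := (heavyCircuits s β N).filter fun C ↦ s < C.card with hH
  have hcard : ∀ Q : Finset α, (Q.card : ℕ∞) = N.eRank + 1 → Q.card = r + 1 := by
    intro Q hQ
    rw [hr] at hQ
    exact_mod_cast hQ
  have hdisj : (H : Set (Finset α)).PairwiseDisjoint T := by
    intro C hC C' hC' hne
    rw [Function.onFun, disjoint_left]
    intro Q hQ hQ'
    rw [hT, mem_coverSets] at hQ hQ'
    rw [mem_coe, hH, mem_filter] at hC hC'
    exact hne (isCircuit_unique_of_spanning hr hQ.2.1 (hcard Q hQ.2.2)
      (isCircuit_of_mem_heavyCircuits hC.1) (isCircuit_of_mem_heavyCircuits hC'.1) hQ.1 hQ'.1)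
  calc H.card * β = ∑ _C ∈ H, β := by simp
    _ ≤ ∑ C ∈ H, (T C).card := by
        refine sum_le_sum fun C hC ↦ ?_
        rw [hH, mem_filter, mem_heavyCircuits] at hC
        exact hC.1.2.resolve_left (not_le.2 hC.2)
    _ = (H.biUnion T).card := (card_biUnion hdisj).symm
    _ ≤ (powersetCard (r + 1) (univ : Finset α)).card := by
        refine card_le_card fun Q hQ ↦ ?_
        rw [mem_biUnion] at hQ
        obtain ⟨C, -, hQ⟩ := hQ
        rw [hT, mem_coverSets] at hQ
        exact mem_powersetCard.2 ⟨subset_univ _, hcard Q hQ.2.2⟩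
    _ = _ := by rw [card_powersetCard, card_univ]

/-- Complements of bases of the hyperplane `N.E \ K` are spanning sets of nullity one in the dual
that contain `K`, and there are at least `s * (s - 1) / 2` such bases. -/
theorem mem_heavyCircuits_dual (hE : N.E = Set.univ) (hr : N.eRank = r)
    (hβ : 2 * β ≤ s * (s - 1)) {S : Finset α} (hK : N.IsCocircuit K) (hSK : Disjoint S K)
    (hS : N.eRk S + 2 ≤ (S.card : ℕ∞))
    (hc : ∀ C : Finset α, N.IsCircuit C → C ⊆ S → s < C.card) : K ∈ heavyCircuits s β N✶ := by
  classical
  obtain ⟨hd, hrn⟩ := eRk_compl_dual hE hr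
  have h := mul_pred_le_card_indep_avoiding hE hr hK hSK hS hc
  refine mem_heavyCircuits.2 ⟨hK, Or.inr ?_⟩
  refine (Nat.le_of_mul_le_mul_left (hβ.trans h) two_pos).trans ?_
  refine card_le_card_of_injOn (fun A : Finset α ↦ Aᶜ) ?_ (fun A _ B _ hAB ↦ compl_injective hAB)
  intro A hA
  rw [mem_coe, mem_filter] at hA
  rw [mem_coe, mem_coverSets, dual_spanning_compl_iff hE, hd, card_compl]
  refine ⟨fun x hx ↦ mem_compl.2 (disjoint_right.1 hA.2.2.1 hx), hA.2.1, ?_⟩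
  have : A.card + 1 = r := hA.2.2.2
  exact_mod_cast (by omega : Fintype.card α - A.card = Fintype.card α - r + 1)

/-- If all circuits in `Q` were large, a cocircuit avoiding `Q` would be heavy and would cover `X`.
-/
theorem exists_heavyCircuit_subset (hE : N.E = Set.univ) (hr : N.eRank = r)
    (hβ : 2 * β ≤ s * (s - 1)) {Q : Finset α} (hXQ : X ⊆ Q)
    (hX : ¬ Covered (certificate s β N) X) (hQ : ¬ N.Spanning Q)
    (hQr : N.eRk Q + 2 ≤ (Q.card : ℕ∞)) : ∃ C ∈ heavyCircuits s β N, C ⊆ Q := by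
  by_contra! hcon
  obtain ⟨K, hQK, hK⟩ := exists_cocircuit_disjoint hE hQ
  refine hX (Or.inr ⟨K, mem_heavyCircuits_dual hE hr hβ hK hQK hQr fun C hC hCQ ↦ ?_,
    disjoint_of_subset_left hXQ hQK⟩)
  by_contra! hs
  exact hcon C (mem_heavyCircuits.2 ⟨hC, Or.inl hs⟩) hCQ

theorem eRk_lt_of_not_spanning (hE : N.E = Set.univ) (hr : N.eRank = r) (hX : ¬ N.Spanning X) :
    N.eRk X < r := by
  have : N.RankFinite := Matroid.eRank_ne_top_iff N |>.1 (by rw [hr]; exact ENat.natCast_ne_top r)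
  rw [Matroid.spanning_iff_eRk_le (by simp [hE]), hr, not_le] at hX
  exact hX

theorem exists_heavyCircuit_of_not_spanning (hE : N.E = Set.univ) (hr : N.eRank = r)
    (hβ : 2 * β ≤ s * (s - 1)) {Q : Finset α} (hXQ : X ⊆ Q)
    (hX : ¬ Covered (certificate s β N) X) (hQ : ¬ N.Spanning Q)
    (hQr : Q.card = r + 1) : ∃ C ∈ heavyCircuits s β N, C ⊆ Q := by
  refine exists_heavyCircuit_subset hE hr hβ hXQ hX hQ ?_
  have h := Order.add_one_le_of_lt (eRk_lt_of_not_spanning hE hr hQ)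
  rw [hQr]
  push_cast
  calc N.eRk Q + 2 = N.eRk Q + 1 + 1 := by rw [add_assoc]; rfl
    _ ≤ r + 1 := add_le_add_left h 1

/-- This is the dual of `exists_heavyCircuit_of_not_spanning`, applied to complements. -/
theorem exists_heavyCocircuit_of_not_indep (hE : N.E = Set.univ) (hr : N.eRank = r)
    (hβ : 2 * β ≤ s * (s - 1)) {I : Finset α} (hIX : I ⊆ X)
    (hX : ¬ Covered (certificate s β N) X) (hI : ¬ N.Indep I)
    (hIr : I.card + 1 = r) : ∃ K ∈ heavyCircuits s β N✶, Disjoint I K := by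
  obtain ⟨hd, hrn⟩ := eRk_compl_dual hE hr
  obtain ⟨K, hK, hKI⟩ := exists_heavyCircuit_of_not_spanning (N := N✶) (X := Xᶜ) (Q := Iᶜ) hE hd hβ
    (compl_subset_compl.2 hIX) (by
      rw [certificate, N.dual_dual]
      exact fun h ↦ hX (covered_compl_swap.1 h)) (by rwa [dual_spanning_compl_iff hE]) (by
      rw [card_compl]; omega)
  exact ⟨K, hK, disjoint_right.2 fun x hx ↦ mem_compl.1 (hKI hx)⟩

theorem eRk_add_one_of_mem_residue (hE : N.E = Set.univ) (hr : N.eRank = r)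
    (hβ : 2 * β ≤ s * (s - 1)) (hX : X ∈ residue s β N) : N.eRk X + 1 = r := by
  rw [mem_residue] at hX
  have hXr : X.card = r := by
    rw [hr] at hX
    exact_mod_cast hX.1
  have hns : ¬ N.Spanning X := by rw [spanning_iff_indep_of_card hr hXr]; exact hX.2.1
  have hlt := Order.add_one_le_of_lt (eRk_lt_of_not_spanning hE hr hns)
  refine le_antisymm hlt ?_
  by_contra! hcon
  have h2 := Order.add_one_le_of_lt hcon
  obtain ⟨C, hC, hCX⟩ := exists_heavyCircuit_subset hE hr hβ Subset.rfl hX.2.2 hns (by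
    rw [hXr]
    calc N.eRk X + 2 = N.eRk X + 1 + 1 := by rw [add_assoc]; rfl
      _ ≤ r := h2)
  exact hX.2.2 (Or.inl ⟨C, hC, hCX⟩)

theorem card_of_mem_residue (hr : N.eRank = r) (hX : X ∈ residue s β N) : X.card = r := by
  rw [mem_residue, hr] at hX
  exact_mod_cast hX.1

theorem card_union_of_adjacent (hXY : X.card = Y.card) (hne : X ≠ Y) (h : (X \ Y).card ≤ 1) :
    (X ∪ Y).card = X.card + 1 ∧ (X ∩ Y).card + 1 = X.card := by
  have h1 := card_sdiff_add_card_inter X Y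
  have h2 := card_union_add_card_inter X Y
  have h3 : (X \ Y).card ≠ 0 := by
    intro h0
    rw [card_eq_zero, sdiff_eq_empty_iff_subset] at h0
    exact hne (eq_of_subset_of_card_le h0 hXY.ge)
  omega

/-- If `X ∪ Y` spans, it has a single circuit; this lies in both non-bases, so `X ∩ Y` is dependent
and avoids a heavy cocircuit. If `X ∪ Y` does not span, its nullity is at least two and it contains
a heavy circuit. -/
theorem linked_of_mem_residue (hE : N.E = Set.univ) (hr : N.eRank = r)
    (hβ : 2 * β ≤ s * (s - 1)) (hX : X ∈ residue s β N) (hY : Y ∈ residue s β N)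
    (hne : X ≠ Y) (hadj : (X \ Y).card ≤ 1) : Linked (certificate s β N) X Y := by
  have hXr := card_of_mem_residue hr hX
  have hYr := card_of_mem_residue hr hY
  rw [mem_residue] at hX hY
  obtain ⟨hu, hi⟩ := card_union_of_adjacent (hXr.trans hYr.symm) hne hadj
  refine ⟨hX.2.2, hY.2.2, hXr.trans hYr.symm, hadj, ?_⟩
  by_cases hsp : N.Spanning (X ∪ Y : Finset α)
  · right
    refine exists_heavyCocircuit_of_not_indep hE hr hβ (I := X ∩ Y) inter_subset_left hX.2.2
      (fun hind ↦ ?_) (by omega)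
    obtain ⟨C, hCX, hC⟩ := exists_circuit_subset hE hX.2.1
    obtain ⟨C', hCY, hC'⟩ := exists_circuit_subset hE hY.2.1
    have heq := isCircuit_unique_of_spanning hr hsp (by omega) hC hC'
      (hCX.trans subset_union_left) (hCY.trans subset_union_right)
    exact hC.not_indep (hind.subset (by
      exact_mod_cast subset_inter hCX (heq ▸ hCY)))
  · left
    exact exists_heavyCircuit_of_not_spanning hE hr hβ subset_union_left hX.2.2 hsp (by omega)

theorem subset_of_isCircuit_subset_union (hE : N.E = Set.univ) (hX : ¬ N.Indep X) (hY : N.Indep Y)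
    (hadj : (X \ Y).card ≤ 1) (hC : N.IsCircuit C) (hCXY : C ⊆ X ∪ Y) : C ⊆ X := by
  obtain ⟨C', hCX, hC'⟩ := exists_circuit_subset hE hX
  have hne : (X \ Y).Nonempty := by
    rw [nonempty_iff_ne_empty]
    intro h0
    rw [sdiff_eq_empty_iff_subset] at h0
    exact hX (hY.subset (by exact_mod_cast h0))
  obtain ⟨x, hx⟩ := card_eq_one.1 (le_antisymm hadj (card_pos.2 hne))
  have hsub : X ∪ Y ⊆ insert x Y := by
    intro z hz
    by_cases hzY : z ∈ Y
    · exact mem_insert_of_mem hzY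
    · have : z ∈ X \ Y := mem_sdiff.2 ⟨(mem_union.1 hz).resolve_right hzY, hzY⟩
      rw [hx, mem_singleton] at this
      exact this ▸ mem_insert_self _ _
  rw [isCircuit_unique_of_indep hY hsub hC hC' hCXY (hCX.trans subset_union_left)]
  exact hCX

/-- If `Y` were a base, `X ∪ Y` would contain just one circuit, the one inside `X`; a linking heavy
circuit would then lie in `X` and cover it. A linking cocircuit is treated dually. Thus the residue
is a union of linkage classes. -/
theorem mem_residue_of_linked (hE : N.E = Set.univ) (hr : N.eRank = r)
    (hX : X ∈ residue s β N) (h : Linked (certificate s β N) X Y) : Y ∈ residue s β N := by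
  have hXr := card_of_mem_residue hr hX
  rw [mem_residue] at hX ⊢
  obtain ⟨hcX, hcY, hcard, hadj, h⟩ := h
  refine ⟨by rw [← hcard]; exact hX.1, fun hY ↦ ?_, hcY⟩
  obtain ⟨C, hC, hCXY⟩ | ⟨K, hK, hKXY⟩ := h
  · exact hcX (Or.inl ⟨C, hC, subset_of_isCircuit_subset_union hE hX.2.1 hY hadj
      (isCircuit_of_mem_heavyCircuits hC) hCXY⟩)
  · refine hcX (Or.inr ⟨K, hK, ?_⟩)
    have h1 := subset_of_isCircuit_subset_union (N := N✶) (X := Xᶜ) (Y := Yᶜ) (C := K) hE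
      (by rw [dual_indep_compl_iff hE, spanning_iff_indep_of_card hr hXr]; exact hX.2.1)
      (by rwa [dual_indep_compl_iff hE, spanning_iff_indep_of_card hr (hcard ▸ hXr)])
      (by
        have : Xᶜ \ Yᶜ = Y \ X := by
          ext z
          simp only [mem_sdiff, mem_compl, not_not]
          tauto
        rw [this, ← card_sdiff_eq_of_card_eq hcard]
        exact hadj)
      (isCircuit_of_mem_heavyCircuits hK) (by
        intro z hz
        rw [← compl_inter, mem_compl]
        exact disjoint_right.1 hKXY hz)
    exact disjoint_right.2 fun z hz ↦ mem_compl.1 (h1 hz)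

theorem Linked.symm (h : Linked Z X Y) : Linked Z Y X := by
  obtain ⟨h1, h2, h3, h4, h5⟩ := h
  refine ⟨h2, h1, h3.symm, (card_sdiff_eq_of_card_eq h3) ▸ h4, ?_⟩
  rwa [union_comm, inter_comm]

theorem rep_mem_residue_iff (hE : N.E = Set.univ) (hr : N.eRank = r) :
    rep (certificate s β N) X ∈ residue s β N ↔ X ∈ residue s β N :=
  rep_induction fun _ _ h ↦
    ⟨fun hX ↦ mem_residue_of_linked hE hr hX h, fun hY ↦ mem_residue_of_linked hE hr hY h.symm⟩

theorem rep_mem_core_iff (hE : N.E = Set.univ) (hr : N.eRank = r) :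
    rep (certificate s β N) X ∈ core s β N ↔ X ∈ residue s β N := by
  rw [mem_core, rep_mem_residue_iff hE hr, and_iff_left rep_rep]

/-- Adjacent members of the residue are linked, so they share their representative. -/
theorem stable_core (hE : N.E = Set.univ) (hr : N.eRank = r) (hβ : 2 * β ≤ s * (s - 1)) :
    Stable (core s β N) := by
  intro X hX Y hY hne
  by_contra! hlt
  rw [mem_core] at hX hY
  refine hne ?_
  rw [← hX.2, ← hY.2]
  exact rep_eq_of_linked (linked_of_mem_residue hE hr hβ hX.1 hY.1 hne (by omega))

/-- The linkage classes and their representatives depend on the certificate alone, so the core tells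
which classes make up the residue. -/
theorem core_ext {N' : Matroid α} (hE : N.E = Set.univ) (hE' : N'.E = Set.univ)
    (hr : N.eRank = r) (hr' : N'.eRank = r) (hZ : certificate s β N = certificate s β N')
    (h : core s β N = core s β N') : N = N' := by
  refine residue_ext hE hE' hr hr' hZ ?_
  ext X
  rw [← rep_mem_core_iff hE hr, ← rep_mem_core_iff hE' hr', h, hZ]

end Encoding

/-! ### Exchanges at circuits properly contained in members of the core -/

section CircuitMoves

variable {α : Type*} [Fintype α] [DecidableEq α] {N : Matroid α} {r s t β : ℕ}
  {X X' Y C C' K : Finset α} {Z : Finset (Finset α) × Finset (Finset α)}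

theorem mem_residue_of_mem_core (hX : X ∈ core s β N) : X ∈ residue s β N :=
  (mem_core.1 hX).1

theorem not_covered_of_mem_residue (hX : X ∈ residue s β N) : ¬ Covered (certificate s β N) X :=
  (mem_residue.1 hX).2.2

theorem exists_indep_subset_of_mem_residue (hE : N.E = Set.univ) (hr : N.eRank = r)
    (hβ : 2 * β ≤ s * (s - 1)) (hX : X ∈ residue s β N) :
    ∃ B ⊆ X, N.Indep B ∧ B.card + 1 = r := by
  obtain ⟨B, hB⟩ := N.exists_isBasis (X : Set α) (hE ▸ Set.subset_univ _)
  lift B to Finset α using Set.toFinite _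
  refine ⟨B, by exact_mod_cast hB.subset, hB.indep, ?_⟩
  have h := eRk_add_one_of_mem_residue hE hr hβ hX
  rw [← hB.encard_eq_eRk, Set.encard_coe_eq_coe_finsetCard] at h
  exact_mod_cast h

theorem isCircuit_unique_of_mem_residue (hE : N.E = Set.univ) (hr : N.eRank = r)
    (hβ : 2 * β ≤ s * (s - 1)) (hX : X ∈ residue s β N) (hC : N.IsCircuit C)
    (hC' : N.IsCircuit C') (hCX : C ⊆ X) (hCX' : C' ⊆ X) : C = C' := by
  obtain ⟨B, hBX, hB, hBr⟩ := exists_indep_subset_of_mem_residue hE hr hβ hX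
  have hXr := card_of_mem_residue hr hX
  obtain ⟨e, he⟩ := card_eq_one.1 (show (X \ B).card = 1 by
    rw [card_sdiff_of_subset hBX]; omega)
  refine isCircuit_unique_of_indep hB (e := e) (Q := X) ?_ hC hC' hCX hCX'
  intro x hx
  by_cases hxB : x ∈ B
  · exact mem_insert_of_mem hxB
  · have : x ∈ X \ B := mem_sdiff.2 ⟨hx, hxB⟩
    rw [he, mem_singleton] at this
    exact this ▸ mem_insert_self _ _

theorem indep_insert_of_mem_cocircuit {B : Finset α} (hE : N.E = Set.univ) (hB : N.Indep B)
    (hK : N.IsCocircuit K) (hBK : Disjoint B K) {v : α} (hv : v ∈ K) :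
    N.Indep (insert v B : Finset α) := by
  rw [coe_insert]
  exact ((hB.notMem_closure_iff (hE ▸ Set.mem_univ v)).1
    (notMem_closure_of_cocircuit hK hBK hv)).1

theorem spanning_of_indep_subset (hE : N.E = Set.univ) (hr : N.eRank = r) {B : Finset α}
    (hB : N.Indep B) (hBr : B.card = r) (hBX : B ⊆ X) : N.Spanning X :=
  ((spanning_iff_indep_of_card hr hBr).2 hB).superset (by exact_mod_cast hBX)
    (hE ▸ Set.subset_univ _)

theorem spanning_insert_of_mem_residue (hE : N.E = Set.univ) (hr : N.eRank = r)
    (hβ : 2 * β ≤ s * (s - 1)) (hX : X ∈ residue s β N) (hK : N.IsCocircuit K)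
    (hXK : Disjoint X K) {y : α} (hy : y ∈ K) : N.Spanning (insert y X : Finset α) := by
  obtain ⟨B, hBX, hB, hBr⟩ := exists_indep_subset_of_mem_residue hE hr hβ hX
  have hBK := disjoint_of_subset_left hBX hXK
  refine spanning_of_indep_subset hE hr (indep_insert_of_mem_cocircuit hE hB hK hBK hy) ?_
    (insert_subset_insert _ hBX)
  rw [card_insert_of_notMem (disjoint_right.1 hBK hy), hBr]

theorem isCocircuit_of_mem_certificate (hK : K ∈ (certificate s β N).2) : N.IsCocircuit K :=
  isCircuit_of_mem_heavyCircuits hK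

theorem exists_heavyCocircuit_erase (hE : N.E = Set.univ) (hr : N.eRank = r)
    (hβ : 2 * β ≤ s * (s - 1)) (hX : X ∈ residue s β N) {e : α} (he : e ∈ X)
    (hA : ¬ N.Indep (X.erase e : Finset α)) :
    ∃ K ∈ (certificate s β N).2, Disjoint (X.erase e) K ∧ e ∈ K := by
  have hXr := card_of_mem_residue hr hX
  have hpos : 0 < X.card := card_pos.2 ⟨e, he⟩
  obtain ⟨K, hK, hd⟩ := exists_heavyCocircuit_of_not_indep hE hr hβ (erase_subset e X)
    (not_covered_of_mem_residue hX) hA (by rw [card_erase_of_mem he]; omega)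
  refine ⟨K, hK, hd, ?_⟩
  by_contra heK
  refine not_covered_of_mem_residue hX (Or.inr ⟨K, hK, disjoint_left.2 fun x hx hxK ↦ ?_⟩)
  exact disjoint_left.1 hd (mem_erase.2 ⟨fun h ↦ heK (h ▸ hxK), hx⟩) hxK

theorem linked_insert_erase {e v : α} (hX : ¬ Covered Z X) (he : e ∈ X) (hv : v ∉ X.erase e)
    (hK : K ∈ Z.2) (hAK : Disjoint (X.erase e) K) (hne : v ≠ e)
    (hY : ¬ Covered Z (insert v (X.erase e))) : Linked Z X (insert v (X.erase e)) := by
  have hpos : 0 < X.card := card_pos.2 ⟨e, he⟩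
  refine ⟨hX, hY, ?_, ?_, Or.inr ⟨K, hK, disjoint_of_subset_left ?_ hAK⟩⟩
  · rw [card_insert_of_notMem hv, card_erase_of_mem he]
    omega
  · refine (card_le_card (t := {e}) fun x hx ↦ ?_).trans (card_singleton e).le
    simp only [mem_sdiff, mem_insert, mem_erase, not_or] at hx
    rw [mem_singleton]
    tauto
  · intro x hx
    simp only [mem_inter, mem_insert, mem_erase] at hx ⊢
    obtain ⟨hxX, rfl | h⟩ := hx
    · exact ⟨hne, hxX⟩
    · exact h

/-- A member of the core that nearly contains a dependent hyperplane of another member of the core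
contains the circuit in that hyperplane. -/
theorem subset_of_card_erase_sdiff_le (hE : N.E = Set.univ) (hr : N.eRank = r)
    (hβ : 2 * β ≤ s * (s - 1)) (hX : X ∈ core s β N) (hX' : X' ∈ core s β N) (hne : X ≠ X')
    {e : α} (he : e ∈ X) (hA : ¬ N.Indep (X.erase e : Finset α))
    (hadj : (X.erase e \ X').card ≤ 1) (hC : N.IsCircuit C) (hCX : C ⊆ X) : C ⊆ X' := by
  have hXR := mem_residue_of_mem_core hX
  have hXR' := mem_residue_of_mem_core hX'
  have hXr := card_of_mem_residue hr hXR
  have hXr' := card_of_mem_residue hr hXR'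
  have hpos : 0 < X.card := card_pos.2 ⟨e, he⟩
  obtain ⟨C₀, hCA₀, hC₀⟩ := exists_circuit_subset hE hA
  obtain rfl := isCircuit_unique_of_mem_residue hE hr hβ hXR hC hC₀ hCX
    (hCA₀.trans (erase_subset _ _))
  obtain ⟨K, hK, hAK, heK⟩ := exists_heavyCocircuit_erase hE hr hβ hXR he hA
  -- Since `X'` is uncovered it meets the heavy cocircuit `K` that avoids `X.erase e`; replacing `e`
  -- by such a `v` moves `X` next to `X'`.
  obtain ⟨v, hvX', hvK⟩ : ∃ v ∈ X', v ∈ K := by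
    by_contra! hcon
    exact not_covered_of_mem_residue hXR' (Or.inr ⟨K, hK, disjoint_left.2 hcon⟩)
  have hvA : v ∉ X.erase e := disjoint_right.1 hAK hvK
  have hve : v ≠ e := by
    rintro rfl
    have h2 := stable_core hE hr hβ X hX X' hX' hne
    have h3 : X \ X' ⊆ X.erase v \ X' := fun x hx ↦ by
      rw [mem_sdiff] at hx ⊢
      exact ⟨mem_erase.2 ⟨fun h ↦ hx.2 (h ▸ hvX'), hx.1⟩, hx.2⟩
    have := card_le_card h3
    omega
  set W := insert v (X.erase e) with hW
  have hWr : W.card = r := by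
    rw [hW, card_insert_of_notMem hvA, card_erase_of_mem he]
    omega
  have hWX' : (W \ X').card ≤ 1 := by
    refine (card_le_card fun x hx ↦ ?_).trans hadj
    rw [mem_sdiff, hW, mem_insert] at hx
    rw [mem_sdiff]
    exact ⟨hx.1.resolve_left fun h ↦ hx.2 (h ▸ hvX'), hx.2⟩
  by_cases hcov : Covered (certificate s β N) W
  swap
  -- If `W` is uncovered, it is linked to `X` and equal or linked to `X'`, so the two core members
  -- would coincide.
  · exfalso
    have hl := linked_insert_erase (not_covered_of_mem_residue hXR) he hvA hK hAK hve hcov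
    have hWR := mem_residue_of_linked hE hr hXR hl
    refine hne ?_
    rw [← (mem_core.1 hX).2, ← (mem_core.1 hX').2, rep_eq_of_linked hl, ← hW]
    obtain h | h := eq_or_ne W X'
    · rw [h]
    · exact rep_eq_of_linked (linked_of_mem_residue hE hr hβ hWR hXR' h hWX')
  have hWne : W ≠ X' := fun h ↦ not_covered_of_mem_residue hXR' (h ▸ hcov)
  obtain ⟨D, hD, hDW⟩ | ⟨K', hK', hWK'⟩ := hcov
  -- A heavy circuit covering `W` but not `X` contains `v`, and would meet the cocircuit `K` in `v`
  -- alone.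
  · exfalso
    have hvD : v ∈ D := by
      by_contra hvD
      refine not_covered_of_mem_residue hXR (Or.inl ⟨D, hD, fun x hx ↦ ?_⟩)
      exact mem_of_mem_erase ((mem_insert.1 (hDW hx)).resolve_left fun h ↦ hvD (h ▸ hx))
    refine (isCircuit_of_mem_heavyCircuits hD).inter_isCocircuit_ne_singleton
      (isCocircuit_of_mem_certificate hK) (e := v) ?_
    ext x
    simp only [Set.mem_inter_iff, mem_coe, Set.mem_singleton_iff]
    constructor
    · rintro ⟨hxD, hxK⟩
      exact (mem_insert.1 (hDW hxD)).resolve_right fun h ↦ disjoint_left.1 hAK h hxK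
    · rintro rfl
      exact ⟨hvD, hvK⟩
  -- If a heavy cocircuit `K'` covers `W`, adding `v` and `g` to an independent set of `r - 2`
  -- elements shows that `W ∪ X'` spans. Its nullity is one, so the circuit inside `X'` is `C`.
  · obtain ⟨g, hgX', hgK'⟩ : ∃ g ∈ X', g ∈ K' := by
      by_contra! hcon
      exact not_covered_of_mem_residue hXR' (Or.inr ⟨K', hK', disjoint_left.2 hcon⟩)
    obtain ⟨B, hBX, hB, hBr⟩ := exists_indep_subset_of_mem_residue hE hr hβ hXR
    have hB1 : B.erase e ⊆ X.erase e := erase_subset_erase _ hBX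
    have hi1 : N.Indep (insert v (B.erase e) : Finset α) :=
      indep_insert_of_mem_cocircuit hE (hB.subset (by exact_mod_cast erase_subset e B))
        (isCocircuit_of_mem_certificate hK) (disjoint_of_subset_left hB1 hAK) hvK
    have hd2 : Disjoint (insert v (B.erase e)) K' :=
      disjoint_of_subset_left (insert_subset_insert _ hB1) hWK'
    have hi2 := indep_insert_of_mem_cocircuit hE hi1 (isCocircuit_of_mem_certificate hK') hd2 hgK'
    have heB : e ∈ B := by
      by_contra heB
      refine hC₀.not_indep (hB.subset ?_)
      have hsub : B ⊆ X.erase e := fun x hx ↦ mem_erase.2 ⟨fun h ↦ heB (h ▸ hx), hBX hx⟩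
      rw [eq_of_subset_of_card_le hsub (by rw [card_erase_of_mem he]; omega)]
      exact_mod_cast hCA₀
    have hcard : (insert g (insert v (B.erase e))).card = r := by
      rw [card_insert_of_notMem (disjoint_right.1 hd2 hgK'),
        card_insert_of_notMem fun h ↦ hvA (hB1 h), card_erase_of_mem heB]
      have : 0 < B.card := card_pos.2 ⟨e, heB⟩
      omega
    have hsp : N.Spanning (W ∪ X' : Finset α) :=
      spanning_of_indep_subset hE hr hi2 hcard (insert_subset (mem_union_right _ hgX')
        ((insert_subset_insert _ hB1).trans subset_union_left))
    obtain ⟨C', hCX', hC'⟩ := exists_circuit_subset hE (mem_residue.1 hXR').2.1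
    rw [isCircuit_unique_of_spanning hr hsp
      (by rw [(card_union_of_adjacent (hWr.trans hXr'.symm) hWne hWX').1, hWr]) hC hC'
      ((hCA₀.trans (subset_insert _ _)).trans subset_union_left) (hCX'.trans subset_union_right)]
    exact hCX'

theorem lt_card_of_isCocircuit_disjoint (hX : X ∈ residue s β N) (hK : N.IsCocircuit K)
    (hXK : Disjoint X K) : s < K.card := by
  by_contra! hle
  exact not_covered_of_mem_residue hX (Or.inr ⟨K, mem_heavyCircuits.2 ⟨hK, Or.inl hle⟩, hXK⟩)

/-- Since `X` is uncovered, `C` is not heavy. Each core member `X'` containing `C` avoids a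
cocircuit with more than `s` elements, and adding any of these to `X'` gives a spanning set of
nullity one. By stability different `X'` give different sets. -/
theorem card_core_supersets_lt (hE : N.E = Set.univ) (hr : N.eRank = r)
    (hβ : 2 * β ≤ s * (s - 1)) (hst : β ≤ s * t) (hX : X ∈ residue s β N) (hC : N.IsCircuit C)
    (hCX : C ⊆ X) : ((core s β N).filter fun X' ↦ C ⊆ X').card < t := by
  have hlt : (coverSets N C).card < s * t := by
    refine lt_of_lt_of_le ?_ hst
    by_contra! hle
    exact not_covered_of_mem_residue hX
      (Or.inl ⟨C, mem_heavyCircuits.2 ⟨hC, Or.inr hle⟩, hCX⟩)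
  have hex : ∀ X' ∈ core s β N, ∃ K, Disjoint X' K ∧ N.IsCocircuit K := fun X' hX' ↦
    exists_cocircuit_disjoint hE (by
      rw [spanning_iff_indep_of_card hr (card_of_mem_residue hr (mem_residue_of_mem_core hX'))]
      exact (mem_residue.1 (mem_residue_of_mem_core hX')).2.1)
  choose! K hXK hK using hex
  refine Nat.lt_of_mul_lt_mul_left (a := s) (lt_of_le_of_lt ?_ hlt)
  set F := (core s β N).filter fun X' ↦ C ⊆ X' with hF
  have hFm : ∀ X' ∈ F, X' ∈ core s β N ∧ C ⊆ X' := fun X' h ↦ mem_filter.1 h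
  calc s * F.card = ∑ _X' ∈ F, s := by rw [sum_const, smul_eq_mul, mul_comm]
    _ ≤ ∑ X' ∈ F, ((K X').image fun y ↦ insert y X').card := by
        refine sum_le_sum fun X' hX' ↦ ?_
        have h1 := (hFm X' hX').1
        rw [card_image_of_injOn]
        · exact (lt_card_of_isCocircuit_disjoint (mem_residue_of_mem_core h1) (hK X' h1)
            (hXK X' h1)).le
        · intro y hy y' hy' heq
          have hy1 : y ∉ X' := disjoint_right.1 (hXK X' h1) hy
          have : y ∈ insert y' X' := (show insert y X' = insert y' X' from heq) ▸
            mem_insert_self y X'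
          exact (mem_insert.1 this).resolve_right hy1
    _ = (F.biUnion fun X' ↦ (K X').image fun y ↦ insert y X').card := by
        refine (card_biUnion fun X₁ h₁ X₂ h₂ hne ↦ ?_).symm
        rw [Function.onFun, disjoint_left]
        intro Q hQ hQ'
        obtain ⟨y, hy, rfl⟩ := mem_image.1 hQ
        obtain ⟨y', hy', heq⟩ := mem_image.1 hQ'
        have h2 := stable_core hE hr hβ X₁ (hFm X₁ h₁).1 X₂ (hFm X₂ h₂).1 hne
        have h3 : X₁ \ X₂ ⊆ {y'} := fun x hx ↦ by
          rw [mem_sdiff] at hx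
          have : x ∈ insert y' X₂ := heq ▸ mem_insert_of_mem hx.1
          exact mem_singleton.2 ((mem_insert.1 this).resolve_right hx.2)
        have := card_le_card h3
        rw [card_singleton] at this
        omega
    _ ≤ (coverSets N C).card := by
        refine card_le_card fun Q hQ ↦ ?_
        rw [mem_biUnion] at hQ
        obtain ⟨X', hX', hQ⟩ := hQ
        obtain ⟨y, hy, rfl⟩ := mem_image.1 hQ
        have h1 := (hFm X' hX').1
        refine mem_coverSets.2 ⟨(hFm X' hX').2.trans (subset_insert _ _),
          spanning_insert_of_mem_residue hE hr hβ (mem_residue_of_mem_core h1) (hK X' h1)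
            (hXK X' h1) hy, ?_⟩
        rw [card_insert_of_notMem (disjoint_right.1 (hXK X' h1) hy),
          card_of_mem_residue hr (mem_residue_of_mem_core h1), hr]
        push_cast
        rfl

/-- The circuits that are properly contained in a member of the core. -/
noncomputable def coreCircuits (s β : ℕ) (N : Matroid α) : Finset (Finset α) := by
  classical
  exact univ.filter fun C ↦ N.IsCircuit C ∧ ∃ X ∈ core s β N, C ⊂ X

/-- The members of the core that are circuits. -/
noncomputable def circuitCore (s β : ℕ) (N : Matroid α) : Finset (Finset α) := by
  classical
  exact (core s β N).filter fun X ↦ N.IsCircuit X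

theorem mem_coreCircuits :
    C ∈ coreCircuits s β N ↔ N.IsCircuit C ∧ ∃ X ∈ core s β N, C ⊂ X := by
  simp [coreCircuits]

theorem mem_circuitCore : X ∈ circuitCore s β N ↔ X ∈ core s β N ∧ N.IsCircuit X := by
  simp [circuitCore]

/-- The core can be recovered from the certificate, the circuits properly inside core members, and
the core members that are circuits. -/
theorem mem_core_iff (hE : N.E = Set.univ) (hr : N.eRank = r) : X ∈ core s β N ↔
    X.card = r ∧ ¬ Covered (certificate s β N) X ∧ rep (certificate s β N) X = X ∧
      (X ∈ circuitCore s β N ∨ ∃ C ∈ coreCircuits s β N, C ⊆ X) := by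
  constructor
  · intro hX
    have hXR := mem_residue_of_mem_core hX
    refine ⟨card_of_mem_residue hr hXR, not_covered_of_mem_residue hXR, (mem_core.1 hX).2, ?_⟩
    obtain ⟨C, hCX, hC⟩ := exists_circuit_subset hE (mem_residue.1 hXR).2.1
    by_cases h : C = X
    · exact Or.inl (mem_circuitCore.2 ⟨hX, h ▸ hC⟩)
    · exact Or.inr ⟨C, mem_coreCircuits.2 ⟨hC, X, hX, hCX.ssubset_of_ne h⟩, hCX⟩
  · rintro ⟨h1, h2, h3, h | ⟨C, hC, hCX⟩⟩
    · exact (mem_circuitCore.1 h).1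
    · refine mem_core.2 ⟨mem_residue.2 ⟨by rw [hr, h1], fun hi ↦ ?_, h2⟩, h3⟩
      exact (mem_coreCircuits.1 hC).1.not_indep (hi.subset (by exact_mod_cast hCX))

theorem ext_of_coreCircuits {N' : Matroid α} (hE : N.E = Set.univ) (hE' : N'.E = Set.univ)
    (hr : N.eRank = r) (hr' : N'.eRank = r) (hZ : certificate s β N = certificate s β N')
    (h : coreCircuits s β N = coreCircuits s β N')
    (h' : circuitCore s β N = circuitCore s β N') : N = N' := by
  refine core_ext hE hE' hr hr' hZ ?_
  ext X
  rw [mem_core_iff hE hr, mem_core_iff hE' hr', hZ, h, h']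

/-- Decoding of an exchange that inserted `g` into an uncovered set. -/
noncomputable def decodeInsert (Z : Finset (Finset α) × Finset (Finset α)) (g : α)
    (Y : Finset α) : Finset α := by
  classical
  -- An uncovered result is linked to the original or equal to it, so its representative is the
  -- original. For a covered result, any uncovered set obtained by replacing `g` will do, as long as
  -- the common part avoids a given cocircuit: all such sets are linked to each other.
  exact if Covered Z Y then
    if h : ∃ X, ¬ Covered Z X ∧ ∃ y ∈ X, X.erase y = Y.erase g ∧ ∃ K ∈ Z.2,
      Disjoint (X.erase y) K then rep Z h.choose else Y
    else rep Z Y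

theorem decodeInsert_of_mem_core (hX : X ∈ core s β N) (g : α) :
    decodeInsert (certificate s β N) g X = X := by
  rw [decodeInsert, if_neg (not_covered_of_mem_residue (mem_residue_of_mem_core hX))]
  exact (mem_core.1 hX).2

theorem rep_eq_of_erase_eq {X₁ X₂ : Finset α} {y₁ y₂ : α} (h₁ : ¬ Covered Z X₁)
    (h₂ : ¬ Covered Z X₂) (hy₁ : y₁ ∈ X₁) (hy₂ : y₂ ∈ X₂) (heq : X₁.erase y₁ = X₂.erase y₂)
    (hK : K ∈ Z.2) (hd : Disjoint (X₁.erase y₁) K) : rep Z X₁ = rep Z X₂ := by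
  have hX₂ : X₂ = insert y₂ (X₁.erase y₁) := by rw [heq, insert_erase hy₂]
  obtain rfl | hne := eq_or_ne y₂ y₁
  · rw [hX₂, insert_erase hy₁]
  · rw [hX₂]
    refine rep_eq_of_linked (linked_insert_erase h₁ hy₁ ?_ hK hd hne (hX₂ ▸ h₂))
    rw [heq]
    exact notMem_erase _ _

theorem decodeInsert_insert_erase (hX : X ∈ core s β N) {e g : α} (he : e ∈ X) (hg : g ∉ X)
    (hK : K ∈ (certificate s β N).2) (hd : Disjoint (X.erase e) K) :
    decodeInsert (certificate s β N) g (insert g (X.erase e)) = X := by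
  have hX0 := not_covered_of_mem_residue (mem_residue_of_mem_core hX)
  have hgA : g ∉ X.erase e := fun h ↦ hg (mem_of_mem_erase h)
  rw [decodeInsert]
  split_ifs with h1 h2
  · obtain ⟨h3, y, hy, h4, K', hK', h5⟩ := h2.choose_spec
    rw [rep_eq_of_erase_eq h3 hX0 hy he (h4.trans (erase_insert hgA)) hK' h5]
    exact (mem_core.1 hX).2
  · exact absurd ⟨X, hX0, e, he, (erase_insert hgA).symm, K, hK, hd⟩ h2
  · have h3 : (insert g (X.erase e)).erase g = X.erase e := erase_insert hgA
    rw [rep_eq_of_erase_eq h1 hX0 (mem_insert_self _ _) he h3 hK (h3.symm ▸ hd)]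
    exact (mem_core.1 hX).2

/-- Each `X'` contains at least `r - 2` elements of `A`, hence at most two others. -/
theorem card_blocked_le {A : Finset α} {F : Finset (Finset α)} (hA : A.card + 1 = r)
    (hF : ∀ X' ∈ F, X'.card = r ∧ (A \ X').card ≤ 1) (ht : F.card ≤ t) :
    (F.biUnion fun X' ↦ X' \ A).card ≤ 2 * t := by
  refine (card_biUnion_le_card_mul F _ 2 fun X' hX' ↦ ?_).trans (by omega)
  have h1 := card_sdiff_add_card_inter X' A
  have h2 := card_sdiff_add_card_inter A X'
  rw [inter_comm] at h2
  have := hF X' hX'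
  omega

/-- For a circuit `C` properly inside a core member `X`, an element `e` of `X \ C` is replaced by
`g`. Core members nearly containing `X.erase e` must contain `C`, so there are at most `t`; they
block at most `2 * t` choices of `g`, and at least `s` remain. Pigeonhole gives one `g` serving many
circuits. -/
theorem exists_moves_of_coreCircuits (hE : N.E = Set.univ) (hr : N.eRank = r)
    (hβ : 2 * β ≤ s * (s - 1)) (hst : β ≤ s * t) (hn : r + s + 2 * t ≤ Fintype.card α)
    {k : ℕ} (hk : Fintype.card α * k ≤ (coreCircuits s β N).card * s) (hα : 0 < Fintype.card α) :
    ∃ g : α, ∃ J ⊆ core s β N, k ≤ J.card ∧ ∃ μ : Finset α → Finset α,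
      ∀ X ∈ J, decodeInsert (certificate s β N) g (μ X) = X ∧ μ X ≠ X ∧ (μ X).card = r ∧
        (∀ X' ∈ core s β N, X ≠ X' → 2 ≤ (μ X \ X').card) ∧
        (∀ X' ∈ J, X ≠ X' → 2 ≤ (μ X \ μ X').card) := by
  classical
  have : Nonempty α := Fintype.card_pos_iff.1 hα
  have hex : ∀ C ∈ coreCircuits s β N, ∃ X e K, X ∈ core s β N ∧ C ⊆ X ∧ e ∈ X ∧ e ∉ C ∧
      K ∈ (certificate s β N).2 ∧ Disjoint (X.erase e) K ∧ ¬ N.Indep (X.erase e : Finset α) := by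
    intro C hC
    obtain ⟨hC, X, hX, hCX⟩ := mem_coreCircuits.1 hC
    obtain ⟨e, he, heC⟩ := exists_of_ssubset hCX
    have hA : ¬ N.Indep (X.erase e : Finset α) := fun hi ↦ hC.not_indep (hi.subset (by
      exact_mod_cast (fun x hx ↦ mem_erase.2 ⟨fun h ↦ heC (h ▸ hx), hCX.1 hx⟩ :
        C ⊆ X.erase e)))
    obtain ⟨K, hK, hd, -⟩ := exists_heavyCocircuit_erase hE hr hβ (mem_residue_of_mem_core hX) he hA
    exact ⟨X, e, K, hX, hCX.1, he, heC, hK, hd, hA⟩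
  choose! X e K hX hCX he heC hK hd hA using hex
  have hcirc : ∀ C ∈ coreCircuits s β N, N.IsCircuit C := fun C hC ↦ (mem_coreCircuits.1 hC).1
  have hinj : ∀ C ∈ coreCircuits s β N, ∀ C' ∈ coreCircuits s β N, C' ⊆ X C → C = C' :=
    fun C hC C' hC' h ↦ isCircuit_unique_of_mem_residue hE hr hβ
      (mem_residue_of_mem_core (hX C hC)) (hcirc C hC) (hcirc C' hC') (hCX C hC) h
  set A : Finset α → Finset α := fun C ↦ (X C).erase (e C) with hAdef
  have hXr : ∀ C ∈ coreCircuits s β N, (X C).card = r := fun C hC ↦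
    card_of_mem_residue hr (mem_residue_of_mem_core (hX C hC))
  have hAr : ∀ C ∈ coreCircuits s β N, (A C).card + 1 = r := fun C hC ↦ by
    have : 0 < (X C).card := card_pos.2 ⟨_, he C hC⟩
    rw [hAdef, card_erase_of_mem (he C hC), ← hXr C hC]
    omega
  set F : Finset α → Finset (Finset α) := fun C ↦ (core s β N).filter fun X' ↦
    X' ≠ X C ∧ (A C \ X').card ≤ 1 with hF
  have hFt : ∀ C ∈ coreCircuits s β N, (F C).card ≤ t := fun C hC ↦ by
    refine (card_le_card ?_).trans (card_core_supersets_lt hE hr hβ hst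
      (mem_residue_of_mem_core (hX C hC)) (hcirc C hC) (hCX C hC)).le
    intro X' hX'
    rw [hF, mem_filter] at hX'
    exact mem_filter.2 ⟨hX'.1, subset_of_card_erase_sdiff_le hE hr hβ (hX C hC) hX'.1
      hX'.2.1.symm (he C hC) (hA C hC) hX'.2.2 (hcirc C hC) (hCX C hC)⟩
  set G : Finset α → Finset α := fun C ↦ (X C ∪ (F C).biUnion fun X' ↦ X' \ A C)ᶜ with hG
  have hGs : ∀ C ∈ coreCircuits s β N, s ≤ (G C).card := fun C hC ↦ by
    have h1 : ((F C).biUnion fun X' ↦ X' \ A C).card ≤ 2 * t :=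
      card_blocked_le (hAr C hC) (fun X' hX' ↦ by
        rw [hF, mem_filter] at hX'
        exact ⟨card_of_mem_residue hr (mem_residue_of_mem_core hX'.1), hX'.2.2⟩) (hFt C hC)
    have h2 := card_union_le (X C) ((F C).biUnion fun X' ↦ X' \ A C)
    have h3 := hXr C hC
    rw [hG, card_compl]
    omega
  have hGm : ∀ C ∈ coreCircuits s β N, ∀ g ∈ G C, g ∉ X C ∧ ∀ X' ∈ core s β N, X C ≠ X' →
      2 ≤ (insert g (A C) \ X').card := fun C hC g hg ↦ by
    rw [hG, mem_compl, mem_union, not_or] at hg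
    refine ⟨hg.1, fun X' hX' hne ↦ ?_⟩
    have hgA : g ∉ A C := fun h ↦ hg.1 (mem_of_mem_erase h)
    have h2 := stable_core hE hr hβ _ (hX C hC) X' hX' hne
    by_contra! hlt
    have h3 : A C \ X' ⊆ insert g (A C) \ X' := sdiff_subset_sdiff (subset_insert _ _) subset_rfl
    have h4 : X' ∈ F C := by
      rw [hF, mem_filter]
      exact ⟨hX', hne.symm, (card_le_card h3).trans (by omega)⟩
    have hgX' : g ∉ X' := fun h ↦ hg.2 (mem_biUnion.2 ⟨X', h4, mem_sdiff.2 ⟨h, hgA⟩⟩)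
    have h5 : insert g (A C) \ X' = insert g (A C \ X') := insert_sdiff_of_notMem _ hgX'
    rw [h5, card_insert_of_notMem fun h ↦ hgA (mem_sdiff.1 h).1] at hlt
    have h6 : X C \ X' ⊆ insert (e C) (A C \ X') := fun x hx ↦ by
      rw [mem_sdiff] at hx
      rw [mem_insert, mem_sdiff, hAdef, mem_erase]
      tauto
    have h7 := (card_le_card h6).trans (card_insert_le _ _)
    omega
  obtain ⟨g, hg⟩ := card_pigeonhole (coreCircuits s β N) G hGs hk hα
  set T := (coreCircuits s β N).filter fun C ↦ g ∈ G C with hT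
  have hTm : ∀ C ∈ T, C ∈ coreCircuits s β N ∧ g ∈ G C := fun C hC ↦ mem_filter.1 hC
  have hXinj : Set.InjOn X T := fun C hC C' hC' h ↦
    hinj C (hTm C hC).1 C' (hTm C' hC').1 (h ▸ hCX C' (hTm C' hC').1)
  have : Nonempty (Finset α) := ⟨∅⟩
  set ν := Function.invFunOn X (T : Set (Finset α)) with hν
  have hνX : ∀ C ∈ T, ν (X C) = C := fun C hC ↦ hXinj.leftInvOn_invFunOn hC
  refine ⟨g, T.image X, fun Y hY ↦ ?_, by rwa [card_image_of_injOn hXinj],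
    fun Y ↦ insert g (A (ν Y)), fun Y hY ↦ ?_⟩
  · obtain ⟨C, hC, rfl⟩ := mem_image.1 hY
    exact hX C (hTm C hC).1
  obtain ⟨C, hCT, rfl⟩ := mem_image.1 hY
  simp only [hνX C hCT]
  obtain ⟨hC, hgC⟩ := hTm C hCT
  obtain ⟨hgX, hgs⟩ := hGm C hC g hgC
  have hgA : g ∉ A C := fun h ↦ hgX (mem_of_mem_erase h)
  refine ⟨decodeInsert_insert_erase (hX C hC) (he C hC) hgX (hK C hC) (hd C hC),
    fun h ↦ hgX (h ▸ mem_insert_self _ _), by rw [card_insert_of_notMem hgA, hAr C hC], hgs, ?_⟩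
  intro Y' hY' hne
  obtain ⟨C', hCT', rfl⟩ := mem_image.1 hY'
  simp only [hνX C' hCT']
  obtain ⟨hC', hgC'⟩ := hTm C' hCT'
  -- Two moved sets that are too close would force `C ⊆ X C'`, but `X C'` contains only the circuit
  -- `C'`.
  by_contra! hlt
  have h1 : A C \ X C' ⊆ insert g (A C) \ insert g (A C') := fun x hx ↦ by
    rw [mem_sdiff] at hx
    rw [mem_sdiff, mem_insert, mem_insert, not_or]
    exact ⟨Or.inr hx.1, fun h ↦ hgA (h ▸ hx.1), fun h ↦ hx.2 (mem_of_mem_erase h)⟩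
  have h2 := subset_of_card_erase_sdiff_le hE hr hβ (hX C hC) (hX C' hC') hne (he C hC) (hA C hC)
    ((card_le_card h1).trans (Nat.le_of_lt_succ hlt)) (hcirc C hC) (hCX C hC)
  exact hne (by rw [hinj C' hC' C hC h2])

end CircuitMoves

/-- There are few matroids with a given certificate and many core circuits. -/
theorem card_mul_two_pow_le_of_coreCircuits {n r s t β k : ℕ} (hβ : 2 * β ≤ s * (s - 1))
    (hst : β ≤ s * t) (hn : r + s + 2 * t ≤ n) (hn0 : 0 < n)
    (Z : Finset (Finset (Fin n)) × Finset (Finset (Fin n))) (𝒩 : Finset (Matroid (Fin n)))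
    (h𝒩 : ∀ N ∈ 𝒩, N.E = Set.univ ∧ N.eRank = r ∧ certificate s β N = Z ∧
      n * k ≤ (coreCircuits s β N).card * s) :
    𝒩.card * 2 ^ k ≤ n * (stableFamilies n r).card := by
  classical
  have hinj : Set.InjOn (core s β) (𝒩 : Set (Matroid (Fin n))) := fun N hN N' hN' h ↦ by
    have h1 := h𝒩 N hN
    have h2 := h𝒩 N' hN'
    exact core_ext h1.1 h2.1 h1.2.1 h2.2.1 (h1.2.2.1.trans h2.2.2.1.symm) h
  rw [← card_image_of_injOn hinj]
  refine (card_mul_two_pow_le (𝒩.image (core s β)) (stableFamilies n r) (univ : Finset (Fin n))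
    (decodeInsert Z) k fun I hI ↦ ?_).trans (by rw [card_univ, Fintype.card_fin])
  obtain ⟨N, hN, rfl⟩ := mem_image.1 hI
  obtain ⟨hE, hr, rfl, hk⟩ := h𝒩 N hN
  obtain ⟨g, J, hJ, hkJ, μ, hμ⟩ := exists_moves_of_coreCircuits hE hr hβ hst
    (by rwa [Fintype.card_fin]) (k := k) (by rwa [Fintype.card_fin]) (by rwa [Fintype.card_fin])
  refine ⟨g, mem_univ _, J, hJ, hkJ, μ, fun X hX ↦ decodeInsert_of_mem_core hX g,
    fun X hX ↦ ⟨(hμ X hX).1, (hμ X hX).2.1⟩, fun σ hσ ↦ ?_⟩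
  refine sdiff_union_image_mem_stableFamilies (J := J) (mem_stableFamilies.2
    ⟨fun X hX ↦ card_of_mem_residue hr (mem_residue_of_mem_core hX), stable_core hE hr hβ⟩)
    (fun X hX ↦ (hμ X hX).2.2.1) (fun X hX ↦ (hμ X hX).2.2.2.1) (fun X hX ↦ (hμ X hX).2.2.2.2) hσ

/-! ### Sets with many two-element intersections but no one-element intersection -/

section TwoHits

variable {α : Type*} [DecidableEq α] {𝒟 : Finset (Finset α)} {X Y Z : Finset α} {h j b : ℕ}

/-- No member of `𝒟` meets `X` in exactly one element. -/
def NoOneHit (𝒟 : Finset (Finset α)) (X : Finset α) : Prop :=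
  ∀ D ∈ 𝒟, (X ∩ D).card ≠ 1

/-- The elements of `X` that lie in a two-element intersection with a member of `𝒟`. -/
def twoHits (𝒟 : Finset (Finset α)) (X : Finset α) : Finset α :=
  (𝒟.filter fun D ↦ (X ∩ D).card = 2).biUnion fun D ↦ X ∩ D

theorem NoOneHit.mono {𝒟' : Finset (Finset α)} (hX : NoOneHit 𝒟 X) (h : 𝒟' ⊆ 𝒟) :
    NoOneHit 𝒟' X := fun D hD ↦ hX D (h hD)

theorem inter_subset_twoHits {D : Finset α} (hD : D ∈ 𝒟) (h2 : (X ∩ D).card = 2) :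
    X ∩ D ⊆ twoHits 𝒟 X :=
  subset_biUnion_of_mem (fun D ↦ X ∩ D) (mem_filter.2 ⟨hD, h2⟩)

/-- Every nonempty part of `X \ Z` can be removed from `X` so as to create a one-element
intersection. -/
def Fragile (𝒟 : Finset (Finset α)) (Z X : Finset α) : Prop :=
  ∀ S ⊆ X \ Z, S.Nonempty → ∃ D ∈ 𝒟, ((X \ S) ∩ D).card = 1

/-- Take `T` of maximum size. Every element of `B` lies in `T`, in its image, or in its preimage
outside `T`; the last part is itself self-avoiding, so each part has at most `T.card` elements. -/
theorem exists_self_avoiding (B : Finset α) (a : α → α) (ha : ∀ x ∈ B, a x ≠ x) :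
    ∃ T ⊆ B, B.card ≤ 3 * T.card ∧ ∀ x ∈ T, a x ∉ T := by
  classical
  obtain ⟨T, hT, hmax⟩ := exists_max_image (B.powerset.filter fun T ↦ ∀ x ∈ T, a x ∉ T) card
    ⟨∅, by simp⟩
  simp only [mem_filter, mem_powerset] at hT hmax
  refine ⟨T, hT.1, ?_, hT.2⟩
  have h1 : ((B.filter fun x ↦ a x ∈ T) \ T).card ≤ T.card := by
    refine hmax _ ⟨fun x hx ↦ (mem_filter.1 (mem_sdiff.1 hx).1).1, fun x hx hax ↦ ?_⟩
    exact (mem_sdiff.1 hax).2 (mem_filter.1 (mem_sdiff.1 hx).1).2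
  have h2 : B ⊆ T ∪ T.image a ∪ ((B.filter fun x ↦ a x ∈ T) \ T) := by
    intro x hx
    by_contra hcon
    simp only [mem_union, mem_sdiff, mem_filter, mem_image, not_or, not_exists, not_and,
      not_not] at hcon
    obtain ⟨⟨hxT, hxa⟩, h3⟩ := hcon
    have hax : a x ∉ T := fun h ↦ hxT (h3 ⟨hx, h⟩)
    have h4 := hmax (insert x T) ⟨insert_subset hx hT.1, fun y hy hay ↦ ?_⟩
    · rw [card_insert_of_notMem hxT] at h4
      omega
    · rw [mem_insert] at hy hay
      obtain rfl | hy := hy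
      · exact hay.elim (ha y hx) hax
      · exact hay.elim (hxa y hy) (hT.2 y hy)
  have h3 := (card_le_card h2).trans (card_union_le _ _)
  have h4 := card_union_le T (T.image a)
  have h5 : (T.image a).card ≤ T.card := card_image_le
  omega

/-- Each two-hit `x` has a partner `a x` with `X ∩ D = {x, a x}`. In a set `T` containing no partner
of its members, removing `x` always leaves the partner behind. -/
theorem exists_fragile_subset (𝒟 : Finset (Finset α)) (X : Finset α) :
    ∃ T ⊆ X, (twoHits 𝒟 X).card ≤ 3 * T.card ∧
      ∀ S ⊆ T, S.Nonempty → ∃ D ∈ 𝒟, ((X \ S) ∩ D).card = 1 := by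
  have hex : ∀ x ∈ twoHits 𝒟 X, ∃ y, y ≠ x ∧ ∃ D ∈ 𝒟, X ∩ D = {x, y} := by
    intro x hx
    simp only [twoHits, mem_biUnion, mem_filter] at hx
    obtain ⟨D, ⟨hD, h2⟩, hxD⟩ := hx
    obtain ⟨u, v, huv, h3⟩ := card_eq_two.1 h2
    rw [h3, mem_insert, mem_singleton] at hxD
    obtain rfl | rfl := hxD
    · exact ⟨v, huv.symm, D, hD, h3⟩
    · exact ⟨u, huv, D, hD, by rw [h3, pair_comm]⟩
  obtain h0 | ⟨x₀, -⟩ := (twoHits 𝒟 X).eq_empty_or_nonempty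
  · refine ⟨∅, empty_subset _, by simp [h0], fun S hS hne ↦ ?_⟩
    rw [subset_empty.1 hS] at hne
    exact absurd hne not_nonempty_empty
  have : Nonempty α := ⟨x₀⟩
  choose! a ha D hD hXD using hex
  obtain ⟨T, hT, hc, hTa⟩ := exists_self_avoiding (twoHits 𝒟 X) a ha
  refine ⟨T, fun x hx ↦ ?_, hc, fun S hS hne ↦ ?_⟩
  · have : x ∈ X ∩ D x := by rw [hXD x (hT hx)]; simp
    exact (mem_inter.1 this).1
  · obtain ⟨x, hx⟩ := hne
    refine ⟨D x, hD x (hT (hS hx)), card_eq_one.2 ⟨a x, ?_⟩⟩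
    have h0 : X \ S ∩ D x = (X ∩ D x) \ S := by
      ext y
      simp only [mem_sdiff, mem_inter]
      tauto
    rw [h0, hXD x (hT (hS hx))]
    ext y
    have h1 : a x ∉ S := fun h ↦ hTa x (hS hx) (hS h)
    simp only [mem_sdiff, mem_insert, mem_singleton]
    constructor
    · rintro ⟨rfl | rfl, h2⟩
      · exact absurd hx h2
      · rfl
    · rintro rfl
      exact ⟨Or.inr rfl, h1⟩

/-- Rebuild `X` from `Z` one element at a time: some `D` meets `Z` once, while `X` does not meet it
once, so `X \ Z` contains one of the at most `h` elements of `D`. -/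
theorem card_fragile_le (h𝒟 : ∀ D ∈ 𝒟, D.card ≤ h) (F : Finset (Finset α))
    (hF : ∀ X ∈ F, Z ⊆ X ∧ (X \ Z).card = j ∧ NoOneHit 𝒟 X ∧ Fragile 𝒟 Z X) :
    F.card ≤ h ^ j := by
  induction j generalizing Z F with
  | zero =>
    rw [pow_zero]
    refine card_le_one.2 fun X hX Y hY ↦ ?_
    have key : ∀ X ∈ F, X = Z := fun X hX ↦ by
      obtain ⟨h1, h2, -⟩ := hF X hX
      rw [card_eq_zero, sdiff_eq_empty_iff_subset] at h2
      exact h2.antisymm h1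
    rw [key X hX, key Y hY]
  | succ j ih =>
    obtain rfl | ⟨X₀, hX₀⟩ := F.eq_empty_or_nonempty
    · simp
    obtain ⟨D, hD, hZD⟩ : ∃ D ∈ 𝒟, (Z ∩ D).card = 1 := by
      obtain ⟨h1, h2, -, h3⟩ := hF X₀ hX₀
      obtain ⟨D, hD, h4⟩ := h3 (X₀ \ Z) Subset.rfl (card_pos.1 (by omega))
      rw [Finset.sdiff_sdiff_eq_self h1] at h4
      exact ⟨D, hD, h4⟩
    have hsub : F ⊆ D.biUnion fun x ↦ F.filter fun X ↦ x ∈ X \ Z := by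
      intro X hX
      obtain ⟨h1, -, h3, -⟩ := hF X hX
      have h4 : (X ∩ D).card ≠ (Z ∩ D).card := by
        rw [hZD]
        exact h3 D hD
      obtain ⟨x, hx, hxZ⟩ : ∃ x ∈ X ∩ D, x ∉ Z ∩ D := by
        by_contra! hcon
        exact h4 (congr_arg card (Subset.antisymm hcon (inter_subset_inter h1 subset_rfl)))
      rw [mem_inter] at hx hxZ
      exact mem_biUnion.2 ⟨x, hx.2, mem_filter.2 ⟨hX, mem_sdiff.2
        ⟨hx.1, fun hxZ' ↦ hxZ ⟨hxZ', hx.2⟩⟩⟩⟩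
    refine (card_le_card hsub).trans ((card_biUnion_le_card_mul _ _ (h ^ j) fun x _ ↦ ?_).trans ?_)
    · refine ih (Z := insert x Z) _ fun X hX ↦ ?_
      rw [mem_filter, mem_sdiff] at hX
      obtain ⟨h1, h2, h3, h4⟩ := hF X hX.1
      have h5 : X \ insert x Z ⊆ X \ Z := sdiff_subset_sdiff subset_rfl (subset_insert _ _)
      refine ⟨insert_subset hX.2.1 h1, ?_, h3, fun S hS hne ↦ h4 S (hS.trans h5) hne⟩
      rw [sdiff_insert, card_erase_of_mem (mem_sdiff.2 hX.2), h2]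
      rfl
    · rw [pow_succ, mul_comm]
      exact Nat.mul_le_mul_left _ (h𝒟 D hD)

/-- Few sets have no one-element but many two-element intersections with members of `𝒟`. -/
theorem card_mul_choose_le [Fintype α] (h𝒟 : ∀ D ∈ 𝒟, D.card ≤ h) (F : Finset (Finset α))
    (hF : ∀ X ∈ F, NoOneHit 𝒟 X ∧ 3 * b ≤ (twoHits 𝒟 X).card) :
    F.card * b.choose j ≤ 2 ^ Fintype.card α * h ^ j := by
  classical
  choose T hTX hTc hT using exists_fragile_subset 𝒟
  -- Double count pairs consisting of `X` with a fragile `j`-set removed, and `X`: every `X` has at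
  -- least `b.choose j` of them, every first component at most `h ^ j`.
  set P : Finset (Finset α × Finset α) :=
    F.biUnion fun X ↦ ((T X).powersetCard j).image fun S ↦ (X \ S, X) with hP
  have hPm : ∀ p ∈ P, p.2 ∈ F ∧ p.1 ⊆ p.2 ∧ (p.2 \ p.1).card = j ∧ p.2 \ p.1 ⊆ T p.2 := by
    intro p hp
    simp only [hP, mem_biUnion, mem_image, mem_powersetCard] at hp
    obtain ⟨X, hX, S, hS, rfl⟩ := hp
    have h1 : X \ (X \ S) = S := Finset.sdiff_sdiff_eq_self (hS.1.trans (hTX X))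
    exact ⟨hX, sdiff_subset, by rw [h1, hS.2], by rw [h1]; exact hS.1⟩
  have hlow : F.card * b.choose j ≤ P.card := by
    rw [hP, card_biUnion]
    · calc F.card * b.choose j = ∑ _X ∈ F, b.choose j := by simp
        _ ≤ _ := by
          refine sum_le_sum fun X hX ↦ ?_
          rw [card_image_of_injOn, card_powersetCard]
          · refine Nat.choose_le_choose _ ?_
            have h1 := hTc X
            have h2 := (hF X hX).2
            omega
          · intro S hS S' hS' heq
            have h1 : X \ S = X \ S' := (Prod.mk.inj heq).1
            rw [mem_coe, mem_powersetCard] at hS hS'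
            rw [← Finset.sdiff_sdiff_eq_self (hS.1.trans (hTX X)), h1,
              Finset.sdiff_sdiff_eq_self (hS'.1.trans (hTX X))]
    · intro X _ X' _ hne
      rw [Function.onFun, disjoint_left]
      intro p hp hp'
      obtain ⟨S, -, rfl⟩ := mem_image.1 hp
      obtain ⟨S', -, h⟩ := mem_image.1 hp'
      exact hne (Prod.mk.inj h).2.symm
  refine hlow.trans ?_
  calc P.card ≤ h ^ j * (univ : Finset (Finset α)).card := by
        refine card_le_mul_card_image_of_maps_to (f := Prod.fst) (fun p _ ↦ mem_univ _) _
          fun Z _ ↦ ?_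
        rw [← card_image_of_injOn (f := Prod.snd) (fun p hp q hq heq ↦ ?_)]
        · refine card_fragile_le h𝒟 (Z := Z) _ fun X hX ↦ ?_
          obtain ⟨p, hp, rfl⟩ := mem_image.1 hX
          obtain ⟨hpP, rfl⟩ := mem_filter.1 hp
          obtain ⟨h1, h2, h3, h4⟩ := hPm p hpP
          exact ⟨h2, h3, (hF _ h1).1, fun S hS ↦ hT p.2 S (hS.trans h4)⟩
        · rw [mem_coe, mem_filter] at hp hq
          exact Prod.ext (hp.2.trans hq.2.symm) heq
    _ = _ := by
        rw [card_univ, Fintype.card_finset, mul_comm]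

end TwoHits

/-! ### Exchanges along uniquely avoided sets -/

section Exchange

variable {α : Type*} [Fintype α] [DecidableEq α]

theorem exists_independent {V : Type*} [DecidableEq V] (T : Finset V) (R : V → V → Prop)
    [DecidableRel R] (hsymm : ∀ x y, R x y → R y x) (d : ℕ)
    (hd : ∀ x ∈ T, (T.filter fun y ↦ x ≠ y ∧ R x y).card ≤ d) :
    ∃ J ⊆ T, T.card ≤ J.card * (d + 1) ∧ ∀ x ∈ J, ∀ y ∈ J, x ≠ y → ¬ R x y := by
  classical
  obtain ⟨J, hJ, hmax⟩ := exists_max_image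
    (T.powerset.filter fun J ↦ ∀ x ∈ J, ∀ y ∈ J, x ≠ y → ¬ R x y) card ⟨∅, by simp⟩
  simp only [mem_filter, mem_powerset] at hJ hmax
  refine ⟨J, hJ.1, ?_, hJ.2⟩
  have hsub : T ⊆ J.biUnion fun x ↦ insert x (T.filter fun y ↦ x ≠ y ∧ R x y) := by
    intro y hy
    by_contra hcon
    simp only [mem_biUnion, mem_insert, mem_filter, not_exists, not_and, not_or] at hcon
    have hyJ : y ∉ J := fun h ↦ (hcon y h).1 rfl
    have hR : ∀ x ∈ J, ¬ R x y := fun x hx ↦ (hcon x hx).2 hy fun h ↦ hyJ (h ▸ hx)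
    have h1 := hmax (insert y J) ⟨insert_subset hy hJ.1, fun u hu v hv huv ↦ ?_⟩
    · rw [card_insert_of_notMem hyJ] at h1
      omega
    · rw [mem_insert] at hu hv
      obtain rfl | hu := hu <;> obtain rfl | hv := hv
      · exact absurd rfl huv
      · exact fun h ↦ hR v hv (hsymm _ _ h)
      · exact hR u hu
      · exact hJ.2 u hu v hv huv
  refine (card_le_card hsub).trans (card_biUnion_le_card_mul _ _ _ fun x hx ↦ ?_)
  exact (card_insert_le _ _).trans (Nat.add_le_add_right (hd x (hJ.1 hx)) 1)

variable {𝒟 I : Finset (Finset α)} {X X' : Finset α} {r δ : ℕ}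

/-- Exactly one member of `𝒟` is disjoint from `X`, and none meets `X` in exactly one element. -/
def UniquelyAvoided (𝒟 : Finset (Finset α)) (X : Finset α) : Prop :=
  (∃ D ∈ 𝒟, Disjoint X D ∧ ∀ D' ∈ 𝒟, Disjoint X D' → D' = D) ∧ NoOneHit 𝒟 X

/-- Decoding of an exchange that removed `f` from a set and inserted the element `d D` of the
member `D` of `𝒟` that is disjoint from that set. -/
noncomputable def decodeRemove (𝒟 : Finset (Finset α)) (d : Finset α → α) (f : α)
    (Y : Finset α) : Finset α := by
  classical
  exact if ∃ D ∈ 𝒟, Disjoint Y D then Y else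
    if h : ∃ D ∈ 𝒟, Y ∩ D = {d D} then insert f (Y.erase (d h.choose)) else Y

theorem decodeRemove_of_uniquelyAvoided (hX : UniquelyAvoided 𝒟 X) (d : Finset α → α) (f : α) :
    decodeRemove 𝒟 d f X = X := by
  obtain ⟨⟨D, hD, hXD, -⟩, -⟩ := hX
  rw [decodeRemove, if_pos ⟨D, hD, hXD⟩]

theorem card_inter_eq_two {D : Finset α} {u v : α} (h0 : ¬ Disjoint X D) (h1 : (X ∩ D).card ≠ 1)
    (h2 : X ∩ D ⊆ {u, v}) : (X ∩ D).card = 2 := by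
  have h3 : (X ∩ D).card ≠ 0 := by
    rwa [Ne, card_eq_zero, ← disjoint_iff_inter_eq_empty]
  have := (card_le_card h2).trans card_le_two
  omega

/-- If the decoder picks another `D'` with a different marked element, then `X ∩ D'` consists of
that element and `f`, making `f` a two-hit. The same reasoning without one-element intersections
shows that the modified set avoids no member of `𝒟`, so it is recognised as modified. -/
theorem decodeRemove_insert_erase (hX : UniquelyAvoided 𝒟 X) {d : Finset α → α} {D : Finset α}
    (hd : d D ∈ D) (hD : D ∈ 𝒟) (hXD : Disjoint X D) {f : α} (hfX : f ∈ X)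
    (hf : f ∉ twoHits 𝒟 X) : decodeRemove 𝒟 d f (insert (d D) (X.erase f)) = X := by
  obtain ⟨⟨D₀, hD₀, hXD₀, huniq⟩, hone⟩ := hX
  obtain rfl := huniq D hD hXD
  have hdX : d D ∉ X := disjoint_right.1 hXD hd
  have hfD : f ∉ D := disjoint_left.1 hXD hfX
  rw [decodeRemove, if_neg]
  · have hex : ∃ D' ∈ 𝒟, insert (d D) (X.erase f) ∩ D' = {d D'} := by
      refine ⟨D, hD, ?_⟩
      ext x
      simp only [mem_inter, mem_insert, mem_erase, mem_singleton]
      constructor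
      · rintro ⟨h | h, hxD⟩
        · exact h
        · exact absurd hxD (disjoint_left.1 hXD h.2)
      · rintro rfl
        exact ⟨Or.inl rfl, hd⟩
    rw [dif_pos hex]
    obtain ⟨hD', hYD'⟩ := hex.choose_spec
    set D' := hex.choose
    suffices d D' = d D by
      rw [this, erase_insert fun h ↦ hdX (mem_of_mem_erase h), insert_erase hfX]
    by_contra hne
    have h1 : d D' ∈ insert (d D) (X.erase f) ∩ D' := hYD' ▸ mem_singleton_self _
    have h2 : d D' ∈ X := by
      rw [mem_inter, mem_insert, mem_erase] at h1
      tauto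
    have h3 : X ∩ D' ⊆ {d D', f} := by
      intro x hx
      rw [mem_inter] at hx
      rw [mem_insert, mem_singleton]
      by_contra! hcon
      have : x ∈ insert (d D) (X.erase f) ∩ D' := by simp [hx, hcon]
      rw [hYD', mem_singleton] at this
      exact hcon.1 this
    have h4 : ¬ Disjoint X D' := fun h ↦ disjoint_left.1 h h2 (mem_inter.1 h1).2
    have h5 := card_inter_eq_two h4 (hone D' hD') h3
    have h6 : X ∩ D' = {d D', f} := eq_of_subset_of_card_le h3 (by rw [h5]; exact card_le_two)
    exact hf (inter_subset_twoHits hD' h5 (by rw [h6]; simp))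
  · rintro ⟨D', hD', hYD'⟩
    have h1 : X ∩ D' ⊆ {f} := by
      intro x hx
      rw [mem_inter] at hx
      by_contra hcon
      rw [mem_singleton] at hcon
      exact disjoint_left.1 hYD' (mem_insert_of_mem (mem_erase.2 ⟨hcon, hx.1⟩)) hx.2
    have h2 := card_le_card h1
    have h3 := hone D' hD'
    rw [card_singleton] at h2
    have h4 : X ∩ D' = ∅ := card_eq_zero.1 (by omega)
    rw [← disjoint_iff_inter_eq_empty] at h4
    obtain rfl := huniq D' hD' h4
    exact disjoint_left.1 hYD' (mem_insert_self _ _) hd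

/-- Were the moved set too close to `X'`, then `X'` would contain `e` but not `f`. The set `D'`
avoided by `X'` would differ from `D` and meet `X` in exactly the two elements of `X \ X'`, one of
them `f`. -/
theorem two_le_card_exchange_sdiff (hX : UniquelyAvoided 𝒟 X) (hX' : UniquelyAvoided 𝒟 X')
    (h2 : 2 ≤ (X \ X').card) {D : Finset α} {e : α} (he : e ∈ D)
    (hD : D ∈ 𝒟) (hXD : Disjoint X D) {f : α} (hfX : f ∈ X) (hf : f ∉ twoHits 𝒟 X) :
    2 ≤ (insert e (X.erase f) \ X').card := by
  by_contra! hlt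
  have heX : e ∉ X := disjoint_right.1 hXD he
  have hA : (X \ X') ⊆ insert f (insert e (X.erase f) \ X') := by
    intro x hx
    simp only [mem_insert, mem_sdiff, mem_erase] at hx ⊢
    tauto
  have h3 := (card_le_card hA).trans (card_insert_le _ _)
  have heX' : e ∈ X' := by
    by_contra heX'
    have h4 : insert e (X.erase f \ X') ⊆ insert e (X.erase f) \ X' := by
      rw [insert_sdiff_of_notMem _ heX']
    have h5 := card_le_card h4
    rw [card_insert_of_notMem fun h ↦ heX (mem_of_mem_erase (mem_sdiff.1 h).1)] at h5
    have h6 : X \ X' ⊆ insert f (X.erase f \ X') := by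
      intro x hx
      simp only [mem_insert, mem_sdiff, mem_erase] at hx ⊢
      tauto
    have h7 := (card_le_card h6).trans (card_insert_le _ _)
    omega
  have hfX' : f ∉ X' := by
    intro hfX'
    have h4 : X \ X' ⊆ insert e (X.erase f) \ X' := by
      intro x hx
      simp only [mem_insert, mem_sdiff, mem_erase] at hx ⊢
      exact ⟨Or.inr ⟨fun h ↦ hx.2 (h ▸ hfX'), hx.1⟩, hx.2⟩
    have := card_le_card h4
    omega
  obtain ⟨⟨D', hD', hXD', -⟩, hone'⟩ := hX'
  obtain ⟨⟨D₀, hD₀, hXD₀, huniq⟩, hone⟩ := hX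
  have hDD' : D' ≠ D := by
    rintro rfl
    exact disjoint_left.1 hXD' heX' he
  have h4 : ¬ Disjoint X D' := fun h ↦ hDD' ((huniq D' hD' h).trans (huniq D hD hXD).symm)
  have h5 : X ∩ D' ⊆ X \ X' := fun x hx ↦ by
    rw [mem_inter] at hx
    exact mem_sdiff.2 ⟨hx.1, fun h ↦ disjoint_left.1 hXD' h hx.2⟩
  have h6 : (X ∩ D').card = 2 := by
    have h7 : (X ∩ D').card ≠ 0 := by
      rwa [Ne, card_eq_zero, ← disjoint_iff_inter_eq_empty]
    have := hone D' hD'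
    have := card_le_card h5
    omega
  have h7 : X ∩ D' = X \ X' := eq_of_subset_of_card_le h5 (by omega)
  exact hf (inter_subset_twoHits hD' h6 (by rw [h7]; exact mem_sdiff.2 ⟨hfX, hfX'⟩))

/-- Used in both directions: if two moved sets conflict, each of the differences `X \ X'` and `X' \
X` is a two-element intersection with the set avoided by the other side. This leaves few candidates
for `X'`. -/
theorem sdiff_eq_inter_of_conflict (hX' : UniquelyAvoided 𝒟 X')
    (hcard : X.card = X'.card) (h2 : 2 ≤ (X \ X').card) {D D' : Finset α} {e e' : α} (he : e ∈ D)
    (he' : e' ∈ D') (hD : D ∈ 𝒟) (hXD : Disjoint X D) 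
    (hXD' : Disjoint X' D') {f : α} (hfX' : f ∈ X')
    (hlt : (insert e (X.erase f) \ insert e' (X'.erase f)).card < 2) :
    X' \ X = X' ∩ D ∧ (X' ∩ D).card = 2 := by
  have heX : e ∉ X := disjoint_right.1 hXD he
  have heX' : e' ∉ X' := disjoint_right.1 hXD' he'
  have h4 : X \ X' ⊆ insert e' (insert e (X.erase f) \ insert e' (X'.erase f)) := by
    intro x hx
    simp only [mem_insert, mem_sdiff, mem_erase, not_or, not_and] at hx ⊢
    by_cases h : x = e'
    · exact Or.inl h
    · exact Or.inr ⟨Or.inr ⟨fun h ↦ hx.2 (h ▸ hfX'), hx.1⟩, h, fun _ ↦ hx.2⟩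
  have h5 := (card_le_card h4).trans (card_insert_le _ _)
  have heX'' : e ∈ X' := by
    by_contra hcon
    by_cases hee : e = e'
    · subst hee
      have h6 : X \ X' ⊆ insert e (X.erase f) \ insert e (X'.erase f) := by
        intro x hx
        simp only [mem_insert, mem_sdiff, mem_erase, not_or, not_and] at hx ⊢
        exact ⟨Or.inr ⟨fun h ↦ hx.2 (h ▸ hfX'), hx.1⟩, fun h ↦ heX (h ▸ hx.1), fun _ ↦ hx.2⟩
      have := card_le_card h6
      omega
    · have h6 : insert e ((X \ X').erase e') ⊆
          insert e (X.erase f) \ insert e' (X'.erase f) := by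
        intro x hx
        simp only [mem_insert, mem_sdiff, mem_erase, not_or, not_and] at hx ⊢
        obtain rfl | hx := hx
        · exact ⟨Or.inl rfl, hee, fun _ ↦ hcon⟩
        · exact ⟨Or.inr ⟨fun h ↦ hx.2.2 (h ▸ hfX'), hx.2.1⟩, hx.1, fun _ ↦ hx.2.2⟩
      have h7 := card_le_card h6
      rw [card_insert_of_notMem (fun h ↦ heX (mem_sdiff.1 (mem_of_mem_erase h)).1)] at h7
      have := pred_card_le_card_erase (s := X \ X') (a := e')
      omega
  have h6 : X' ∩ D ⊆ X' \ X := fun x hx ↦ by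
    rw [mem_inter] at hx
    exact mem_sdiff.2 ⟨hx.1, fun h ↦ disjoint_left.1 hXD h hx.2⟩
  have h7 := card_le_card h6
  rw [← card_sdiff_eq_of_card_eq hcard] at h7
  have h8 := hX'.2 D hD
  have h9 : 0 < (X' ∩ D).card := card_pos.2 ⟨e, mem_inter.2 ⟨heX'', he⟩⟩
  refine ⟨(eq_of_subset_of_card_le h6 ?_).symm, by omega⟩
  rw [← card_sdiff_eq_of_card_eq hcard]
  omega

/-- A stable family all of whose members avoid exactly one member of `𝒟` can be modified
independently in many places. -/
theorem exists_moves_of_uniquelyAvoided {s b b' k : ℕ} (hI : Stable I) (hIr : ∀ X ∈ I, X.card = r)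
    (hId : ∀ X ∈ I, UniquelyAvoided 𝒟 X) {d : Finset α → α} (hd : ∀ D ∈ 𝒟, d D ∈ D)
    (hs : b' + s ≤ r) {T : Finset (Finset α)} (hTI : T ⊆ I)
    (hT : ∀ X ∈ T, (∃ D ∈ 𝒟, Disjoint X D ∧ D.card ≤ δ) ∧
      (twoHits (𝒟.filter fun D ↦ D.card ≤ δ) X).card ≤ b ∧ (twoHits 𝒟 X).card ≤ b')
    (hk : Fintype.card α * (k * (b ^ 2 * δ ^ 2 + 1)) ≤ T.card * s) (hα : 0 < Fintype.card α) :
    ∃ f : α, ∃ J ⊆ I, k ≤ J.card ∧ ∃ μ : Finset α → Finset α,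
      ∀ X ∈ J, decodeRemove 𝒟 d f (μ X) = X ∧ μ X ≠ X ∧ (μ X).card = r ∧
        (∀ X' ∈ I, X ≠ X' → 2 ≤ (μ X \ X').card) ∧
        (∀ X' ∈ J, X ≠ X' → 2 ≤ (μ X \ μ X').card) := by
  classical
  obtain ⟨f, hf⟩ := card_pigeonhole T (fun X ↦ X \ twoHits 𝒟 X) (s := s) (fun X hX ↦ by
    have h1 := le_card_sdiff (twoHits 𝒟 X) X
    have h2 := (hT X hX).2.2
    have h3 := hIr X (hTI hX)
    omega) hk hα
  set U := T.filter fun X ↦ f ∈ X \ twoHits 𝒟 X with hU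
  have hUm : ∀ X ∈ U, X ∈ T ∧ f ∈ X ∧ f ∉ twoHits 𝒟 X := fun X hX ↦ by
    rw [hU, mem_filter, mem_sdiff] at hX
    exact hX
  have hex : ∀ X ∈ U, ∃ D ∈ 𝒟, Disjoint X D ∧ D.card ≤ δ := fun X hX ↦ (hT X (hUm X hX).1).1
  choose! D hD hXD hDδ using hex
  set μ : Finset α → Finset α := fun X ↦ insert (d (D X)) (X.erase f) with hμ
  have hdX : ∀ X ∈ U, d (D X) ∉ X := fun X hX ↦ disjoint_right.1 (hXD X hX) (hd _ (hD X hX))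
  have hμr : ∀ X ∈ U, (μ X).card = r := fun X hX ↦ by
    have hfX := (hUm X hX).2.1
    have : 0 < X.card := card_pos.2 ⟨f, hfX⟩
    rw [hμ, card_insert_of_notMem fun h ↦ hdX X hX (mem_of_mem_erase h), card_erase_of_mem hfX,
      ← hIr X (hTI (hUm X hX).1)]
    omega
  -- A conflicting `X'` is determined by `X \ X'`, a pair of two-hits of `X`, and by `X' \ X`, a
  -- pair in the small set `D X`.
  have hdeg : ∀ X ∈ U, (U.filter fun X' ↦ X ≠ X' ∧ ((μ X).card = (μ X').card ∧
      (μ X \ μ X').card < 2)).card ≤ b ^ 2 * δ ^ 2 := by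
    intro X hX
    obtain ⟨hXT, hfX, -⟩ := hUm X hX
    have hmaps : ∀ X' ∈ U.filter fun X' ↦ X ≠ X' ∧ ((μ X).card = (μ X').card ∧
        (μ X \ μ X').card < 2), (X \ X', X' \ X) ∈
        (twoHits (𝒟.filter fun D ↦ D.card ≤ δ) X).powersetCard 2 ×ˢ (D X).powersetCard 2 := by
      intro X' hX'
      obtain ⟨hX', hne, h1, h2⟩ := mem_filter.1 hX'
      obtain ⟨hXT', hfX', -⟩ := hUm X' hX'
      have hc : X.card = X'.card := (hIr X (hTI hXT)).trans (hIr X' (hTI hXT')).symm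
      have h3 := hI X (hTI hXT) X' (hTI hXT') hne
      have h4 := sdiff_eq_inter_of_conflict (hId X' (hTI hXT')) hc h3 (hd _ (hD X hX))
        (hd _ (hD X' hX')) (hD X hX) (hXD X hX) (hXD X' hX') hfX' h2
      have h5 := sdiff_eq_inter_of_conflict (hId X (hTI hXT)) hc.symm
        (card_sdiff_eq_of_card_eq hc ▸ h3) (hd _ (hD X' hX'))
        (hd _ (hD X hX)) (hD X' hX') (hXD X' hX') (hXD X hX) hfX
        (card_sdiff_eq_of_card_eq h1 ▸ h2)
      rw [mem_product, mem_powersetCard, mem_powersetCard, h4.1, h5.1]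
      exact ⟨⟨inter_subset_twoHits (mem_filter.2 ⟨hD X' hX', hDδ X' hX'⟩) h5.2, h5.2⟩,
        inter_subset_right, h4.2⟩
    refine (card_le_card_of_injOn _ hmaps fun X₁ h₁ X₂ h₂ heq ↦ ?_).trans ?_
    · have h1 := (Prod.mk.inj heq).1
      have h2 := (Prod.mk.inj heq).2
      have key : ∀ Y : Finset α, Y = (X \ (X \ Y)) ∪ (Y \ X) := fun Y ↦ by
        ext x
        simp only [mem_union, mem_sdiff]
        tauto
      rw [key X₁, key X₂, h1, h2]
    · rw [card_product, card_powersetCard, card_powersetCard]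
      exact Nat.mul_le_mul
        ((Nat.choose_le_pow _ _).trans (Nat.pow_le_pow_left (hT X hXT).2.1 2))
        ((Nat.choose_le_pow _ _).trans (Nat.pow_le_pow_left (hDδ X hX) 2))
  obtain ⟨J, hJU, hJc, hJ⟩ := exists_independent U (fun X X' ↦ (μ X).card = (μ X').card ∧
    (μ X \ μ X').card < 2) (fun X X' h ↦ ⟨h.1.symm, card_sdiff_eq_of_card_eq h.1 ▸ h.2⟩) _ hdeg
  refine ⟨f, J, fun X hX ↦ hTI (hUm X (hJU hX)).1, ?_, μ, fun X hX ↦ ?_⟩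
  · exact Nat.le_of_mul_le_mul_right (hf.trans hJc) (Nat.succ_pos _)
  have hXU := hJU hX
  obtain ⟨hXT, hfX, hf2⟩ := hUm X hXU
  refine ⟨decodeRemove_insert_erase (hId X (hTI hXT)) (hd _ (hD X hXU)) (hD X hXU) (hXD X hXU)
    hfX hf2, fun h ↦ hdX X hXU ((congr_arg (d (D X) ∈ ·) h).mp (mem_insert_self _ _)), hμr X hXU, fun X' hX' hne ↦ ?_,
    fun X' hX' hne ↦ ?_⟩
  · exact two_le_card_exchange_sdiff (hId X (hTI hXT)) (hId X' hX')
      (hI X (hTI hXT) X' hX' hne) (hd _ (hD X hXU)) (hD X hXU) (hXD X hXU) hfX hf2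
  · by_contra! hlt
    exact hJ X hX X' hX' hne ⟨(hμr X hXU).trans (hμr X' (hJU hX')).symm, hlt⟩

end Exchange

/-- There are few stable families many of whose members avoid a small member of `𝒟`, and all of
whose members avoid exactly one member of `𝒟`. -/
theorem card_mul_two_pow_le_of_uniquelyAvoided {n r s δ Δ b b' j w m k : ℕ}
    {𝒟 : Finset (Finset (Fin n))} (h𝒟 : ∀ D ∈ 𝒟, D.Nonempty ∧ D.card ≤ Δ)
    (𝓘 : Finset (Finset (Finset (Fin n)))) (h𝓘 : 𝓘 ⊆ stableFamilies n r)
    (hId : ∀ I ∈ 𝓘, ∀ X ∈ I, UniquelyAvoided 𝒟 X)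
    (hm : ∀ I ∈ 𝓘, ∃ T ⊆ I, m ≤ T.card ∧ ∀ X ∈ T, ∃ D ∈ 𝒟, Disjoint X D ∧ D.card ≤ δ)
    (hs : 3 * b' + s ≤ r) (hb : 2 ^ n * δ ^ j ≤ w * b.choose j) (hbj : j ≤ b)
    (hb' : 2 ^ n * Δ ^ j ≤ w * b'.choose j) (hbj' : j ≤ b')
    (hk : n * (k * ((3 * b) ^ 2 * δ ^ 2 + 1)) ≤ (m - 2 * w) * s) (hn : 0 < n) :
    𝓘.card * 2 ^ k ≤ n * (stableFamilies n r).card := by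
  classical
  have : NeZero n := ⟨hn.ne'⟩
  set d : Finset (Fin n) → Fin n := fun D ↦ if h : D.Nonempty then h.choose else 0
  have hd : ∀ D ∈ 𝒟, d D ∈ D := fun D hD ↦ by
    simp only [d, (h𝒟 D hD).1, dite_true]
    exact (h𝒟 D hD).1.choose_spec
  refine (card_mul_two_pow_le 𝓘 (stableFamilies n r) (univ : Finset (Fin n))
    (decodeRemove 𝒟 d) k fun I hI ↦ ?_).trans (by rw [card_univ, Fintype.card_fin])
  obtain ⟨T, hTI, hTm, hT⟩ := hm I hI
  have hIs := mem_stableFamilies.1 (h𝓘 hI)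
  -- Discard the members with too many two-hits: those against the small sets control the conflicts,
  -- those against all of `𝒟` the choice of `f`.
  set T₁ := T.filter fun X ↦ 3 * b ≤ (twoHits (𝒟.filter fun D ↦ D.card ≤ δ) X).card
  set T₂ := T.filter fun X ↦ 3 * b' ≤ (twoHits 𝒟 X).card
  have h1 : T₁.card ≤ w := by
    have := card_mul_choose_le (b := b) (j := j) (𝒟 := 𝒟.filter fun D ↦ D.card ≤ δ) (h := δ)
      (fun D hD ↦ (mem_filter.1 hD).2) T₁ (fun X hX ↦
        ⟨(hId I hI X (hTI (mem_filter.1 hX).1)).2.mono (filter_subset _ _), (mem_filter.1 hX).2⟩)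
    rw [Fintype.card_fin] at this
    exact Nat.le_of_mul_le_mul_right (this.trans hb) (Nat.choose_pos hbj)
  have h2 : T₂.card ≤ w := by
    have := card_mul_choose_le (b := b') (j := j) (h := Δ) (fun D hD ↦ (h𝒟 D hD).2) T₂
      (fun X hX ↦ ⟨(hId I hI X (hTI (mem_filter.1 hX).1)).2, (mem_filter.1 hX).2⟩)
    rw [Fintype.card_fin] at this
    exact Nat.le_of_mul_le_mul_right (this.trans hb') (Nat.choose_pos hbj')
  have h3 : m - 2 * w ≤ (T \ (T₁ ∪ T₂)).card := by
    have h4 := le_card_sdiff (T₁ ∪ T₂) T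
    have h5 := card_union_le T₁ T₂
    omega
  obtain ⟨f, J, hJ, hkJ, μ, hμ⟩ := exists_moves_of_uniquelyAvoided (T := T \ (T₁ ∪ T₂)) (δ := δ)
    (s := s) (b := 3 * b) (b' := 3 * b') (k := k) hIs.2 hIs.1 (hId I hI) hd hs
    (sdiff_subset.trans hTI) (fun X hX ↦ by
      rw [mem_sdiff, mem_union, not_or] at hX
      refine ⟨hT X hX.1, ?_, ?_⟩
      · by_contra! hlt
        exact hX.2.1 (mem_filter.2 ⟨hX.1, hlt.le⟩)
      · by_contra! hlt
        exact hX.2.2 (mem_filter.2 ⟨hX.1, hlt.le⟩))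
    (by rw [Fintype.card_fin]; exact hk.trans (Nat.mul_le_mul_right _ h3))
    (by rwa [Fintype.card_fin])
  refine ⟨f, mem_univ _, J, hJ, hkJ, μ, fun X hX ↦ decodeRemove_of_uniquelyAvoided (hId I hI X hX)
    d f, fun X hX ↦ ⟨(hμ X hX).1, (hμ X hX).2.1⟩, fun σ hσ ↦ ?_⟩
  exact sdiff_union_image_mem_stableFamilies (J := J) (h𝓘 hI) (fun X hX ↦ (hμ X hX).2.2.1)
    (fun X hX ↦ (hμ X hX).2.2.2.1) (fun X hX ↦ (hμ X hX).2.2.2.2) hσ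

/-! ### Cocircuits of the matroid that is truncated -/

section Truncation

variable {n r s β Δ : ℕ} {M N : Matroid (Fin n)} {X K : Finset (Fin n)}

/-- `N` is the truncation of a matroid `M` of rank one more than that of `N`. -/
def IsProperTruncation (M N : Matroid (Fin n)) (r : ℕ) : Prop :=
  M.E = Set.univ ∧ M.eRank = (r + 1 : ℕ) ∧ ∀ X : Finset (Fin n), N.Indep X ↔ M.Indep X ∧ X.card ≤ r

theorem exists_isProperTruncation (hE : N.E = Set.univ) (hr : N.eRank = r)
    (hN : IsTruncationOfAnother N) : ∃ M, IsProperTruncation M N r := by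
  obtain ⟨M, hne, rfl⟩ := hN
  obtain ⟨ρ, hρ⟩ : ∃ ρ : ℕ, M.eRank = ρ := by
    obtain ⟨B, hB⟩ := M.exists_isBase
    lift B to Finset (Fin n) using Set.toFinite _
    exact ⟨B.card, by rw [← hB.encard_eq_eRank, Set.encard_coe_eq_coe_finsetCard]⟩
  have hind : ∀ X : Finset (Fin n), (truncation M).Indep X ↔ M.Indep X ∧ X.card ≤ ρ - 1 := by
    intro X
    rw [truncation_indep_iff, hρ, Set.encard_coe_eq_coe_finsetCard]
    refine and_congr_right fun _ ↦ ?_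
    exact_mod_cast Iff.rfl
  obtain _ | ρ := ρ
  · refine absurd (show M = truncation M from Matroid.ext_indep rfl fun I _ ↦ ?_) hne
    lift I to Finset (Fin n) using Set.toFinite _
    rw [hind]
    exact ⟨fun h ↦ ⟨h, indep_card_le hρ h⟩, fun h ↦ h.1⟩
  · obtain rfl : ρ = r := by
      obtain ⟨B, hB⟩ := M.exists_isBase
      lift B to Finset (Fin n) using Set.toFinite _
      have hBc : B.card = ρ + 1 := by
        have h := hB.encard_eq_eRank
        rw [hρ, Set.encard_coe_eq_coe_finsetCard] at h
        exact_mod_cast h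
      obtain ⟨B', hB', hc⟩ := exists_subset_card_eq (show ρ ≤ B.card by omega)
      have h1 := indep_card_le hr ((hind B').2 ⟨hB.indep.subset (by exact_mod_cast hB'), by omega⟩)
      obtain ⟨B₂, hB₂⟩ := (truncation M).exists_isBase
      lift B₂ to Finset (Fin n) using Set.toFinite _
      have h2 := hB₂.encard_eq_eRank
      rw [hr, Set.encard_coe_eq_coe_finsetCard] at h2
      have h3 : B₂.card = r := by exact_mod_cast h2
      have h4 := ((hind B₂).1 hB₂.indep).2
      omega
    exact ⟨M, hE, hρ, hind⟩

theorem IsProperTruncation.isCircuit (h : IsProperTruncation M N r) (hX : N.IsCircuit X)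
    (hXr : X.card = r) : M.IsCircuit X := by
  rw [Matroid.isCircuit_iff_forall_ssubset, Matroid.dep_iff]
  refine ⟨⟨fun hi ↦ hX.not_indep ((h.2.2 X).2 ⟨hi, hXr.le⟩), h.1 ▸ Set.subset_univ _⟩,
    fun I hI ↦ ?_⟩
  lift I to Finset (Fin n) using Set.toFinite _
  exact ((h.2.2 I).1 (hX.ssubset_indep hI)).1

/-- The cocircuits of `M` with at most `Δ` elements. -/
noncomputable def smallCocircuits (M : Matroid (Fin n)) (Δ : ℕ) : Finset (Finset (Fin n)) := by
  classical
  exact univ.filter fun D ↦ M.IsCocircuit D ∧ D.card ≤ Δ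

theorem mem_smallCocircuits : X ∈ smallCocircuits M Δ ↔ M.IsCocircuit X ∧ X.card ≤ Δ := by
  simp [smallCocircuits]

/-- Adding any `y` in a cocircuit of `N` avoiding `X` gives a set spanning `N`; a base of `N` inside
it is an independent `r`-set of `M`. -/
theorem exists_indep_insert_of_mem_circuitCore (h : IsProperTruncation M N r)
    (hE : N.E = Set.univ) (hr : N.eRank = r) (hβ : 2 * β ≤ s * (s - 1))
    (hX : X ∈ circuitCore s β N) : ∃ K : Finset (Fin n), Disjoint X K ∧ s < K.card ∧
      ∀ y ∈ K, ∃ B ⊆ insert y X, M.Indep B ∧ B.card = r := by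
  have hXR := mem_residue_of_mem_core (mem_circuitCore.1 hX).1
  have hXr := card_of_mem_residue hr hXR
  obtain ⟨K, hXK, hK⟩ := exists_cocircuit_disjoint hE (by
    rw [spanning_iff_indep_of_card hr hXr]
    exact (mem_residue.1 hXR).2.1)
  refine ⟨K, hXK, lt_card_of_isCocircuit_disjoint hXR hK hXK, fun y hy ↦ ?_⟩
  obtain ⟨B, hB, hBi, hBr⟩ := exists_base_subset_of_spanning hr
    (spanning_insert_of_mem_residue hE hr hβ hXR hK hXK hy)
  exact ⟨B, hB, ((h.2.2 B).1 hBi).1, hBr⟩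

/-- If `X` avoided two small cocircuits, some `y` in `K` would lie outside both, as `s ≥ 2 * Δ`. An
independent `r`-set in `insert y X`, extended by an element of one cocircuit outside the other, is a
base of `M` avoiding a cocircuit. One-element intersections are excluded by circuit-cocircuit
orthogonality. -/
theorem uniquelyAvoided_smallCocircuits (h : IsProperTruncation M N r) (hE : N.E = Set.univ)
    (hr : N.eRank = r) (hβ : 2 * β ≤ s * (s - 1)) (hΔ : 2 * Δ ≤ s) (hX : X ∈ circuitCore s β N)
    {D : Finset (Fin n)} (hD : D ∈ smallCocircuits M Δ) (hXD : Disjoint X D) :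
    UniquelyAvoided (smallCocircuits M Δ) X := by
  classical
  obtain ⟨hXc, hXC⟩ := mem_circuitCore.1 hX
  have hXr := card_of_mem_residue hr (mem_residue_of_mem_core hXc)
  obtain ⟨K, hXK, hK, hKB⟩ := exists_indep_insert_of_mem_circuitCore h hE hr hβ hX
  refine ⟨⟨D, hD, hXD, fun D' hD' hXD' ↦ ?_⟩, fun D' hD' h1 ↦ ?_⟩
  · rw [mem_smallCocircuits] at hD hD'
    by_contra hne
    obtain ⟨y, hy⟩ : (K \ (D ∪ D')).Nonempty := by
      rw [← card_pos]
      have h1 := le_card_sdiff (D ∪ D') K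
      have h2 := card_union_le D D'
      omega
    rw [mem_sdiff, mem_union, not_or] at hy
    obtain ⟨z, hz, hz'⟩ : ∃ z ∈ D, z ∉ D' := by
      by_contra! hcon
      have h1 : D = D' := by
        exact_mod_cast hD.1.isCircuit.eq_of_subset_isCircuit hD'.1.isCircuit
          (by exact_mod_cast (show D ⊆ D' from hcon))
      exact hne h1.symm
    obtain ⟨B, hBX, hB, hBr⟩ := hKB y hy.1
    have hBD : Disjoint B D := disjoint_of_subset_left hBX (disjoint_insert_left.2 ⟨hy.2.1, hXD⟩)
    have hBD' : Disjoint B D' :=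
      disjoint_of_subset_left hBX (disjoint_insert_left.2 ⟨hy.2.2, hXD'⟩)
    have hi := indep_insert_of_mem_cocircuit h.1 hB hD.1 hBD hz
    refine not_spanning_of_disjoint h.1 hD'.1 (X := insert z B)
      (disjoint_insert_left.2 ⟨hz', hBD'⟩) ?_
    rw [spanning_iff_indep_of_card h.2.1]
    · exact hi
    · rw [card_insert_of_notMem (disjoint_right.1 hBD hz), hBr]
  · obtain ⟨e, he⟩ := card_eq_one.1 h1
    refine (h.isCircuit hXC hXr).inter_isCocircuit_ne_singleton (mem_smallCocircuits.1 hD').1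
      (e := e) ?_
    exact_mod_cast he

/-- For each of the more than `s` elements `y` of `K`, the set `insert y X` avoids a cocircuit of
`M` with more than `2 * d` elements `z`. Each `X` with `y` and `z` added spans `M` with nullity one
and arises from at most two ordered pairs. So `X` is a heavy circuit of `M`, and those are few. -/
theorem card_not_avoiding_mul_le (h : IsProperTruncation M N r) (hE : N.E = Set.univ)
    (hr : N.eRank = r) (hβ : 2 * β ≤ s * (s - 1)) {d : ℕ} (hd : 2 * d ≤ Δ)
    (F : Finset (Finset (Fin n))) (hF : ∀ X ∈ F, X ∈ circuitCore s β N ∧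
      ¬ ∃ D ∈ smallCocircuits M Δ, Disjoint X D ∧ D.card ≤ 2 * d) :
    F.card * (s * d) ≤ n.choose (r + 2) := by
  classical
  have hsub : F ⊆ (heavyCircuits 0 (s * d) M).filter fun C ↦ 0 < C.card := by
    intro X hX
    obtain ⟨hX, hno⟩ := hF X hX
    obtain ⟨hXc, hXC⟩ := mem_circuitCore.1 hX
    have hXr := card_of_mem_residue hr (mem_residue_of_mem_core hXc)
    have hXM := h.isCircuit hXC hXr
    obtain ⟨K, hXK, hK, hKB⟩ := exists_indep_insert_of_mem_circuitCore h hE hr hβ hX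
    refine mem_filter.2 ⟨mem_heavyCircuits.2 ⟨hXM, Or.inr ?_⟩, card_pos.2 ?_⟩
    swap
    · exact_mod_cast hXM.nonempty
    have hD : ∀ y ∈ K, ∃ D : Finset (Fin n), M.IsCocircuit D ∧ Disjoint (insert y X) D ∧
        2 * d < D.card := by
      intro y hy
      have hyX : y ∉ X := disjoint_right.1 hXK hy
      obtain ⟨D, hD, hDc⟩ := exists_cocircuit_disjoint (X := insert y X) h.1 (by
        rw [spanning_iff_indep_of_card h.2.1 (by rw [card_insert_of_notMem hyX, hXr])]
        exact fun hi ↦ hXM.not_indep (hi.subset (by exact_mod_cast subset_insert y X)))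
      refine ⟨D, hDc, hD, ?_⟩
      by_contra! hle
      exact hno ⟨D, mem_smallCocircuits.2 ⟨hDc, hle.trans hd⟩,
        disjoint_of_subset_left (subset_insert _ _) hD, hle⟩
    choose! D hDc hyD hDd using hD
    set P : Finset (Fin n × Fin n) := K.biUnion fun y ↦ (D y).image fun z ↦ (y, z) with hP
    have hPm : ∀ p ∈ P, p.1 ∈ K ∧ p.2 ∈ D p.1 := by
      intro p hp
      simp only [hP, mem_biUnion, mem_image] at hp
      obtain ⟨y, hy, z, hz, rfl⟩ := hp
      exact ⟨hy, hz⟩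
    have hPX : ∀ p ∈ P, p.1 ∉ X ∧ p.2 ∉ X ∧ p.2 ≠ p.1 := by
      intro p hp
      obtain ⟨h1, h2⟩ := hPm p hp
      have h3 := disjoint_right.1 (hyD _ h1) h2
      rw [mem_insert, not_or] at h3
      exact ⟨disjoint_right.1 hXK h1, h3.2, h3.1⟩
    have hPc : s * (2 * d) ≤ P.card := by
      rw [hP, card_biUnion]
      · calc s * (2 * d) ≤ K.card * (2 * d) := Nat.mul_le_mul_right _ hK.le
          _ = ∑ _y ∈ K, 2 * d := by rw [sum_const, smul_eq_mul]
          _ ≤ _ := by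
            refine sum_le_sum fun y hy ↦ ?_
            rw [card_image_of_injective _ fun z z' h ↦ (Prod.mk.inj h).2]
            exact (hDd y hy).le
      · intro y _ y' _ hne
        rw [Function.onFun, disjoint_left]
        intro p hp hp'
        obtain ⟨z, -, rfl⟩ := mem_image.1 hp
        obtain ⟨z', -, h⟩ := mem_image.1 hp'
        exact hne (Prod.mk.inj h).1.symm
    have hle : P.card ≤ 2 * (coverSets M X).card := by
      refine card_le_mul_card_image_of_maps_to
        (f := fun p : Fin n × Fin n ↦ insert p.2 (insert p.1 X)) (fun p hp ↦ ?_) 2 fun Q _ ↦ ?_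
      · obtain ⟨h1, h2⟩ := hPm p hp
        obtain ⟨h3, h4, h5⟩ := hPX p hp
        obtain ⟨B, hBX, hB, hBr⟩ := hKB _ h1
        have hBD : Disjoint B (D p.1) := disjoint_of_subset_left hBX (hyD _ h1)
        refine mem_coverSets.2 ⟨(subset_insert _ _).trans (subset_insert _ _),
          spanning_of_indep_subset h.1 h.2.1
            (indep_insert_of_mem_cocircuit h.1 hB (hDc _ h1) hBD h2) ?_
            (insert_subset_insert _ hBX), ?_⟩
        · rw [card_insert_of_notMem (disjoint_right.1 hBD h2), hBr]
        · rw [card_insert_of_notMem (by rw [mem_insert, not_or]; exact ⟨h5, h4⟩),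
            card_insert_of_notMem h3, hXr, h.2.1]
          push_cast
          rfl
      · obtain h0 | ⟨p, hp⟩ := (P.filter fun p ↦ insert p.2 (insert p.1 X) = Q).eq_empty_or_nonempty
        · rw [h0, card_empty]
          omega
        refine (card_le_card (t := {(p.1, p.2), (p.2, p.1)}) fun q hq ↦ ?_).trans card_le_two
        rw [mem_filter] at hp hq
        obtain ⟨h1, h2, h3⟩ := hPX p hp.1
        obtain ⟨h4, h5, h6⟩ := hPX q hq.1
        have h7 := hq.2.trans hp.2.symm
        have h8 : q.1 ∈ insert p.2 (insert p.1 X) := by rw [← h7]; simp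
        have h9 : q.2 ∈ insert p.2 (insert p.1 X) := by rw [← h7]; simp
        simp only [mem_insert, h4, h5, or_false] at h8 h9
        simp only [mem_insert, mem_singleton, Prod.ext_iff]
        rcases h8 with h8 | h8 <;> rcases h9 with h9 | h9
        · exact absurd (h9.trans h8.symm) h6
        · exact Or.inr ⟨h8, h9⟩
        · exact Or.inl ⟨h8, h9⟩
        · exact absurd (h9.trans h8.symm) h6
    have h1 : s * (2 * d) = 2 * (s * d) := by ring
    omega
  refine (Nat.mul_le_mul_right _ (card_le_card hsub)).trans ?_
  have := card_large_heavyCircuits_mul_le (s := 0) (β := s * d) h.2.1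
  rwa [Fintype.card_fin] at this

end Truncation

/-! ### Counting small families, and averaging over fibres -/

section Families

/-- The families of at most `w` subsets of `Fin n`. -/
noncomputable def smallFamilies (n w : ℕ) : Finset (Finset (Finset (Fin n))) :=
  univ.filter fun S ↦ S.card ≤ w

theorem mem_smallFamilies {n w : ℕ} {S : Finset (Finset (Fin n))} :
    S ∈ smallFamilies n w ↔ S.card ≤ w := by
  simp [smallFamilies]

theorem succ_pow_self_le (q : ℕ) : (q + 1) ^ q ≤ q ^ q * 4 := by
  obtain rfl | hq := Nat.eq_zero_or_pos q
  · simp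
  have h1 : (1 + 1 / (q : ℝ)) ^ q ≤ 4 := by
    calc (1 + 1 / (q : ℝ)) ^ q ≤ (Real.exp (1 / q)) ^ q := by
          refine pow_le_pow_left₀ (by positivity) ?_ q
          rw [add_comm]
          exact Real.add_one_le_exp _
      _ = Real.exp 1 := by
          rw [← Real.exp_nat_mul, mul_one_div_cancel (by positivity)]
      _ ≤ 4 := by linarith [Real.exp_one_lt_d9]
  have h2 : ((q : ℝ) + 1) ^ q = q ^ q * (1 + 1 / (q : ℝ)) ^ q := by
    rw [← mul_pow]
    congr 1
    field_simp
  have h3 : ((q : ℝ) + 1) ^ q ≤ q ^ q * 4 := by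
    rw [h2]
    exact mul_le_mul_of_nonneg_left h1 (by positivity)
  exact_mod_cast h3

/-- Give each family of size `k` the weight `q ^ (-k)` with `q = 2 ^ p`. The total is `(1 + 1 / q) ^
(2 ^ n)`, at most `4 ^ (2 ^ n / q)`, and each family counted weighs at least `q ^ (-w)`. -/
theorem card_smallFamilies_le {n w p : ℕ} (hp : p ≤ n) :
    (smallFamilies n w).card ≤ 2 ^ (p * w + 2 * 2 ^ (n - p)) := by
  set q := 2 ^ p with hq
  have hq0 : 0 < q := by positivity
  have hqn : q * 2 ^ (n - p) = 2 ^ n := by rw [hq, ← pow_add, Nat.add_sub_cancel' hp]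
  have hV : (univ : Finset (Finset (Fin n))).card = 2 ^ n := by simp
  have h1 : (smallFamilies n w).card * q ^ (2 ^ n) ≤ q ^ w * (q + 1) ^ (2 ^ n) := by
    calc (smallFamilies n w).card * q ^ (2 ^ n) = ∑ _S ∈ smallFamilies n w, q ^ (2 ^ n) := by simp
      _ ≤ ∑ S ∈ smallFamilies n w, q ^ w * (1 ^ S.card * q ^ (2 ^ n - S.card)) := by
          refine sum_le_sum fun S hS ↦ ?_
          rw [mem_smallFamilies] at hS
          rw [one_pow, one_mul, ← pow_add]
          exact Nat.pow_le_pow_right hq0 (by omega)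
      _ ≤ ∑ S ∈ (univ : Finset (Finset (Fin n))).powerset,
            q ^ w * (1 ^ S.card * q ^ (2 ^ n - S.card)) :=
          sum_le_sum_of_subset fun S _ ↦ mem_powerset.2 (subset_univ S)
      _ = q ^ w * (q + 1) ^ (2 ^ n) := by
          rw [← mul_sum, ← hV, sum_pow_mul_eq_add_pow, add_comm]
  have h2 : (q + 1) ^ (2 ^ n) ≤ q ^ (2 ^ n) * 2 ^ (2 * 2 ^ (n - p)) := by
    rw [← hqn, pow_mul, pow_mul, pow_mul 2 2, ← mul_pow]
    exact Nat.pow_le_pow_left (succ_pow_self_le q) _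
  refine Nat.le_of_mul_le_mul_right (c := q ^ (2 ^ n)) (h1.trans ?_) (by positivity)
  calc q ^ w * (q + 1) ^ (2 ^ n) ≤ q ^ w * (q ^ (2 ^ n) * 2 ^ (2 * 2 ^ (n - p))) :=
        Nat.mul_le_mul_left _ h2
    _ = 2 ^ (p * w + 2 * 2 ^ (n - p)) * q ^ (2 ^ n) := by
        rw [pow_add, hq, ← pow_mul 2 p w]
        ring

theorem card_small_subsets_le (n k : ℕ) :
    ((univ : Finset (Finset (Fin n))).filter fun X ↦ X.card ≤ k).card ≤ (n + 1) ^ k := by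
  have hsub : (univ : Finset (Finset (Fin n))).filter (fun X ↦ X.card ≤ k) ⊆
      (range (k + 1)).biUnion fun i ↦ powersetCard i univ := by
    intro X hX
    rw [mem_filter] at hX
    exact mem_biUnion.2 ⟨X.card, mem_range.2 (by omega),
      mem_powersetCard.2 ⟨subset_univ _, rfl⟩⟩
  refine (card_le_card hsub).trans (card_biUnion_le.trans ?_)
  rw [add_pow]
  refine sum_le_sum fun i hi ↦ ?_
  rw [card_powersetCard, card_univ, Fintype.card_fin, one_pow, mul_one]
  have h1 : 0 < k.choose i := Nat.choose_pos (by rw [mem_range] at hi; omega)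
  exact (Nat.choose_le_pow n i).trans (Nat.le_mul_of_pos_right _ h1)

theorem pow_le_choose_mul (a j : ℕ) (ha : 0 < a) : a ^ j ≤ (j * a).choose j := by
  induction j with
  | zero => simp
  | succ j ih =>
    have h1 := Nat.add_one_mul_choose_eq ((j + 1) * a - 1) j
    have h2 : (j + 1) * a - 1 + 1 = (j + 1) * a := Nat.sub_add_cancel (by nlinarith)
    rw [h2] at h1
    have h3 : (j * a).choose j ≤ ((j + 1) * a - 1).choose j :=
      Nat.choose_le_choose _ (by rw [add_mul]; omega)
    have h4 : (j + 1) * (a * ((j + 1) * a - 1).choose j) =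
        (j + 1) * ((j + 1) * a).choose (j + 1) := by
      rw [← mul_assoc, h1]
      ring
    rw [← Nat.eq_of_mul_eq_mul_left (Nat.succ_pos j) h4, pow_succ, mul_comm]
    exact Nat.mul_le_mul_left _ (ih.trans h3)

/-- Fixing `a` bits of information and a loss of `2 ^ n` in each fibre are both paid for by the gain
`2 ^ k`, leaving a further `2 ^ n`. -/
theorem card_mul_two_pow_le_of_fibers {V ι : Type*} [DecidableEq ι] (𝒩 : Finset V) (f : V → ι)
    (Γ : Finset ι) (hf : ∀ N ∈ 𝒩, f N ∈ Γ) {k n a m : ℕ}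
    (hk : ∀ i ∈ Γ, (𝒩.filter fun N ↦ f N = i).card * 2 ^ k ≤ 2 ^ n * m) (hΓ : Γ.card ≤ 2 ^ a)
    (hak : a + 2 * n ≤ k) : 𝒩.card * 2 ^ n ≤ m := by
  have h1 : 𝒩.card * 2 ^ k ≤ 2 ^ (a + n) * m := by
    rw [card_eq_sum_card_fiberwise (t := Γ) hf, sum_mul]
    refine (sum_le_card_nsmul _ _ _ hk).trans ?_
    rw [smul_eq_mul, pow_add, mul_assoc]
    exact Nat.mul_le_mul_right _ hΓ
  refine Nat.le_of_mul_le_mul_left (c := 2 ^ (a + n)) (le_trans ?_ h1) (by positivity)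
  rw [mul_left_comm, ← pow_add]
  exact Nat.mul_le_mul_left _ (Nat.pow_le_pow_right two_pos (by omega))

end Families

/-! ### Choice of parameters and the case distinction -/

section Classes

/-- The relations between the order of magnitude `q` of the quantities to be counted, the threshold
`s` for small circuits, and the logarithm `L` of `n`. -/
structure Scale (n L q s : ℕ) : Prop where
  -- The intended values are `L = Nat.log 2 n`, `s = n / L ^ 2` and `q = n.choose (n / 2) / (n * L ^
  -- 40)`.
  le_log : 60 ≤ L
  le_threshold : n ≤ 2 * s * L ^ 2
  le_choose : q * n * L ^ 40 ≤ n.choose (n / 2)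
  choose_le : n.choose (n / 2) ≤ 2 * q * n * L ^ 40
  two_pow_le : 2 ^ n ≤ q * 2 ^ (3 * L)
  succ_pow_le : (n + 1) ^ (2 * s) ≤ q
  pow_le_threshold : 36 * L ^ 43 ≤ s
  log_le : 5 * L ≤ n

variable {n L q s r : ℕ}

theorem card_product_le_two_pow {V W : Type*} {A : Finset V} {B : Finset W} {a b : ℕ}
    (hA : A.card ≤ 2 ^ a) (hB : B.card ≤ 2 ^ b) : (A ×ˢ B).card ≤ 2 ^ (a + b) := by
  rw [card_product, pow_add]
  exact Nat.mul_le_mul hA hB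

theorem mul_pow_le_of_le (hL : 60 ≤ L) {a b c : ℕ} (hc : c ≤ 60) (hab : a < b) :
    c * L ^ a ≤ L ^ b := by
  calc c * L ^ a ≤ L * L ^ a := Nat.mul_le_mul_right _ (hc.trans hL)
    _ = L ^ (a + 1) := by rw [pow_succ, mul_comm]
    _ ≤ L ^ b := Nat.pow_le_pow_right (by omega) hab

namespace Scale

variable (h : Scale n L q s)

include h

theorem threshold_pos : 0 < s := by
  have h1 := h.pow_le_threshold
  have h2 : 0 < L ^ 43 := Nat.pow_pos (by have := h.le_log; omega)
  omega

theorem pos : 0 < n := by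
  have h1 := h.log_le
  have h2 := h.le_log
  omega

theorem le_unit : n ≤ q := by
  refine le_trans ?_ h.succ_pow_le
  have := h.threshold_pos
  exact (Nat.le_succ n).trans (Nat.le_self_pow (by omega) _)

theorem mul_pow_le_threshold : 2 * (s * (8 * L ^ 42)) ≤ s * (s - 1) := by
  have h1 : 60 * L ^ 42 ≤ L ^ 43 := mul_pow_le_of_le h.le_log le_rfl (by omega)
  have h2 := h.pow_le_threshold
  have h3 : 2 * (8 * L ^ 42) ≤ s - 1 := by
    have : 0 < L ^ 42 := Nat.pow_pos (by have := h.le_log; omega)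
    omega
  calc 2 * (s * (8 * L ^ 42)) = s * (2 * (8 * L ^ 42)) := by ring
    _ ≤ _ := Nat.mul_le_mul_left _ h3

theorem choose_le_mul (k : ℕ) : n.choose k ≤ s * (4 * q * L ^ 42) := by
  calc n.choose k ≤ n.choose (n / 2) := Nat.choose_le_middle _ _
    _ ≤ 2 * q * n * L ^ 40 := h.choose_le
    _ ≤ 2 * q * (2 * s * L ^ 2) * L ^ 40 := by
        have := h.le_threshold
        gcongr
    _ = s * (4 * q * L ^ 42) := by ring

/-- At most `q / 2` heavy circuits have more than `s` elements, by the choice `β = s * (8 * L ^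
42)`; the others number at most `(n + 1) ^ s`, again at most `q / 2`. -/
theorem heavyCircuits_mem {N : Matroid (Fin n)} (hr : N.eRank = r) :
    heavyCircuits s (s * (8 * L ^ 42)) N ∈ smallFamilies n q := by
  rw [mem_smallFamilies, ← card_filter_add_card_filter_not (fun C ↦ s < C.card)]
  have h1 := card_large_heavyCircuits_mul_le (s := s) (β := s * (8 * L ^ 42)) hr
  rw [Fintype.card_fin] at h1
  have h2 := h1.trans (h.choose_le_mul _)
  set x := ((heavyCircuits s (s * (8 * L ^ 42)) N).filter fun C ↦ s < C.card).card
  have h3 : 2 * x ≤ q := by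
    have hpos : 0 < s * (4 * L ^ 42) :=
      Nat.mul_pos h.threshold_pos (Nat.mul_pos (by norm_num)
        (Nat.pow_pos (by have := h.le_log; omega)))
    refine Nat.le_of_mul_le_mul_right (c := s * (4 * L ^ 42)) ?_ hpos
    calc 2 * x * (s * (4 * L ^ 42)) = x * (s * (8 * L ^ 42)) := by ring
      _ ≤ _ := h2
      _ = _ := by ring
  have h4 : ((heavyCircuits s (s * (8 * L ^ 42)) N).filter fun C ↦ ¬ s < C.card).card ≤
      (n + 1) ^ s := by
    refine (card_le_card fun C hC ↦ ?_).trans (card_small_subsets_le n s)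
    exact mem_filter.2 ⟨mem_univ _, not_lt.1 (mem_filter.1 hC).2⟩
  have h5 : 2 * (n + 1) ^ s ≤ q := by
    refine le_trans ?_ h.succ_pow_le
    rw [two_mul s, pow_add]
    refine Nat.mul_le_mul_right _ ?_
    have := h.pos
    have := h.threshold_pos
    exact (show 2 ≤ n + 1 by omega).trans (Nat.le_self_pow (by omega) _)
  omega

theorem certificate_mem {N : Matroid (Fin n)} (hE : N.E = Set.univ) (hr : N.eRank = r) :
    certificate s (s * (8 * L ^ 42)) N ∈ smallFamilies n q ×ˢ smallFamilies n q :=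
  mem_product.2 ⟨h.heavyCircuits_mem hr, h.heavyCircuits_mem (eRk_compl_dual hE hr).1⟩

/-- The general bound with `p = 5 * L`, for which the second term of the exponent is at most `q`. -/
theorem card_smallFamilies_le (w : ℕ) : (smallFamilies n w).card ≤ 2 ^ (5 * L * w + q) := by
  refine (MatroidTruncation.card_smallFamilies_le h.log_le).trans
    (Nat.pow_le_pow_right two_pos (Nat.add_le_add_left ?_ _))
  refine Nat.le_of_mul_le_mul_right (c := 2 ^ (5 * L)) ?_ (by positivity)
  calc 2 * 2 ^ (n - 5 * L) * 2 ^ (5 * L) = 2 * 2 ^ n := by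
        rw [mul_assoc, ← pow_add, Nat.sub_add_cancel h.log_le]
    _ ≤ 2 * (q * 2 ^ (3 * L)) := Nat.mul_le_mul_left _ h.two_pow_le
    _ = q * 2 ^ (3 * L + 1) := by ring
    _ ≤ q * 2 ^ (5 * L) := Nat.mul_le_mul_left _
        (Nat.pow_le_pow_right two_pos (by have := h.le_log; omega))

theorem two_pow_le_ncard : 2 ^ (q * L ^ 40) ≤ (matroidsOn n).ncard := by
  refine two_pow_le_ncard_matroidsOn ?_ ?_
  · have h1 := h.log_le
    have h2 := h.le_log
    omega
  · exact le_trans (le_of_eq (by ring)) h.le_choose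

theorem stable_le (h1 : 2 * s ≤ r) (h2 : r + 2 * s ≤ n) :
    n * (stableFamilies n r).card ≤ 2 ^ n * (matroidsOn n).ncard := by
  have := h.threshold_pos
  exact Nat.mul_le_mul Nat.lt_two_pow_self.le (card_stableFamilies_le (by omega) (by omega))

/-- There are at most `q` sets of size `r`, so certificate and core cost about `15 * L * q` bits,
against the `q * L ^ 40` bits of the lower bound. -/
theorem card_extreme_le (𝒩 : Finset (Matroid (Fin n)))
    (h𝒩 : ∀ N ∈ 𝒩, N.E = Set.univ ∧ N.eRank = r) (hr : r < 2 * s ∨ n < r + 2 * s) :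
    𝒩.card * 2 ^ n ≤ (matroidsOn n).ncard := by
  classical
  have hL := h.le_log
  have hnq := h.le_unit
  have hchoose : n.choose r ≤ q := by
    refine le_trans ?_ h.succ_pow_le
    have key : ∀ k < 2 * s, n.choose k ≤ (n + 1) ^ (2 * s) := fun k hk ↦
      (Nat.choose_le_pow n k).trans ((Nat.pow_le_pow_left (Nat.le_succ n) k).trans
        (Nat.pow_le_pow_right (Nat.succ_pos n) hk.le))
    obtain hr | hr := hr
    · exact key r hr
    · obtain hlt | hle := Nat.lt_or_ge n r
      · rw [Nat.choose_eq_zero_of_lt hlt]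
        exact Nat.zero_le _
      · rw [← Nat.choose_symm hle]
        exact key _ (by have := h.threshold_pos; omega)
  set β := s * (8 * L ^ 42)
  refine card_mul_two_pow_le_of_fibers 𝒩 (fun N ↦ (certificate s β N, core s β N))
    ((smallFamilies n q ×ˢ smallFamilies n q) ×ˢ smallFamilies n q) (fun N hN ↦ ?_)
    (k := q * L ^ 40) (a := (5 * L * q + q) + (5 * L * q + q) + (5 * L * q + q)) ?_ ?_ ?_
  · obtain ⟨hE, hr⟩ := h𝒩 N hN
    refine mem_product.2 ⟨h.certificate_mem hE hr, mem_smallFamilies.2 (le_trans ?_ hchoose)⟩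
    calc (core s β N).card ≤ (powersetCard r (univ : Finset (Fin n))).card :=
          card_le_card fun X hX ↦ mem_powersetCard.2
            ⟨subset_univ _, card_of_mem_residue hr (mem_residue_of_mem_core hX)⟩
      _ = n.choose r := by rw [card_powersetCard, card_univ, Fintype.card_fin]
  · rintro i -
    have h1 : (𝒩.filter fun N ↦ (certificate s β N, core s β N) = i).card ≤ 1 := by
      refine card_le_one.2 fun N hN N' hN' ↦ ?_
      rw [mem_filter] at hN hN'
      have heq := Prod.mk.inj (hN.2.trans hN'.2.symm)
      exact core_ext (h𝒩 N hN.1).1 (h𝒩 N' hN'.1).1 (h𝒩 N hN.1).2 (h𝒩 N' hN'.1).2 heq.1 heq.2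
    calc _ ≤ 1 * (matroidsOn n).ncard := Nat.mul_le_mul h1 h.two_pow_le_ncard
      _ ≤ _ := Nat.mul_le_mul_right _ Nat.one_le_two_pow
  · exact card_product_le_two_pow (card_product_le_two_pow (h.card_smallFamilies_le q)
      (h.card_smallFamilies_le q)) (h.card_smallFamilies_le q)
  · have h1 : 60 * L ^ 1 ≤ L ^ 40 := mul_pow_le_of_le hL le_rfl (by norm_num)
    rw [pow_one] at h1
    have h2 : 15 * L + 5 ≤ L ^ 40 := by omega
    calc _ ≤ q * (15 * L + 5) := by linarith
      _ ≤ _ := Nat.mul_le_mul_left _ h2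

/-- The gain `q * L ^ 2` beats the roughly `10 * L * q` bits of the certificate. -/
theorem card_coreCircuits_large_le (h1 : 2 * s ≤ r) (h2 : r + 2 * s ≤ n)
    (𝒩 : Finset (Matroid (Fin n)))
    (h𝒩 : ∀ N ∈ 𝒩, N.E = Set.univ ∧ N.eRank = r ∧
      n * (q * L ^ 2) ≤ (coreCircuits s (s * (8 * L ^ 42)) N).card * s) :
    𝒩.card * 2 ^ n ≤ (matroidsOn n).ncard := by
  classical
  have hL := h.le_log
  have hnq := h.le_unit
  refine card_mul_two_pow_le_of_fibers 𝒩 (certificate s (s * (8 * L ^ 42)))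
    (smallFamilies n q ×ˢ smallFamilies n q) (fun N hN ↦ h.certificate_mem (h𝒩 N hN).1
      (h𝒩 N hN).2.1) (k := q * L ^ 2) (a := (5 * L * q + q) + (5 * L * q + q))
    (fun Z _ ↦ ?_) ?_ ?_
  · refine le_trans ?_ (h.stable_le h1 h2)
    refine card_mul_two_pow_le_of_coreCircuits (t := 8 * L ^ 42) h.mul_pow_le_threshold le_rfl ?_
      h.pos Z _ fun N hN ↦ ?_
    · have h3 : 60 * L ^ 42 ≤ L ^ 43 := mul_pow_le_of_le h.le_log le_rfl (by omega)
      have h4 := h.pow_le_threshold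
      omega
    · rw [mem_filter] at hN
      obtain ⟨hE, hr, hk⟩ := h𝒩 N hN.1
      exact ⟨hE, hr, hN.2, hk⟩
  · exact card_product_le_two_pow (h.card_smallFamilies_le q) (h.card_smallFamilies_le q)
  · have h3 : 60 * L ^ 1 ≤ L ^ 2 := mul_pow_le_of_le hL le_rfl (by norm_num)
    rw [pow_one] at h3
    have h4 : 10 * L + 4 ≤ L ^ 2 := by omega
    calc _ ≤ q * (10 * L + 4) := by linarith
      _ ≤ _ := Nat.mul_le_mul_left _ h4

theorem coreCircuits_mem {N : Matroid (Fin n)}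
    (hN : ¬ n * (q * L ^ 2) ≤ (coreCircuits s (s * (8 * L ^ 42)) N).card * s) :
    coreCircuits s (s * (8 * L ^ 42)) N ∈ smallFamilies n (2 * q * L ^ 4) := by
  rw [mem_smallFamilies]
  refine Nat.le_of_mul_le_mul_right (c := s) ((not_le.1 hN).le.trans ?_) h.threshold_pos
  calc n * (q * L ^ 2) ≤ 2 * s * L ^ 2 * (q * L ^ 2) := Nat.mul_le_mul_right _ h.le_threshold
    _ = _ := by ring

/-- All the data are written down; the largest item costs about `5 * q * L ^ 39` bits, less than `q
* L ^ 40`. -/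
theorem card_circuitCore_small_le (𝒩 : Finset (Matroid (Fin n)))
    (h𝒩 : ∀ N ∈ 𝒩, N.E = Set.univ ∧ N.eRank = r ∧
      ¬ n * (q * L ^ 2) ≤ (coreCircuits s (s * (8 * L ^ 42)) N).card * s ∧
      (circuitCore s (s * (8 * L ^ 42)) N).card ≤ q * L ^ 38) :
    𝒩.card * 2 ^ n ≤ (matroidsOn n).ncard := by
  classical
  have hL := h.le_log
  have hnq := h.le_unit
  set β := s * (8 * L ^ 42)
  refine card_mul_two_pow_le_of_fibers 𝒩
    (fun N ↦ (certificate s β N, coreCircuits s β N, circuitCore s β N))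
    ((smallFamilies n q ×ˢ smallFamilies n q) ×ˢ smallFamilies n (2 * q * L ^ 4) ×ˢ
      smallFamilies n (q * L ^ 38)) (fun N hN ↦ ?_)
    (k := q * L ^ 40) (a := (5 * L * q + q) + (5 * L * q + q) +
      ((5 * L * (2 * q * L ^ 4) + q) + (5 * L * (q * L ^ 38) + q))) ?_ ?_ ?_
  · obtain ⟨hE, hr, h1, h2⟩ := h𝒩 N hN
    exact mem_product.2 ⟨h.certificate_mem hE hr, mem_product.2 ⟨h.coreCircuits_mem h1,
      mem_smallFamilies.2 h2⟩⟩
  · rintro i -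
    have h1 : (𝒩.filter fun N ↦
        (certificate s β N, coreCircuits s β N, circuitCore s β N) = i).card ≤ 1 := by
      refine card_le_one.2 fun N hN N' hN' ↦ ?_
      rw [mem_filter] at hN hN'
      have heq := Prod.mk.inj (hN.2.trans hN'.2.symm)
      have heq' := Prod.mk.inj heq.2
      exact ext_of_coreCircuits (h𝒩 N hN.1).1 (h𝒩 N' hN'.1).1 (h𝒩 N hN.1).2.1 (h𝒩 N' hN'.1).2.1
        heq.1 heq'.1 heq'.2
    calc _ ≤ 1 * (matroidsOn n).ncard := Nat.mul_le_mul h1 h.two_pow_le_ncard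
      _ ≤ _ := Nat.mul_le_mul_right _ Nat.one_le_two_pow
  · exact card_product_le_two_pow (card_product_le_two_pow (h.card_smallFamilies_le q)
      (h.card_smallFamilies_le q)) (card_product_le_two_pow (h.card_smallFamilies_le _)
      (h.card_smallFamilies_le _))
  · have h1 : 60 * L ^ 39 ≤ L ^ 40 := mul_pow_le_of_le hL le_rfl (by norm_num)
    have h2 : L ≤ L ^ 39 := Nat.le_self_pow (by norm_num) _
    have h3 : L ^ 5 ≤ L ^ 39 := Nat.pow_le_pow_right (by omega) (by norm_num)
    have h4 : 10 * L + 10 * L ^ 5 + 5 * L ^ 39 + 6 ≤ L ^ 40 := by omega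
    calc _ ≤ q * (10 * L + 10 * L ^ 5 + 5 * L ^ 39 + 6) := by
          have e1 : 5 * L * (2 * q * L ^ 4) = q * (10 * L ^ 5) := by ring
          have e2 : 5 * L * (q * L ^ 38) = q * (5 * L ^ 39) := by ring
          rw [e1, e2]
          linarith
      _ ≤ _ := Nat.mul_le_mul_left _ h4

theorem two_pow_mul_pow_le {d : ℕ} (hd : 0 < d) :
    2 ^ n * d ^ (3 * L) ≤ q * (3 * L * (2 * d)).choose (3 * L) := by
  calc 2 ^ n * d ^ (3 * L) ≤ q * 2 ^ (3 * L) * d ^ (3 * L) :=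
        Nat.mul_le_mul_right _ h.two_pow_le
    _ = q * (2 * d) ^ (3 * L) := by rw [mul_pow, mul_assoc]
    _ ≤ _ := Nat.mul_le_mul_left _ (pow_le_choose_mul _ _ (by omega))

/-- Besides certificate and core circuits, fix the small cocircuits of `M` and the at most `4 * q`
circuit members avoiding none of them. The exchanges gain `q * L ^ 6`, while the largest fixed item
costs about `10 * q * L ^ 5` bits. -/
theorem card_circuitCore_large_le (h1 : 2 * s ≤ r) (h2 : r + 2 * s ≤ n)
    (𝒩 : Finset (Matroid (Fin n)))
    (h𝒩 : ∀ N ∈ 𝒩, N.E = Set.univ ∧ N.eRank = r ∧ IsTruncationOfAnother N ∧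
      ¬ n * (q * L ^ 2) ≤ (coreCircuits s (s * (8 * L ^ 42)) N).card * s ∧
      q * L ^ 38 ≤ (circuitCore s (s * (8 * L ^ 42)) N).card) :
    𝒩.card * 2 ^ n ≤ (matroidsOn n).ncard := by
  classical
  have hL := h.le_log
  have hL0 : 0 < L := by omega
  have hnq := h.le_unit
  have hs0 := h.threshold_pos
  have hβ := h.mul_pow_le_threshold
  have hL43 : 60 * L ^ 42 ≤ L ^ 43 := mul_pow_le_of_le h.le_log le_rfl (by omega)
  have hsL := h.pow_le_threshold
  set β := s * (8 * L ^ 42)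
  set Δ := 2 * L ^ 42 with hΔ
  have hΔs : 2 * Δ ≤ s := by omega
  have hex : ∀ N ∈ 𝒩, ∃ M, IsProperTruncation M N r := fun N hN ↦
    exists_isProperTruncation (h𝒩 N hN).1 (h𝒩 N hN).2.1 (h𝒩 N hN).2.2.1
  choose! M hM using hex
  set 𝒟 : Matroid (Fin n) → Finset (Finset (Fin n)) := fun N ↦ smallCocircuits (M N) Δ with h𝒟
  set I₀ : Matroid (Fin n) → Finset (Finset (Fin n)) := fun N ↦
    (circuitCore s β N).filter fun X ↦ ∃ D ∈ 𝒟 N, Disjoint X D with hI₀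
  set I₁ : Matroid (Fin n) → Finset (Finset (Fin n)) := fun N ↦
    (circuitCore s β N).filter fun X ↦ ¬ ∃ D ∈ 𝒟 N, Disjoint X D with hI₁
  -- Used with `k = 42` to bound the exceptional part `I₁`, and with `k = 6` to give almost all of
  -- the large circuit core a cocircuit small enough for the conflict bound.
  have hfew : ∀ N ∈ 𝒩, ∀ k ≤ 42, ((circuitCore s β N).filter fun X ↦
      ¬ ∃ D ∈ 𝒟 N, Disjoint X D ∧ D.card ≤ 2 * L ^ k).card ≤ 4 * q * L ^ (42 - k) := by
    intro N hN k hk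
    obtain ⟨hE, hr, -⟩ := h𝒩 N hN
    have h3 := card_not_avoiding_mul_le (d := L ^ k) (hM N hN) hE hr hβ
      (Nat.mul_le_mul_left 2 (Nat.pow_le_pow_right hL0 hk)) _ fun X hX ↦ mem_filter.1 hX
    refine Nat.le_of_mul_le_mul_right (c := s * L ^ k) ((h3.trans (h.choose_le_mul _)).trans ?_)
      (Nat.mul_pos hs0 (Nat.pow_pos hL0))
    refine le_of_eq ?_
    calc s * (4 * q * L ^ 42) = s * (4 * q * L ^ (42 - k + k)) := by rw [Nat.sub_add_cancel hk]
      _ = _ := by rw [pow_add]; ring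
  have hI₁q : ∀ N ∈ 𝒩, (I₁ N).card ≤ 4 * q := fun N hN ↦ by
    refine (card_le_card fun X hX ↦ ?_).trans ((hfew N hN 42 le_rfl).trans (by simp))
    rw [hI₁, mem_filter] at hX
    exact mem_filter.2 ⟨hX.1, fun ⟨D, hD, hXD, _⟩ ↦ hX.2 ⟨D, hD, hXD⟩⟩
  refine card_mul_two_pow_le_of_fibers 𝒩
    (fun N ↦ (certificate s β N, coreCircuits s β N, I₁ N, 𝒟 N))
    ((smallFamilies n q ×ˢ smallFamilies n q) ×ˢ smallFamilies n (2 * q * L ^ 4) ×ˢ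
      smallFamilies n (4 * q) ×ˢ smallFamilies n q) (fun N hN ↦ ?_)
    (k := q * L ^ 6) (a := (5 * L * q + q) + (5 * L * q + q) +
      ((5 * L * (2 * q * L ^ 4) + q) + ((5 * L * (4 * q) + q) + (5 * L * q + q)))) ?_ ?_ ?_
  · obtain ⟨hE, hr, -, h3, -⟩ := h𝒩 N hN
    refine mem_product.2 ⟨h.certificate_mem hE hr, mem_product.2 ⟨h.coreCircuits_mem h3,
      mem_product.2 ⟨mem_smallFamilies.2 (hI₁q N hN), mem_smallFamilies.2 ?_⟩⟩⟩
    calc (𝒟 N).card ≤ ((univ : Finset (Finset (Fin n))).filter fun X ↦ X.card ≤ Δ).card :=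
          card_le_card fun D hD ↦ mem_filter.2 ⟨mem_univ _, (mem_smallCocircuits.1 hD).2⟩
      _ ≤ (n + 1) ^ Δ := card_small_subsets_le n Δ
      _ ≤ (n + 1) ^ (2 * s) := Nat.pow_le_pow_right (Nat.succ_pos n) (by omega)
      _ ≤ q := h.succ_pow_le
  · rintro ⟨Z, 𝒦, I', 𝒟'⟩ -
    refine le_trans ?_ (h.stable_le h1 h2)
    set 𝒩' := 𝒩.filter fun N ↦ (certificate s β N, coreCircuits s β N, I₁ N, 𝒟 N) = (Z, 𝒦, I', 𝒟')
      with h𝒩'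
    have hmem : ∀ N ∈ 𝒩', N ∈ 𝒩 ∧ certificate s β N = Z ∧ coreCircuits s β N = 𝒦 ∧ I₁ N = I' ∧
        𝒟 N = 𝒟' := fun N hN ↦ by
      obtain ⟨hN, heq⟩ := mem_filter.1 hN
      obtain ⟨e1, e2⟩ := Prod.mk.inj heq
      obtain ⟨e2, e3⟩ := Prod.mk.inj e2
      exact ⟨hN, e1, e2, Prod.mk.inj e3⟩
    obtain h0 | ⟨N₀, hN₀⟩ := 𝒩'.eq_empty_or_nonempty
    · rw [h0, card_empty, zero_mul]
      exact Nat.zero_le _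
    have hinj : Set.InjOn I₀ (𝒩' : Set (Matroid (Fin n))) := fun N hN N' hN' heq ↦ by
      obtain ⟨hN1, hN2, hN3, hN4, hN5⟩ := hmem N hN
      obtain ⟨hN1', hN2', hN3', hN4', hN5'⟩ := hmem N' hN'
      refine ext_of_coreCircuits (h𝒩 N hN1).1 (h𝒩 N' hN1').1 (h𝒩 N hN1).2.1 (h𝒩 N' hN1').2.1
        (hN2.trans hN2'.symm) (hN3.trans hN3'.symm) ?_
      have key : ∀ N, circuitCore s β N = I₀ N ∪ I₁ N := fun N ↦
        (filter_union_filter_not_eq _ _).symm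
      rw [key N, key N', hN4, hN4', heq]
    rw [← card_image_of_injOn hinj]
    -- With `j = 3 * L`, taking `b` and `b'` as `j` times twice the size bound makes the binomial
    -- coefficient absorb `2 ^ n ≤ q * 2 ^ (3 * L)`, so at most `w = q` members are discarded for
    -- each bound.
    refine card_mul_two_pow_le_of_uniquelyAvoided (Δ := Δ) (δ := 2 * L ^ 6) (j := 3 * L) (s := s)
      (b := 3 * L * (2 * (2 * L ^ 6))) (b' := 3 * L * (2 * Δ)) (w := q) (m := q * L ^ 37 + 2 * q)
      (𝒟 := 𝒟') ?_ _ ?_ ?_ ?_ ?_ (h.two_pow_mul_pow_le (by positivity))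
      (Nat.le_mul_of_pos_right _ (by positivity)) (h.two_pow_mul_pow_le (by positivity))
      (Nat.le_mul_of_pos_right _ (by positivity)) ?_ h.pos
    · obtain ⟨-, -, -, -, rfl⟩ := hmem N₀ hN₀
      intro D hD
      rw [h𝒟, mem_smallCocircuits] at hD
      exact ⟨by exact_mod_cast hD.1.nonempty, hD.2⟩
    · intro I hI
      obtain ⟨N, hN, rfl⟩ := mem_image.1 hI
      obtain ⟨hE, hr, -⟩ := h𝒩 N (hmem N hN).1
      have hsub : I₀ N ⊆ core s β N := fun X hX ↦ (mem_circuitCore.1 (mem_filter.1 hX).1).1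
      exact mem_stableFamilies.2 ⟨fun X hX ↦ card_of_mem_residue hr
        (mem_residue_of_mem_core (hsub hX)), (stable_core hE hr hβ).mono hsub⟩
    · intro I hI X hX
      obtain ⟨N, hN, rfl⟩ := mem_image.1 hI
      obtain ⟨hN1, -, -, -, hN5⟩ := hmem N hN
      obtain ⟨hE, hr, -⟩ := h𝒩 N hN1
      rw [hI₀, mem_filter] at hX
      obtain ⟨hX, D, hD, hXD⟩ := hX
      rw [← hN5]
      exact uniquelyAvoided_smallCocircuits (hM N hN1) hE hr hβ hΔs hX hD hXD
    · intro I hI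
      obtain ⟨N, hN, rfl⟩ := mem_image.1 hI
      obtain ⟨hN1, -, -, -, hN5⟩ := hmem N hN
      obtain ⟨hE, hr, -, -, hbig⟩ := h𝒩 N hN1
      refine ⟨(circuitCore s β N).filter fun X ↦ ∃ D ∈ 𝒟 N, Disjoint X D ∧ D.card ≤ 2 * L ^ 6,
        fun X hX ↦ ?_, ?_, fun X hX ↦ hN5 ▸ (mem_filter.1 hX).2⟩
      · obtain ⟨hX, D, hD, hXD, -⟩ := mem_filter.1 hX
        exact mem_filter.2 ⟨hX, D, hD, hXD⟩
      · have h3 := hfew N hN1 6 (by norm_num)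
        have h4 := card_filter_add_card_filter_not (s := circuitCore s β N)
          (fun X ↦ ∃ D ∈ 𝒟 N, Disjoint X D ∧ D.card ≤ 2 * L ^ 6)
        have h5 : 60 * L ^ 37 ≤ L ^ 38 := mul_pow_le_of_le hL le_rfl (by norm_num)
        have h6 : L ^ 36 ≤ L ^ 37 := Nat.pow_le_pow_right hL0 (by norm_num)
        have h7 : 0 < L ^ 36 := Nat.pow_pos hL0
        have h8 : q * (L ^ 37 + 2 + 4 * L ^ 36) ≤ q * L ^ 38 :=
          Nat.mul_le_mul_left _ (by omega)
        have h9 : q * (L ^ 37 + 2 + 4 * L ^ 36) = q * L ^ 37 + 2 * q + 4 * q * L ^ 36 := by ring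
        have h10 : 42 - 6 = 36 := rfl
        rw [h10] at h3
        omega
    -- This is the origin of the bound `36 * L ^ 43 ≤ s`: at most `s` elements of `X` are two-hits,
    -- and `r ≥ 2 * s` leaves `s` choices of `f`.
    · have h3 : 3 * (3 * L * (2 * Δ)) = 36 * L ^ 43 := by rw [hΔ]; ring
      omega
    · have h3 : q * L ^ 37 + 2 * q - 2 * q = q * L ^ 37 := Nat.add_sub_cancel _ _
      rw [h3]
      have h4 : (3 * (3 * L * (2 * (2 * L ^ 6)))) ^ 2 * (2 * L ^ 6) ^ 2 + 1 ≤ 5185 * L ^ 26 := by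
        have h5 : (3 * (3 * L * (2 * (2 * L ^ 6)))) ^ 2 * (2 * L ^ 6) ^ 2 = 5184 * L ^ 26 := by ring
        have h6 : 0 < L ^ 26 := Nat.pow_pos hL0
        omega
      calc _ ≤ 2 * s * L ^ 2 * (q * L ^ 6 * (5185 * L ^ 26)) :=
            Nat.mul_le_mul h.le_threshold (Nat.mul_le_mul_left _ h4)
        _ = q * s * (10370 * L ^ 34) := by ring
        _ ≤ q * s * (L ^ 3 * L ^ 34) := by
            refine Nat.mul_le_mul_left _ (Nat.mul_le_mul_right _ ?_)
            exact (show 10370 ≤ 60 ^ 3 by norm_num).trans (Nat.pow_le_pow_left hL 3)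
        _ = _ := by ring
  · exact card_product_le_two_pow (card_product_le_two_pow (h.card_smallFamilies_le q)
      (h.card_smallFamilies_le q)) (card_product_le_two_pow (h.card_smallFamilies_le _)
      (card_product_le_two_pow (h.card_smallFamilies_le _) (h.card_smallFamilies_le _)))
  · have h3 : 60 * L ^ 5 ≤ L ^ 6 := mul_pow_le_of_le hL le_rfl (by norm_num)
    have h4 : L ≤ L ^ 5 := Nat.le_self_pow (by norm_num) _
    have h5 : 10 * L ^ 5 + 35 * L + 7 ≤ L ^ 6 := by omega
    calc _ ≤ q * (10 * L ^ 5 + 35 * L + 7) := by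
          have e1 : 5 * L * (2 * q * L ^ 4) = q * (10 * L ^ 5) := by ring
          rw [e1]
          linarith
      _ ≤ _ := Nat.mul_le_mul_left _ h5

/-- Few matroids of a given rank are truncations. -/
theorem card_truncations_le (𝒩 : Finset (Matroid (Fin n)))
    (h𝒩 : ∀ N ∈ 𝒩, N.E = Set.univ ∧ N.eRank = r ∧ IsTruncationOfAnother N) :
    𝒩.card * 2 ^ n ≤ 3 * (matroidsOn n).ncard := by
  classical
  by_cases hr : r < 2 * s ∨ n < r + 2 * s
  · have := h.card_extreme_le 𝒩 (fun N hN ↦ ⟨(h𝒩 N hN).1, (h𝒩 N hN).2.1⟩) hr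
    omega
  obtain ⟨h1, h2⟩ := not_or.1 hr
  rw [not_lt] at h1 h2
  set A := 𝒩.filter fun N ↦ n * (q * L ^ 2) ≤ (coreCircuits s (s * (8 * L ^ 42)) N).card * s
  set A' := 𝒩.filter fun N ↦ ¬ n * (q * L ^ 2) ≤ (coreCircuits s (s * (8 * L ^ 42)) N).card * s
  set B := A'.filter fun N ↦ (circuitCore s (s * (8 * L ^ 42)) N).card ≤ q * L ^ 38
  set C := A'.filter fun N ↦ ¬ (circuitCore s (s * (8 * L ^ 42)) N).card ≤ q * L ^ 38
  have hA := h.card_coreCircuits_large_le h1 h2 A fun N hN ↦ by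
    obtain ⟨hN, hk⟩ := mem_filter.1 hN
    exact ⟨(h𝒩 N hN).1, (h𝒩 N hN).2.1, hk⟩
  have hB := h.card_circuitCore_small_le (r := r) B fun N hN ↦ by
    obtain ⟨hN, hc⟩ := mem_filter.1 hN
    obtain ⟨hN, hk⟩ := mem_filter.1 hN
    exact ⟨(h𝒩 N hN).1, (h𝒩 N hN).2.1, hk, hc⟩
  have hC := h.card_circuitCore_large_le h1 h2 C fun N hN ↦ by
    obtain ⟨hN, hc⟩ := mem_filter.1 hN
    obtain ⟨hN, hk⟩ := mem_filter.1 hN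
    exact ⟨(h𝒩 N hN).1, (h𝒩 N hN).2.1, (h𝒩 N hN).2.2, hk, (not_le.1 hc).le⟩
  have e1 : A.card + A'.card = 𝒩.card := card_filter_add_card_filter_not _
  have e2 : B.card + C.card = A'.card := card_filter_add_card_filter_not _
  rw [← e1, ← e2, add_mul, add_mul]
  omega

end Scale

/-- If `n` admits a scale, few matroids on `n` elements are truncations. -/
theorem ncard_truncations_le (h : Scale n L q s) :
    ({N : Matroid (Fin n) | IsTruncationOfAnother N} ∩ matroidsOn n).ncard * 2 ^ n ≤
      3 * (n + 1) * (matroidsOn n).ncard := by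
  classical
  have := finite_matroid n
  set 𝒩 : ℕ → Finset (Matroid (Fin n)) := fun r ↦ (Set.toFinite {N : Matroid (Fin n) |
    N.E = Set.univ ∧ N.eRank = r ∧ IsTruncationOfAnother N}).toFinset with h𝒩
  have hsub : {N : Matroid (Fin n) | IsTruncationOfAnother N} ∩ matroidsOn n ⊆
      ((range (n + 1)).biUnion 𝒩 : Finset (Matroid (Fin n))) := by
    rintro N ⟨hN, hE⟩
    obtain ⟨B, hB⟩ := N.exists_isBase
    lift B to Finset (Fin n) using Set.toFinite _
    have hBr := hB.encard_eq_eRank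
    rw [Set.encard_coe_eq_coe_finsetCard] at hBr
    have hBn : B.card ≤ n := (card_le_univ B).trans (Fintype.card_fin n).le
    rw [mem_coe, mem_biUnion]
    refine ⟨B.card, mem_range.2 (by omega), ?_⟩
    rw [h𝒩, Set.Finite.mem_toFinset]
    exact ⟨hE, hBr.symm, hN⟩
  have h1 := Set.ncard_le_ncard hsub (Finset.finite_toSet _)
  rw [Set.ncard_coe_finset] at h1
  have h2 : ∀ r ∈ range (n + 1), (𝒩 r).card * 2 ^ n ≤ 3 * (matroidsOn n).ncard := fun r _ ↦
    h.card_truncations_le (r := r) _ fun N hN ↦ by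
      rwa [h𝒩, Set.Finite.mem_toFinset] at hN
  calc _ ≤ (∑ r ∈ range (n + 1), (𝒩 r).card) * 2 ^ n :=
        Nat.mul_le_mul_right _ (h1.trans card_biUnion_le)
    _ = ∑ r ∈ range (n + 1), (𝒩 r).card * 2 ^ n := sum_mul _ _ _
    _ ≤ (n + 1) * (3 * (matroidsOn n).ncard) := by
        have := sum_le_card_nsmul _ _ _ h2
        rwa [card_range, smul_eq_mul] at this
    _ = _ := by ring

end Classes

/-! ### Existence of the parameters for large `n`, and the limit -/

section Asymptotics

theorem two_pow_le_succ_mul_choose (n : ℕ) : 2 ^ n ≤ (n + 1) * n.choose (n / 2) := by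
  rw [← Nat.sum_range_choose]
  refine (sum_le_card_nsmul _ _ _ fun k _ ↦ Nat.choose_le_middle k n).trans ?_
  rw [card_range, smul_eq_mul]

theorem le_two_mul_div_mul {a b : ℕ} (hb : 0 < b) (hab : b ≤ a) : a ≤ 2 * (a / b) * b := by
  have h1 := Nat.lt_div_mul_add hb (a := a)
  have h2 : 1 ≤ a / b := (Nat.one_le_div_iff hb).2 hab
  have h3 : 1 * b ≤ a / b * b := Nat.mul_le_mul_right b h2
  calc a ≤ a / b * b + a / b * b := by omega
    _ = _ := by ring

theorem scale_of_log_large {n : ℕ} (hL : 60 ≤ Nat.log 2 n)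
    (hpow : 36 * Nat.log 2 n ^ 45 ≤ 2 ^ Nat.log 2 n) :
    Scale n (Nat.log 2 n) (n.choose (n / 2) / (n * Nat.log 2 n ^ 40))
      (n / Nat.log 2 n ^ 2) := by
  have hn0 : n ≠ 0 := by
    rintro rfl
    simp at hL
  have hlow : 2 ^ Nat.log 2 n ≤ n := Nat.pow_log_le_self 2 hn0
  have hup : n + 1 ≤ 2 ^ (Nat.log 2 n + 1) := Nat.lt_pow_succ_log_self one_lt_two n
  set L := Nat.log 2 n
  set c := n.choose (n / 2)
  set s := n / L ^ 2 with hs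
  have hL0 : 0 < L := by omega
  have hLn : 36 * L ^ 45 ≤ n := hpow.trans hlow
  have h40 : 8 * L ^ 40 ≤ 2 ^ L := by
    have : L ^ 40 ≤ L ^ 45 := Nat.pow_le_pow_right hL0 (by norm_num)
    omega
  have h60 : 60 * L ≤ n := by
    have h1 : 60 * L ^ 1 ≤ L ^ 45 := mul_pow_le_of_le hL le_rfl (by norm_num)
    rw [pow_one] at h1
    omega
  have hs43 : 36 * L ^ 43 ≤ s := by
    rw [hs, Nat.le_div_iff_mul_le (Nat.pow_pos hL0)]
    calc 36 * L ^ 43 * L ^ 2 = 36 * L ^ 45 := by ring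
      _ ≤ n := hLn
  have hnL : 8 * (n * (n + 1) * L ^ 40) ≤ 2 ^ (3 * L + 2) := by
    calc 8 * (n * (n + 1) * L ^ 40) = n * (n + 1) * (8 * L ^ 40) := by ring
      _ ≤ 2 ^ (L + 1) * 2 ^ (L + 1) * 2 ^ L :=
          Nat.mul_le_mul (Nat.mul_le_mul ((Nat.le_succ n).trans hup) hup) h40
      _ = _ := by ring
  have hcn := two_pow_le_succ_mul_choose n
  have hnc : n * L ^ 40 ≤ c := by
    refine Nat.le_of_mul_le_mul_left (c := n + 1) (le_trans ?_ hcn) (Nat.succ_pos n)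
    calc (n + 1) * (n * L ^ 40) = 1 * (n * (n + 1) * L ^ 40) := by ring
      _ ≤ 8 * (n * (n + 1) * L ^ 40) := Nat.mul_le_mul_right _ (by norm_num)
      _ ≤ 2 ^ (3 * L + 2) := hnL
      _ ≤ 2 ^ n := Nat.pow_le_pow_right two_pos (by omega)
  have hpos : 0 < n * L ^ 40 := Nat.mul_pos (Nat.pos_of_ne_zero hn0) (Nat.pow_pos hL0)
  have hc2 : c ≤ 2 * (c / (n * L ^ 40)) * (n * L ^ 40) := le_two_mul_div_mul hpos hnc
  set q := c / (n * L ^ 40) with hq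
  have h2n : 2 ^ n ≤ q * 2 ^ (3 * L) := by
    calc 2 ^ n ≤ (n + 1) * (2 * q * (n * L ^ 40)) := hcn.trans (Nat.mul_le_mul_left _ hc2)
      _ = 2 * q * (n * (n + 1) * L ^ 40) := by ring
      _ ≤ q * 2 ^ (3 * L) := by
          have h1 : 2 * (n * (n + 1) * L ^ 40) ≤ 2 ^ (3 * L) := by
            rw [pow_add] at hnL
            omega
          calc 2 * q * (n * (n + 1) * L ^ 40) = q * (2 * (n * (n + 1) * L ^ 40)) := by ring
            _ ≤ _ := Nat.mul_le_mul_left _ h1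
  refine ⟨hL, ?_, ?_, ?_, h2n, ?_, hs43, by omega⟩
  · refine le_two_mul_div_mul (Nat.pow_pos hL0) (le_trans ?_ hLn)
    exact (Nat.pow_le_pow_right hL0 (by norm_num)).trans (Nat.le_mul_of_pos_left _ (by norm_num))
  · rw [mul_assoc]
    exact Nat.div_mul_le_self _ _
  · rwa [mul_assoc _ n]
  · have h1 : s * L ^ 2 ≤ n := Nat.div_mul_le_self _ _
    -- As `s` is about `n / L ^ 2`, the number `(n + 1) ^ (2 * s)` is only about `2 ^ (2 * n / L)`,
    -- far below `q`.
    have h2 : (L + 1) * (2 * s) + 3 * L ≤ n := by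
      have h3 : (L + 1) * (2 * s) ≤ 4 * (s * L) := by nlinarith
      have h4 : 60 * (s * L) ≤ s * L ^ 2 := by
        calc 60 * (s * L) ≤ L * (s * L) := Nat.mul_le_mul_right _ hL
          _ = _ := by ring
      omega
    refine Nat.le_of_mul_le_mul_right (c := 2 ^ (3 * L)) (le_trans ?_ h2n) (by positivity)
    calc (n + 1) ^ (2 * s) * 2 ^ (3 * L) ≤ (2 ^ (L + 1)) ^ (2 * s) * 2 ^ (3 * L) :=
          Nat.mul_le_mul_right _ (Nat.pow_le_pow_left hup _)
      _ = 2 ^ ((L + 1) * (2 * s) + 3 * L) := by rw [← pow_mul, ← pow_add]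
      _ ≤ 2 ^ n := Nat.pow_le_pow_right two_pos h2

open Filter Topology

theorem eventually_exists_scale : ∀ᶠ n : ℕ in atTop, ∃ L q s, Scale n L q s := by
  have hlog : Tendsto (Nat.log 2) atTop atTop :=
    tendsto_atTop_atTop.2 fun b ↦ ⟨2 ^ b, fun n hn ↦ Nat.le_log_of_pow_le one_lt_two hn⟩
  have hpow : ∀ᶠ L : ℕ in atTop, 36 * L ^ 45 ≤ 2 ^ L := by
    have h := tendsto_pow_const_div_const_pow_of_one_lt 45 (one_lt_two (α := ℝ))
    filter_upwards [h.eventually (ge_mem_nhds (show (0 : ℝ) < 1 / 36 by norm_num))] with L hL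
    rw [div_le_div_iff₀ (by positivity) (by norm_num)] at hL
    have h2 : (36 : ℝ) * (L : ℝ) ^ 45 ≤ 2 ^ L := by linarith
    exact_mod_cast h2
  filter_upwards [hlog.eventually hpow, hlog.eventually (eventually_ge_atTop 60)] with n h1 h2
  exact ⟨_, _, _, scale_of_log_large h2 h1⟩

theorem tendsto_succ_div_two_pow :
    Tendsto (fun n : ℕ ↦ 3 * ((n : ℝ) + 1) / 2 ^ n) atTop (𝓝 0) := by
  have h1 := tendsto_pow_const_div_const_pow_of_one_lt 1 (one_lt_two (α := ℝ))
  have h2 := tendsto_pow_const_div_const_pow_of_one_lt 0 (one_lt_two (α := ℝ))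
  have h := (h1.add h2).const_mul 3
  simp only [add_zero, mul_zero] at h
  refine h.congr fun n ↦ ?_
  rw [pow_one, pow_zero]
  ring

end Asymptotics

end MatroidTruncation

theorem theorem5p4 :
    MatroidTruncation.IsThin
      (fun n : ℕ ↦ {N : Matroid (Fin n) | MatroidTruncation.IsTruncationOfAnother N}) := by
  refine squeeze_zero' (Filter.Eventually.of_forall fun n ↦ by positivity) ?_
    MatroidTruncation.tendsto_succ_div_two_pow
  filter_upwards [MatroidTruncation.eventually_exists_scale] with n ⟨L, q, s, h⟩
  have h1 := MatroidTruncation.ncard_truncations_le h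
  have h2 : 0 < (MatroidTruncation.matroidsOn n).ncard :=
    (Nat.pow_pos two_pos).trans_le h.two_pow_le_ncard
  rw [div_le_div_iff₀ (by exact_mod_cast h2) (by positivity)]
  exact_mod_cast h1
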